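/- Let $(M,g)$ be a connected oriented smooth Riemannian manifold of dimension four. Equip the bundle $\Lambda^2TM$ of two-vectors with the metric $g(v_1\wedge v_2,v_3\wedge v_4)=\frac12\det[g(v_i,v_j)]$, let $\Lambda^2_{\pm}TM$ be the subbundles of $\Lambda^2TM$ corresponding to the eigenvalues $\pm1$ of the Hodge star operator, and let $\pi:\mathcal Z\to M$ be the (negative) twistor space of $(M,g)$, that is, the bundle of unit vectors of $\Lambda^2_{-}TM$. The connection on $\Lambda^2_-TM$ induced by the Levi-Civita connection of $g$ gives a splitting $T\mathcal Z=\mathcal H\oplus\mathcal V$ into horizontal and vertical subspaces, $\mathcal V_\sigma=\{V\in\Lambda^2_-T_{\pi(\sigma)}M: g(\sigma,V)=0\}$. For $t>0$ let $h_t=\pi^*g+t\,g^v$ be the Riemannian metric on $\mathcal Z$, where $g^v$ is the restriction of the metric of $\Lambda^2TM$ to $\mathcal V$ (extended by zero on $\mathcal H$). Let $\mathcal W_-$ be the restriction to $\Lambda^2_-TM$ of the endomorphism $\mathcal W$ of $\Lambda^2TM$ corresponding to the Weyl conformal tensor; $(M,g)$ is called self-dual if $\mathcal W_-=0$. A Riemannian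 metric is called Einstein if its Ricci tensor is a constant multiple of the metric. Then, for every $t>0$, the Riemannian manifold $(\mathcal Z,h_t)$ is Einstein if and only if $(M,g)$ is self-dual and Einstein with (constant) scalar curvature $s=6/t$ or $s=12/t$. -/

import Mathlib

open scoped Manifold ContDiff Topology

noncomputable section

namespace Twistor

universe u v w

/-! ## Riemannian geometry in coordinates -/

/-- The coordinate space of dimension `n`. -/
abbrev E (n : ℕ) : Type := EuclideanSpace ℝ (Fin n)

/-- The coordinate vector `∂_i`. -/
def e {n : ℕ} (i : Fin n) : E n := EuclideanSpace.single i 1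

/-- The partial derivative `∂_i f` at `x`. -/
def pderiv {n : ℕ} (i : Fin n) (f : E n → ℝ) (x : E n) : ℝ := fderiv ℝ f x (e i)

/-- The Christoffel symbol `Γ^k_{ij}` at `x` of the metric with coefficient matrix `G`. -/
def christoffel {n : ℕ} (G : E n → Matrix (Fin n) (Fin n) ℝ) (k i j : Fin n) (x : E n) : ℝ :=
  (1 / 2) * ∑ l, (G x)⁻¹ k l *
    (pderiv i (fun y => G y j l) x + pderiv j (fun y => G y i l) x - pderiv l (fun y => G y i j) x)

/-- The coefficient of `∂_l` in `(∇_i ∇_j - ∇_j ∇_i) ∂_k` at `x`. -/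
def curvatureCoeff {n : ℕ} (G : E n → Matrix (Fin n) (Fin n) ℝ) (l i j k : Fin n) (x : E n) : ℝ :=
  pderiv i (christoffel G l j k) x - pderiv j (christoffel G l i k) x
    + ∑ m, (christoffel G l i m x * christoffel G m j k x
        - christoffel G l j m x * christoffel G m i k x)

/-- The coefficients of the Ricci tensor, `ρ(∂_j, ∂_k) = trace (X ↦ (∇_X ∇_j - ∇_j ∇_X) ∂_k)`
for coordinate fields; round spheres have positive Ricci tensor. -/
def ricciCoeff {n : ℕ} (G : E n → Matrix (Fin n) (Fin n) ℝ) (j k : Fin n) (x : E n) : ℝ :=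
  ∑ i, curvatureCoeff G i i j k x

/-! ## Submanifolds, local parametrizations, Einstein metrics -/

section Submanifold

variable {F : Type u} [NormedAddCommGroup F] [NormedSpace ℝ F] {H : Type v} [TopologicalSpace H]
  (I : ModelWithCorners ℝ F H) {N : Type w} [TopologicalSpace N] [ChartedSpace H N]

/-- The coefficient matrix of the pull-back `Ψ^* h` of a field `h` of bilinear forms along a map
`Ψ` from coordinate space. -/
def pullbackCoeff {n : ℕ} (h : (x : N) → TangentSpace I x → TangentSpace I x → ℝ) (Ψ : E n → N)
    (y : E n) : Matrix (Fin n) (Fin n) ℝ :=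
  Matrix.of fun i j => h (Ψ y) (mfderiv (𝓡 n) I Ψ y (e i)) (mfderiv (𝓡 n) I Ψ y (e j))

/-- `Ψ`, restricted to the open set `V ⊆ ℝⁿ`, is a smooth immersion into the manifold `N` with
values in `S`. If `S` is an embedded `n`-dimensional submanifold of `N`, these are exactly the local
diffeomorphisms from open subsets of `ℝⁿ` to `S`. -/
structure IsLocalParam {n : ℕ} (S : Set N) (Ψ : E n → N) (V : Set (E n)) : Prop where
  isOpen : IsOpen V
  smooth : ContMDiffOn (𝓡 n) I ∞ Ψ V
  immersive : ∀ y ∈ V, Function.Injective (mfderiv (𝓡 n) I Ψ y)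
  mapsTo : Set.MapsTo Ψ V S

/-- The `n`-dimensional submanifold `S` of `N`, with the Riemannian metric induced by the field `h`
of bilinear forms, is an Einstein manifold: `S` is covered by its local parametrizations by open
sets of `ℝⁿ`, and there is a constant `c` such that `Ric = c • h` on `S`, that is,
`Ric (Ψ^* h) = c • Ψ^* h` in every local parametrization `Ψ` of `S`. -/
def IsEinstein (n : ℕ) (S : Set N) (h : (x : N) → TangentSpace I x → TangentSpace I x → ℝ) :
    Prop :=
  (∀ z ∈ S, ∃ (Ψ : E n → N) (V : Set (E n)), IsLocalParam I S Ψ V ∧ z ∈ Ψ '' V) ∧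
  ∃ c : ℝ, ∀ (Ψ : E n → N) (V : Set (E n)), IsLocalParam I S Ψ V → ∀ y ∈ V, ∀ i j : Fin n,
    ricciCoeff (pullbackCoeff I h Ψ) i j y = c * pullbackCoeff I h Ψ y i j

end Submanifold

/-! ## Oriented Riemannian 4-manifolds

Recall that, in Mathlib, `TangentSpace (𝓡 4) p` is by definition the coordinate space `E 4`, a
tangent vector at `p` being identified with its components in the preferred chart `chartAt (E 4) p`.
-/

section Base

variable {M : Type u} [TopologicalSpace M] [ChartedSpace (E 4) M]

/-- The components of a tangent vector at `p` in the preferred chart at `p`. -/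
def coords (p : M) (X : TangentSpace (𝓡 4) p) : E 4 := X

/-- An orientation of the 4-manifold `M`: an orientation of every tangent space which, near every
point `p`, is constant in the local trivialization of `TM` given by the chart at `p`. -/
structure ManifoldOrientation (M : Type u) [TopologicalSpace M] [ChartedSpace (E 4) M]
    [IsManifold (𝓡 4) ∞ M] where
  or : (p : M) → Orientation ℝ (TangentSpace (𝓡 4) p) (Fin 4)
  locallyConstant : ∀ p : M, ∀ᶠ q in 𝓝 p,
    ∃ hq : q ∈ (trivializationAt (E 4) (TangentSpace (𝓡 4) : M → Type) p).baseSet,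
      Orientation.map (Fin 4) ((trivializationAt (E 4) (TangentSpace (𝓡 4) : M → Type)
        p).continuousLinearEquivAt ℝ q hq).toLinearEquiv (or q) = or p

variable [IsManifold (𝓡 4) ∞ M]

/-- Smooth Riemannian metrics on `M`. -/
abbrev Metric (M : Type u) [TopologicalSpace M] [ChartedSpace (E 4) M] [IsManifold (𝓡 4) ∞ M] :
    Type u :=
  Bundle.ContMDiffRiemannianMetric (𝓡 4) ∞ (E 4) (TangentSpace (𝓡 4) : M → Type)

variable (g : Metric M)

/-- The metric `g` as a field of bilinear forms. -/
def metricForm (p : M) (X Y : TangentSpace (𝓡 4) p) : ℝ := g.inner p X Y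

/-- The coefficient matrix of `g` in the preferred chart at `p`, a function on coordinate space. -/
def chartCoeff (p : M) : E 4 → Matrix (Fin 4) (Fin 4) ℝ :=
  pullbackCoeff (𝓡 4) (metricForm g) (chartAt (E 4) p).symm

/-- The Ricci tensor `ρ` of `(M, g)` at `p`. -/
def ricci (p : M) (X Y : TangentSpace (𝓡 4) p) : ℝ :=
  ∑ i, ∑ j, ricciCoeff (chartCoeff g p) i j (chartAt (E 4) p p) * coords p X i * coords p Y j

/-- The scalar curvature of `(M, g)` at `p`, the trace of `ρ` with respect to `g`. -/
def scalarCurvature (p : M) : ℝ :=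
  ∑ i, ∑ j, (chartCoeff g p (chartAt (E 4) p p))⁻¹ i j *
    ricciCoeff (chartCoeff g p) i j (chartAt (E 4) p p)

/-- The vector `R(X, Y) Z` at `p`, where `R(X, Y) = ∇_{[X, Y]} - [∇_X, ∇_Y]` (note the sign). -/
def curvature (p : M) (X Y Z : TangentSpace (𝓡 4) p) : TangentSpace (𝓡 4) p :=
  WithLp.toLp 2 fun l => - ∑ i, ∑ j, ∑ k,
    curvatureCoeff (chartCoeff g p) l i j k (chartAt (E 4) p p) *
      coords p X i * coords p Y j * coords p Z k

/-- The inner product `g(X ∧ Y, Z ∧ U) = 1/2 det` of decomposable two-vectors. -/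
def wedgeInner (p : M) (X Y Z U : TangentSpace (𝓡 4) p) : ℝ :=
  (1 / 2) * (g.inner p X Z * g.inner p Y U - g.inner p X U * g.inner p Y Z)

/-- `g(𝓑(X ∧ Y), Z ∧ U)`, where `𝓑(X ∧ Y) = A X ∧ Y + X ∧ A Y - (s/2) X ∧ Y` and `A` is the Ricci
operator, `g(A X, Z) = ρ(X, Z)`. -/
def tracelessRicciForm (p : M) (X Y Z U : TangentSpace (𝓡 4) p) : ℝ :=
  (1 / 2) * (ricci g p X Z * g.inner p Y U - ricci g p X U * g.inner p Y Z)
    + (1 / 2) * (g.inner p X Z * ricci g p Y U - g.inner p X U * ricci g p Y Z)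
    - scalarCurvature g p / 2 * wedgeInner g p X Y Z U

/-- `g(𝓦(X ∧ Y), Z ∧ U)` for the Weyl operator `𝓦 = 𝓡 - (s/6) Id - 𝓑` on two-vectors, where the
curvature operator is defined by `g(𝓡(X ∧ Y), Z ∧ U) = g(R(X, Y) Z, U)`. -/
def weylForm (p : M) (X Y Z U : TangentSpace (𝓡 4) p) : ℝ :=
  g.inner p (curvature g p X Y Z) U - scalarCurvature g p / 6 * wedgeInner g p X Y Z U
    - tracelessRicciForm g p X Y Z U

variable (o : ManifoldOrientation M)

/-- `b` is a positively oriented orthonormal basis of the tangent space at `p`. -/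
def IsOrientedOrthonormal (p : M) (b : Module.Basis (Fin 4) ℝ (TangentSpace (𝓡 4) p)) : Prop :=
  (∀ i j, g.inner p (b i) (b j) = if i = j then 1 else 0) ∧ b.orientation = o.or p

/-- `(M, g)` is self-dual: `𝓦` vanishes on `Λ²₋TM`, the bundle spanned by the two-vectors
`E₁ ∧ E₂ - E₃ ∧ E₄`, `E₁ ∧ E₃ - E₄ ∧ E₂`, `E₁ ∧ E₄ - E₂ ∧ E₃`, for `(E₁, E₂, E₃, E₄)` a positively
oriented orthonormal basis of a tangent space. -/
def IsSelfDual : Prop :=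
  ∀ (p : M) (b : Module.Basis (Fin 4) ℝ (TangentSpace (𝓡 4) p)), IsOrientedOrthonormal g o p b →
    ∀ Z U : TangentSpace (𝓡 4) p,
      weylForm g p (b 0) (b 1) Z U - weylForm g p (b 2) (b 3) Z U = 0 ∧
      weylForm g p (b 0) (b 2) Z U - weylForm g p (b 3) (b 1) Z U = 0 ∧
      weylForm g p (b 0) (b 3) Z U - weylForm g p (b 1) (b 2) Z U = 0

/-! ## The negative twistor space

A two-vector `a` at `p` is represented by the skew-symmetric endomorphism `K_a` of `T_pM` with
`g(K_a X, Y) = 2 g(a, X ∧ Y)`. Thus the bundle `Λ²TM` is the bundle of skew-symmetric endomorphisms,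
a subbundle of `End(TM)`. -/

/-- The fibres of the bundle `End(TM)`. -/
abbrev EndFibre (p : M) : Type := TangentSpace (𝓡 4) p →L[ℝ] TangentSpace (𝓡 4) p

/-- The total space of the bundle `End(TM)`, a smooth manifold. -/
abbrev EndBundle (M : Type u) [TopologicalSpace M] [ChartedSpace (E 4) M]
    [IsManifold (𝓡 4) ∞ M] : Type u :=
  Bundle.TotalSpace (E 4 →L[ℝ] E 4) (EndFibre : M → Type)

/-- The model of the manifold `End(TM)`. -/
abbrev endModel : ModelWithCorners ℝ (E 4 × (E 4 →L[ℝ] E 4)) (ModelProd (E 4) (E 4 →L[ℝ] E 4)) :=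
  (𝓡 4).prod 𝓘(ℝ, E 4 →L[ℝ] E 4)

/-- The endomorphism `K` of `T_pM` is skew-symmetric, that is, it represents a two-vector. -/
def IsTwoVector (p : M) (K : EndFibre p) : Prop :=
  ∀ X Y : TangentSpace (𝓡 4) p, g.inner p (K X) Y = - g.inner p X (K Y)

/-- The two-vector `a` with `K = K_a` satisfies `∗a = -a`, the Hodge operator being determined by
`g(∗a, E₁ ∧ E₂) = g(a, E₃ ∧ E₄)` for all positively oriented orthonormal bases. -/
def IsAntiSelfDual (p : M) (K : EndFibre p) : Prop :=
  ∀ b : Module.Basis (Fin 4) ℝ (TangentSpace (𝓡 4) p), IsOrientedOrthonormal g o p b →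
    g.inner p (K (b 2)) (b 3) = - g.inner p (K (b 0)) (b 1)

/-- The inner product of two-vectors, `g(a, b) = -1/4 trace (K_a ∘ K_b)`; it satisfies
`g(X ∧ Y, Z ∧ U) = 1/2 det`. (It is half of the metric `-1/2 trace (P ∘ Q)`.) -/
def twoVectorInner (K L : E 4 →L[ℝ] E 4) : ℝ :=
  -(1 / 4) * LinearMap.trace ℝ (E 4) (K ∘L L : E 4 →L[ℝ] E 4)

/-- The point `σ` of `End(TM)` as a matrix in the preferred chart at `π(σ)`. -/
def endo (σ : EndBundle M) : E 4 →L[ℝ] E 4 := σ.snd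

/-- The negative twistor space `𝓩 = 𝓩₋` of `(M, g)`: the bundle of unit vectors in `Λ²₋TM`. -/
def twistorSpace : Set (EndBundle M) :=
  {σ | IsTwoVector g σ.proj σ.snd ∧ IsAntiSelfDual g o σ.proj σ.snd ∧
    twoVectorInner (endo σ) (endo σ) = 1}

/-- The connection form of the Levi-Civita connection at `p`: for `X` in `T_pM`, the endomorphism
`Y ↦ Γ(X, Y)`, with Christoffel symbols taken in the preferred chart at `p`. -/
def connectionForm (p : M) (X : TangentSpace (𝓡 4) p) : E 4 →L[ℝ] E 4 :=
  Matrix.toEuclideanCLM (n := Fin 4) (𝕜 := ℝ) (Matrix.of fun k j =>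
    ∑ i, christoffel (chartCoeff g p) k i j (chartAt (E 4) p p) * coords p X i)

/-- The projection of a tangent vector of `End(TM)` at `σ` to the tangent space of `M`. In the
preferred chart of `End(TM)` at `σ`, induced by the chart of `M` at `π(σ)`, it is the first
component. -/
def horizontalPart (σ : EndBundle M) (ξ : TangentSpace endModel σ) :
    TangentSpace (𝓡 4) σ.proj :=
  (ξ : E 4 × (E 4 →L[ℝ] E 4)).1

/-- The vertical part of a tangent vector `ξ = (X, B)` of `End(TM)` at `σ`, with respect to the
horizontal distribution of the connection induced on `End(TM)` by the Levi-Civita connection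
of `g`: it is `B + [Γ(X), σ]`, that is, the covariant derivative of any curve of endomorphisms with
velocity `ξ`. -/
def verticalPart (σ : EndBundle M) (ξ : TangentSpace endModel σ) : E 4 →L[ℝ] E 4 :=
  (ξ : E 4 × (E 4 →L[ℝ] E 4)).2
    + connectionForm g σ.proj (horizontalPart σ ξ) ∘L endo σ
    - endo σ ∘L connectionForm g σ.proj (horizontalPart σ ξ)

/-- The forms `h_t = π^* g + t g^v` on the tangent spaces of `End(TM)`; they restrict to Riemannian
metrics on the twistor space. -/
def twistorMetric (t : ℝ) (σ : EndBundle M) (ξ η : TangentSpace endModel σ) : ℝ :=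
  g.inner σ.proj (horizontalPart σ ξ) (horizontalPart σ η)
    + t * twoVectorInner (verticalPart g σ ξ) (verticalPart g σ η)

end Base

end Twistor

end

noncomputable section
namespace Twistor

universe u v w

/-! ## Partial derivatives -/

section Calculus

variable {n m : ℕ} {U : Set (E n)} {x : E n} {f h : E n → ℝ}

/-! Put `r = √t`. A local oriented orthonormal frame of `M` identifies Λ²₋ with ℝ³ and its
connection with an `so(3)`-valued form θ, so that the twistor space is locally the product of `M`
and the unit sphere, with the metric `g + r² |dS + θ × S|²` (`bundleMetric`). The Ricci tensor at a
point depends only on the 2-jet of the metric there. At a given σ one may therefore use coordinates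
in which `g` is standard to first order and a frame for which θ vanishes at the origin and σ is the
axis `E₁ ∧ E₂ - E₃ ∧ E₄`. With Ω the curvature of Λ²₋, equal to `dθ` at that point, the Ricci tensor
of `h_t` has three blocks. The horizontal block is `ρ(b,d) - (t/2) ∑ Ω^k_{ba} Ω^k_{da}`, summed over
`a` and over the two components `k` orthogonal to σ. The vertical block is `1/t` times the identity
plus `t/4` times the Gram matrix of those two components. The mixed block vanishes when a divergence
of Ω does. These are `bundleMetric_ricci_hor`, `bundleMetric_ricci_ver` and
`bundleMetric_ricci_mixed`.

Suppose `Ric = c h_t`. Three points of each fibre, the axes of a frame, carry all the information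
needed, and the mixed block is not used. Comparing the horizontal equations at the three axes shows
that `Ω^k (Ω^k)ᵀ` does not depend on `k`; the vertical equations show that the `Ω^k` are orthogonal
and of equal length. Split `Ω^k` into its anti-self-dual and self-dual parts `A_k`, `B_k` in ℝ³. The
tensors `A_k ⊗ B_k` coincide for different `k`, whereas `⟨A_k, A_l⟩ + ⟨B_k, B_l⟩ = 0` for `k ≠ l`,
and this forces `A_k ⊗ B_k = 0`. Hence `Ω^k (Ω^k)ᵀ` is a scalar `q`, the horizontal equation makes ρ
scalar, and `B = 0` because `B` is the traceless Ricci tensor. What remains is a 3 × 3 matrix `A`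
with `A² = q` and trace `1/t + 2tq`, and Cayley-Hamilton gives `A = κ`
(`IsCurvTensor.eq_of_einsteinEq`). So `M` is self-dual and Einstein with scalar curvature `12κ`,
where `3κ = 1/t + 2tκ²`. The roots `1/(2t)` and `1/t` give `6/t` and `12/t`, and κ is the same at
all points because it is determined by `c`.

Conversely, if `g` is self-dual and Einstein with scalar curvature `12κ`, then `Ω^k` is κ times the
`k`-th standard anti-self-dual form. The Ricci eigenvalues are `3κ - tκ²` on horizontal and `1/t +
tκ²` on vertical vectors, equal by the quadratic equation. The mixed block vanishes because the
components of Ω are constant in every oriented orthonormal frame.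

The definition of an Einstein metric tests every local parametrization. This is handled by the
tensoriality of the Ricci coefficients (`IsCoordChange.ricci`) and by writing any parametrization of
the twistor space locally as a change of coordinates followed by the one built from a frame
(`IsTwistorChart.exists_isCoordChange`). -/

theorem _root_.ContDiffOn.diffAt (hU : IsOpen U) (hf : ContDiffOn ℝ ∞ f U) (hx : x ∈ U) :
    DifferentiableAt ℝ f x :=
  (hf.contDiffAt (hU.mem_nhds hx)).differentiableAt (by simp)

theorem pderiv_congr (i : Fin n) (hfh : f =ᶠ[𝓝 x] h) : pderiv i f x = pderiv i h x := by
  unfold pderiv; rw [hfh.fderiv_eq]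

theorem pderiv_congr_on (hU : IsOpen U) (hx : x ∈ U) (i : Fin n) (hfh : ∀ y ∈ U, f y = h y) :
    pderiv i f x = pderiv i h x :=
  pderiv_congr i (Filter.eventuallyEq_of_mem (hU.mem_nhds hx) hfh)

theorem contDiffOn_pderiv (hU : IsOpen U) (hf : ContDiffOn ℝ ∞ f U) (i : Fin n) :
    ContDiffOn ℝ ∞ (pderiv i f) U :=
  (hf.fderiv_of_isOpen hU (m := ∞) (by simp)).clm_apply contDiffOn_const

theorem pderiv_const (i : Fin n) (c : ℝ) (x : E n) : pderiv i (fun _ => c) x = 0 := by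
  simp [pderiv]

theorem pderiv_add (i : Fin n) (hf : DifferentiableAt ℝ f x) (hh : DifferentiableAt ℝ h x) :
    pderiv i (fun y => f y + h y) x = pderiv i f x + pderiv i h x := by
  simp [pderiv, fderiv_fun_add hf hh]

theorem pderiv_sub (i : Fin n) (hf : DifferentiableAt ℝ f x) (hh : DifferentiableAt ℝ h x) :
    pderiv i (fun y => f y - h y) x = pderiv i f x - pderiv i h x := by
  simp [pderiv, fderiv_fun_sub hf hh]

theorem pderiv_neg (i : Fin n) :
    pderiv i (fun y => - f y) x = - pderiv i f x := by
  simp [pderiv, fderiv_fun_neg]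

theorem pderiv_mul (i : Fin n) (hf : DifferentiableAt ℝ f x) (hh : DifferentiableAt ℝ h x) :
    pderiv i (fun y => f y * h y) x = pderiv i f x * h x + f x * pderiv i h x := by
  simp [pderiv, fderiv_fun_mul hf hh]; ring

theorem pderiv_const_mul (i : Fin n) (c : ℝ) (hf : DifferentiableAt ℝ f x) :
    pderiv i (fun y => c * f y) x = c * pderiv i f x := by
  rw [pderiv_mul i (differentiableAt_const c) hf, pderiv_const]; ring

theorem pderiv_sum {ι : Type*} (s : Finset ι) (i : Fin n) {F : ι → E n → ℝ}
    (hF : ∀ k ∈ s, DifferentiableAt ℝ (F k) x) :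
    pderiv i (fun y => ∑ k ∈ s, F k y) x = ∑ k ∈ s, pderiv i (F k) x := by
  simp [pderiv, fderiv_fun_sum hF]

theorem pderiv_comm (hU : IsOpen U) (hf : ContDiffOn ℝ ∞ f U) (hx : x ∈ U) (i j : Fin n) :
    pderiv i (pderiv j f) x = pderiv j (pderiv i f) x := by
  have hd : DifferentiableAt ℝ (fderiv ℝ f) x :=
    ((hf.fderiv_of_isOpen hU (m := ∞) (by simp)).contDiffAt (hU.mem_nhds hx)).differentiableAt
      (by simp)
  have key : ∀ i j : Fin n, pderiv i (pderiv j f) x = fderiv ℝ (fderiv ℝ f) x (e i) (e j) := by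
    intro i j
    unfold pderiv
    rw [fderiv_clm_apply hd (differentiableAt_const _)]
    simp
  rw [key, key]
  exact (hf.contDiffAt (hU.mem_nhds hx)).isSymmSndFDerivAt
    (by simpa using (WithTop.coe_le_coe.2 le_top : ((2 : ℕ∞) : WithTop ℕ∞) ≤ ∞)) _ _

theorem fderiv_apply_eq_sum (f : E n → ℝ) (x v : E n) :
    fderiv ℝ f x v = ∑ i, v i * pderiv i f x := by
  have hv : v = ∑ i, v i • (e i : E n) := by
    ext j
    simp [e, Finset.sum_apply, Pi.single_apply]
  conv_lhs => rw [hv]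
  simp [pderiv]

theorem pderiv_eq_apply {φ : E n → E m} (hφ : DifferentiableAt ℝ φ x) (i : Fin n) (a : Fin m) :
    pderiv i (fun y => φ y a) x = (fderiv ℝ φ x (e i)) a := by
  unfold pderiv
  have h1 : HasFDerivAt (fun y => φ y a) ((EuclideanSpace.proj a).comp (fderiv ℝ φ x)) x :=
    (EuclideanSpace.proj (𝕜 := ℝ) a).hasFDerivAt.comp x hφ.hasFDerivAt
  rw [h1.fderiv]; rfl

theorem pderiv_comp {φ : E n → E m} {k : E m → ℝ} (hφ : DifferentiableAt ℝ φ x)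
    (hk : DifferentiableAt ℝ k (φ x)) (i : Fin n) :
    pderiv i (fun y => k (φ y)) x = ∑ a, pderiv i (fun y => φ y a) x * pderiv a k (φ x) := by
  have h1 : pderiv i (fun y => k (φ y)) x = fderiv ℝ k (φ x) (fderiv ℝ φ x (e i)) := by
    unfold pderiv
    rw [show (fun y => k (φ y)) = k ∘ φ from rfl, fderiv_comp x hk hφ]; rfl
  rw [h1, fderiv_apply_eq_sum]
  exact Finset.sum_congr rfl fun a _ => by rw [pderiv_eq_apply hφ]

theorem contDiffOn_coord {φ : E n → E m} (hφ : ContDiffOn ℝ ∞ φ U) (a : Fin m) :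
    ContDiffOn ℝ ∞ (fun y => φ y a) U :=
  (EuclideanSpace.proj (𝕜 := ℝ) a).contDiff.comp_contDiffOn hφ

/-! ## Matrix-valued functions -/

variable {p : ℕ}

/-- The entrywise partial derivative of a matrix-valued function. -/
def mpd (i : Fin n) (A : E n → Matrix (Fin p) (Fin p) ℝ) (x : E n) : Matrix (Fin p) (Fin p) ℝ :=
  Matrix.of fun a b => pderiv i (fun y => A y a b) x

/-- Entrywise smoothness of a matrix-valued function. -/
def MatSmooth (U : Set (E n)) (A : E n → Matrix (Fin p) (Fin p) ℝ) : Prop :=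
  ∀ a b, ContDiffOn ℝ ∞ (fun y => A y a b) U

variable {A B : E n → Matrix (Fin p) (Fin p) ℝ}

theorem MatSmooth.mono {V : Set (E n)} (hA : MatSmooth U A) (h : V ⊆ U) : MatSmooth V A :=
  fun a b => (hA a b).mono h

theorem MatSmooth.congr (hA : MatSmooth U A) (h : ∀ y ∈ U, B y = A y) : MatSmooth U B :=
  fun a b => (hA a b).congr fun y hy => by rw [h y hy]

theorem MatSmooth.diffAt (hA : MatSmooth U A) (hU : IsOpen U) (hx : x ∈ U) (a b : Fin p) :
    DifferentiableAt ℝ (fun y => A y a b) x :=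
  ContDiffOn.diffAt hU (hA a b) hx

theorem MatSmooth.mul (hA : MatSmooth U A) (hB : MatSmooth U B) :
    MatSmooth U (fun y => A y * B y) := fun a b => by
  simp only [Matrix.mul_apply]
  exact ContDiffOn.sum fun k _ => (hA a k).mul (hB k b)

theorem MatSmooth.add (hA : MatSmooth U A) (hB : MatSmooth U B) :
    MatSmooth U (fun y => A y + B y) := fun a b => (hA a b).add (hB a b)

theorem MatSmooth.sub (hA : MatSmooth U A) (hB : MatSmooth U B) :
    MatSmooth U (fun y => A y - B y) := fun a b => (hA a b).sub (hB a b)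

theorem MatSmooth.transpose (hA : MatSmooth U A) : MatSmooth U (fun y => (A y).transpose) :=
  fun a b => hA b a

theorem matSmooth_const (C : Matrix (Fin p) (Fin p) ℝ) : MatSmooth U (fun _ => C) :=
  fun _ _ => contDiffOn_const

theorem MatSmooth.sum {ι : Type*} {s : Finset ι} {F : ι → E n → Matrix (Fin p) (Fin p) ℝ}
    (hF : ∀ k ∈ s, MatSmooth U (F k)) : MatSmooth U (fun y => ∑ k ∈ s, F k y) := fun a b => by
  simp only [Matrix.sum_apply]
  exact ContDiffOn.sum fun k hk => hF k hk a b

theorem MatSmooth.smul (hf : ContDiffOn ℝ ∞ f U) (hA : MatSmooth U A) :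
    MatSmooth U (fun y => f y • A y) := fun a b => hf.mul (hA a b)

theorem MatSmooth.mpd (hA : MatSmooth U A) (hU : IsOpen U) (i : Fin n) :
    MatSmooth U (mpd i A) := fun a b => contDiffOn_pderiv hU (hA a b) i

theorem MatSmooth.comp {φ : E m → E n} {V : Set (E m)} (hA : MatSmooth U A)
    (hφ : ContDiffOn ℝ ∞ φ V) (hV : Set.MapsTo φ V U) : MatSmooth V (fun y => A (φ y)) :=
  fun a b => (hA a b).comp hφ hV

theorem MatSmooth.det (hA : MatSmooth U A) : ContDiffOn ℝ ∞ (fun y => (A y).det) U := by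
  simp only [Matrix.det_apply']
  exact ContDiffOn.sum fun σ _ => contDiffOn_const.mul (contDiffOn_prod fun i _ => hA _ _)

/-- Cramer's rule: each entry of the inverse is a quotient of determinants of smooth matrices. -/
theorem MatSmooth.inv (hA : MatSmooth U A) (hdet : ∀ y ∈ U, (A y).det ≠ 0) :
    MatSmooth U (fun y => (A y)⁻¹) := fun a b => by
  simp only [Matrix.inv_def, Ring.inverse_eq_inv', Matrix.smul_apply, smul_eq_mul]
  refine (hA.det.inv hdet).mul ?_
  simp only [Matrix.adjugate_apply]
  have : MatSmooth U (fun y => (A y).updateRow b (Pi.single a 1)) := fun c d => by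
    by_cases hc : c = b
    · subst hc; simp only [Matrix.updateRow_self]; exact contDiffOn_const
    · simp only [Matrix.updateRow_ne hc]; exact hA c d
  exact this.det

theorem mpd_congr (i : Fin n) (h : A =ᶠ[𝓝 x] B) : mpd i A x = mpd i B x := by
  ext a b
  exact pderiv_congr i (h.mono fun y hy => by simp only [hy])

theorem mpd_congr_on (hU : IsOpen U) (hx : x ∈ U) (i : Fin n) (h : ∀ y ∈ U, A y = B y) :
    mpd i A x = mpd i B x :=
  mpd_congr i (Filter.eventuallyEq_of_mem (hU.mem_nhds hx) h)

theorem mpd_mul (i : Fin n) (hA : ∀ a b, DifferentiableAt ℝ (fun y => A y a b) x)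
    (hB : ∀ a b, DifferentiableAt ℝ (fun y => B y a b) x) :
    mpd i (fun y => A y * B y) x = mpd i A x * B x + A x * mpd i B x := by
  ext a b
  simp only [mpd, Matrix.of_apply, Matrix.mul_apply, Matrix.add_apply]
  rw [pderiv_sum _ _ fun k _ => (hA a k).fun_mul (hB k b), ← Finset.sum_add_distrib]
  exact Finset.sum_congr rfl fun k _ => pderiv_mul i (hA a k) (hB k b)

theorem mpd_add (i : Fin n) (hA : ∀ a b, DifferentiableAt ℝ (fun y => A y a b) x)
    (hB : ∀ a b, DifferentiableAt ℝ (fun y => B y a b) x) :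
    mpd i (fun y => A y + B y) x = mpd i A x + mpd i B x := by
  ext a b; exact pderiv_add i (hA a b) (hB a b)

theorem mpd_sub (i : Fin n) (hA : ∀ a b, DifferentiableAt ℝ (fun y => A y a b) x)
    (hB : ∀ a b, DifferentiableAt ℝ (fun y => B y a b) x) :
    mpd i (fun y => A y - B y) x = mpd i A x - mpd i B x := by
  ext a b; exact pderiv_sub i (hA a b) (hB a b)

theorem mpd_transpose (i : Fin n) (A : E n → Matrix (Fin p) (Fin p) ℝ) (x : E n) :
    mpd i (fun y => (A y).transpose) x = (mpd i A x).transpose := rfl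

theorem mpd_const (i : Fin n) (C : Matrix (Fin p) (Fin p) ℝ) (x : E n) :
    mpd i (fun _ => C) x = 0 := by
  ext a b; exact pderiv_const i _ x

theorem mpd_sum {ι : Type*} (s : Finset ι) (i : Fin n) {F : ι → E n → Matrix (Fin p) (Fin p) ℝ}
    (hF : ∀ k ∈ s, ∀ a b, DifferentiableAt ℝ (fun y => F k y a b) x) :
    mpd i (fun y => ∑ k ∈ s, F k y) x = ∑ k ∈ s, mpd i (F k) x := by
  ext a b
  simp only [mpd, Matrix.of_apply, Matrix.sum_apply]
  exact pderiv_sum s i fun k hk => hF k hk a b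

theorem mpd_smul (i : Fin n) (hf : DifferentiableAt ℝ f x)
    (hA : ∀ a b, DifferentiableAt ℝ (fun y => A y a b) x) :
    mpd i (fun y => f y • A y) x = pderiv i f x • A x + f x • mpd i A x := by
  ext a b; exact pderiv_mul i hf (hA a b)

theorem mpd_comp {φ : E m → E n} {y : E m} (hφ : DifferentiableAt ℝ φ y)
    (hA : ∀ a b, DifferentiableAt ℝ (fun y => A y a b) (φ y)) (i : Fin m) :
    mpd i (fun y => A (φ y)) y = ∑ c, pderiv i (fun y => φ y c) y • mpd c A (φ y) := by
  ext a b
  simp only [mpd, Matrix.of_apply, Matrix.sum_apply, Matrix.smul_apply, smul_eq_mul]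
  exact pderiv_comp hφ (hA a b) i

theorem mpd_comm (hU : IsOpen U) (hA : MatSmooth U A) (hx : x ∈ U) (i j : Fin n) :
    mpd i (mpd j A) x = mpd j (mpd i A) x := by
  ext a b; exact pderiv_comm hU (hA a b) hx i j

end Calculus

/-! ## Christoffel symbols and curvature as matrices -/

section Connection

variable {n : ℕ} {U : Set (E n)} {x : E n} {G : E n → Matrix (Fin n) (Fin n) ℝ}

/-- `G` is the coefficient matrix of a smooth pseudo-Riemannian metric on the open set `U`. -/
structure IsMetricOn (U : Set (E n)) (G : E n → Matrix (Fin n) (Fin n) ℝ) : Prop where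
  isOpen : IsOpen U
  smooth : MatSmooth U G
  symm : ∀ y ∈ U, ∀ i j, G y i j = G y j i
  det_ne : ∀ y ∈ U, (G y).det ≠ 0

/-- The matrix of `Y ↦ Γ(∂_i, Y)`. -/
def gam (G : E n → Matrix (Fin n) (Fin n) ℝ) (i : Fin n) (x : E n) : Matrix (Fin n) (Fin n) ℝ :=
  Matrix.of fun k j => christoffel G k i j x

/-- The matrix of `Z ↦ (∇_i ∇_j - ∇_j ∇_i) Z`. -/
def curvM (G : E n → Matrix (Fin n) (Fin n) ℝ) (i j : Fin n) (x : E n) :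
    Matrix (Fin n) (Fin n) ℝ :=
  Matrix.of fun l k => curvatureCoeff G l i j k x

/-- Christoffel symbols of the first kind. -/
def lowC (G : E n → Matrix (Fin n) (Fin n) ℝ) (i : Fin n) (x : E n) : Matrix (Fin n) (Fin n) ℝ :=
  Matrix.of fun l j => (1 / 2) *
    (pderiv i (fun y => G y j l) x + pderiv j (fun y => G y i l) x - pderiv l (fun y => G y i j) x)

theorem gam_eq (i : Fin n) (x : E n) : gam G i x = (G x)⁻¹ * lowC G i x := by
  ext k j
  simp only [gam, christoffel, lowC, Matrix.of_apply, Matrix.mul_apply, Finset.mul_sum]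
  exact Finset.sum_congr rfl fun l _ => by ring

theorem curvM_eq (i j : Fin n) (x : E n) :
    curvM G i j x = mpd i (gam G j) x - mpd j (gam G i) x + gam G i x * gam G j x
      - gam G j x * gam G i x := by
  ext l k
  simp only [curvM, curvatureCoeff, Matrix.of_apply, Matrix.sub_apply, Matrix.add_apply, mpd,
    Matrix.mul_apply, gam, Finset.sum_sub_distrib]
  ring

theorem ricciCoeff_eq (j k : Fin n) (x : E n) :
    ricciCoeff G j k x = ∑ i, curvM G i j x i k := rfl

namespace IsMetricOn

variable (hG : IsMetricOn U G)
include hG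

theorem mono {V : Set (E n)} (hV : IsOpen V) (h : V ⊆ U) : IsMetricOn V G :=
  ⟨hV, hG.smooth.mono h, fun y hy => hG.symm y (h hy), fun y hy => hG.det_ne y (h hy)⟩

theorem pderiv_symm (hx : x ∈ U) (i a b : Fin n) :
    pderiv i (fun y => G y a b) x = pderiv i (fun y => G y b a) x :=
  pderiv_congr_on hG.isOpen hx i fun y hy => hG.symm y hy a b

theorem lowC_smooth (i : Fin n) : MatSmooth U (lowC G i) := fun l j => by
  have h := fun c a b => contDiffOn_pderiv hG.isOpen (hG.smooth a b) c
  exact contDiffOn_const.mul (((h _ _ _).add (h _ _ _)).sub (h _ _ _))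

theorem mul_gam (hx : x ∈ U) (i : Fin n) : G x * gam G i x = lowC G i x := by
  rw [gam_eq, ← mul_assoc, Matrix.mul_nonsing_inv _ (isUnit_iff_ne_zero.2 (hG.det_ne x hx)), one_mul]

theorem gam_smooth (i : Fin n) : MatSmooth U (gam G i) :=
  ((hG.smooth.inv hG.det_ne).mul (hG.lowC_smooth i)).congr fun y _ => gam_eq i y

theorem gam_symm (hx : x ∈ U) (i j k : Fin n) : gam G i x k j = gam G j x k i := by
  simp only [gam, Matrix.of_apply, christoffel]
  congr 1
  refine Finset.sum_congr rfl fun l _ => ?_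
  rw [hG.pderiv_symm hx l i j]; ring

theorem compat (hx : x ∈ U) (i : Fin n) :
    mpd i G x = (gam G i x).transpose * G x + G x * gam G i x := by
  have hs : (G x).transpose = G x := by ext a b; exact hG.symm x hx b a
  have : (gam G i x).transpose * G x = (lowC G i x).transpose := by
    rw [← hG.mul_gam hx, Matrix.transpose_mul, hs]
  rw [this, hG.mul_gam hx]
  ext a b
  simp only [mpd, lowC, Matrix.of_apply, Matrix.add_apply, Matrix.transpose_apply]
  rw [hG.pderiv_symm hx i b a, hG.pderiv_symm hx a i b, hG.pderiv_symm hx b i a]; ring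

/-- The Levi-Civita connection is the only torsion-free metric connection. -/
theorem gam_unique (hx : x ∈ U) (B : Fin n → Matrix (Fin n) (Fin n) ℝ)
    (hsymm : ∀ i j k, B i k j = B j k i)
    (hB : ∀ i, mpd i G x = (B i).transpose * G x + G x * B i) (i : Fin n) : B i = gam G i x := by
  have hs : (G x).transpose = G x := by ext a b; exact hG.symm x hx b a
  have hu := isUnit_iff_ne_zero.2 (hG.det_ne x hx)
  suffices h : G x * B i = lowC G i x by
    rw [gam_eq, ← h, ← mul_assoc, Matrix.nonsing_inv_mul _ hu, one_mul]
  have hB' : ∀ i a b, pderiv i (fun y => G y a b) x = (G x * B i) b a + (G x * B i) a b := by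
    intro i a b
    have := congrFun (congrFun (hB i) a) b
    rw [show (B i).transpose * G x = (G x * B i).transpose by
      rw [Matrix.transpose_mul, hs]] at this
    exact this
  have hsymm' : ∀ i j k, (G x * B i) k j = (G x * B j) k i := by
    intro i j k
    simp only [Matrix.mul_apply, hsymm i j]
  -- Koszul's argument: among the six terms produced by three permuted compatibility equations,
  -- torsion-freeness cancels all but one pair.
  ext l j
  simp only [lowC, Matrix.of_apply, hB']
  rw [hsymm' j l i, hsymm' l j i, hsymm' l i j, hsymm' j i l]; ring

end IsMetricOn

/-- The curvature matrices of gauge-equivalent connections. -/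
theorem gauge_curvature {n p : ℕ} {V : Set (E n)} {x : E n} (hV : IsOpen V)
    (hx : x ∈ V) {D : E n → Matrix (Fin p) (Fin p) ℝ} {B C : Fin n → E n → Matrix (Fin p) (Fin p) ℝ}
    (hD : MatSmooth V D) (hB : ∀ i, MatSmooth V (B i)) (hC : ∀ i, MatSmooth V (C i))
    (h : ∀ y ∈ V, ∀ i, D y * C i y = B i y * D y + mpd i D y) (i j : Fin n) :
    D x * (mpd i (C j) x - mpd j (C i) x + C i x * C j x - C j x * C i x) =
      (mpd i (B j) x - mpd j (B i) x + B i x * B j x - B j x * B i x) * D x := by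
  -- The gauge relation for index `j`, differentiated in the direction `i`. After antisymmetrization
  -- in `i, j` the second derivatives of `D` cancel, and the products of first derivatives of `D`
  -- with the connections are absorbed by the quadratic terms.
  have key : ∀ i j, mpd i D x * C j x + D x * mpd i (C j) x =
      mpd i (B j) x * D x + B j x * mpd i D x + mpd i (mpd j D) x := by
    intro i j
    have h1 := mpd_congr_on hV hx i fun y hy => h y hy j
    rw [mpd_mul i (hD.diffAt hV hx) ((hC j).diffAt hV hx),
      mpd_add i (((hB j).mul hD).diffAt hV hx) ((hD.mpd hV j).diffAt hV hx),
      mpd_mul i ((hB j).diffAt hV hx) (hD.diffAt hV hx)] at h1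
    exact h1
  have e1 : D x * mpd i (C j) x = mpd i (B j) x * D x + B j x * mpd i D x + mpd i (mpd j D) x
      - mpd i D x * C j x := by rw [← key]; abel
  have e2 : D x * mpd j (C i) x = mpd j (B i) x * D x + B i x * mpd j D x + mpd i (mpd j D) x
      - mpd j D x * C i x := by rw [mpd_comm hV hD hx i j, ← key]; abel
  have e3 : D x * (C i x * C j x) = B i x * (B j x * D x + mpd j D x) + mpd i D x * C j x := by
    rw [← mul_assoc, h x hx i, add_mul, mul_assoc, h x hx j]
  have e4 : D x * (C j x * C i x) = B j x * (B i x * D x + mpd i D x) + mpd j D x * C i x := by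
    rw [← mul_assoc, h x hx j, add_mul, mul_assoc, h x hx i]
  rw [mul_sub, mul_add, mul_sub, e1, e2, e3, e4]
  noncomm_ring

/-! ## Change of coordinates -/

/-- The Jacobian matrix. -/
def jac {m : ℕ} (φ : E n → E m) (x : E n) : Matrix (Fin m) (Fin n) ℝ :=
  Matrix.of fun a i => pderiv i (fun y => φ y a) x

/-- A smooth change of coordinates from `V` into `U`, transforming the metric `G` into `G'`. -/
structure IsCoordChange (V U : Set (E n)) (φ : E n → E n)
    (G' G : E n → Matrix (Fin n) (Fin n) ℝ) : Prop where
  isOpen : IsOpen V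
  smooth : ContDiffOn ℝ ∞ φ V
  mapsTo : Set.MapsTo φ V U
  det_ne : ∀ y ∈ V, (jac φ y).det ≠ 0
  pull : ∀ y ∈ V, G' y = (jac φ y).transpose * G (φ y) * jac φ y

namespace IsCoordChange

variable {V : Set (E n)} {φ : E n → E n} {G' : E n → Matrix (Fin n) (Fin n) ℝ}

theorem jac_smooth (hφ : ContDiffOn ℝ ∞ φ V) (hV : IsOpen V) : MatSmooth V (jac φ) := fun a b =>
  contDiffOn_pderiv hV (contDiffOn_coord hφ a) b

theorem mpd_jac_symm (hφ : ContDiffOn ℝ ∞ φ V) (hV : IsOpen V) {x : E n} (hx : x ∈ V)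
    (i j a : Fin n) : mpd i (jac φ) x a j = mpd j (jac φ) x a i :=
  pderiv_comm hV (contDiffOn_coord hφ a) hx i j

variable (hφ : IsCoordChange V U φ G' G) (hG : IsMetricOn U G)
include hφ hG

theorem isMetricOn : IsMetricOn V G' where
  isOpen := hφ.isOpen
  smooth := ((((jac_smooth hφ.smooth hφ.isOpen).transpose).mul
    (hG.smooth.comp hφ.smooth hφ.mapsTo)).mul (jac_smooth hφ.smooth hφ.isOpen)).congr hφ.pull
  symm := fun y hy i j => by
    have hs : (G (φ y)).transpose = G (φ y) := by
      ext a b; exact hG.symm _ (hφ.mapsTo hy) b a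
    have : (G' y).transpose = G' y := by
      rw [hφ.pull y hy]; simp [Matrix.transpose_mul, hs, mul_assoc]
    exact (congrFun (congrFun this j) i)
  det_ne := fun y hy => by
    rw [hφ.pull y hy]
    simp [Matrix.det_mul, hφ.det_ne y hy, hG.det_ne _ (hφ.mapsTo hy)]

/-- The classical transformation law of Christoffel symbols. The candidate `B` obtained by solving
this law is torsion-free and compatible with the pulled-back metric, hence equals the Levi-Civita
connection by `gam_unique`. No inverse matrix has to be differentiated. -/
theorem mul_gam (hx : x ∈ V) (i : Fin n) :
    jac φ x * gam G' i x =
      (∑ a, jac φ x a i • gam G a (φ x)) * jac φ x + mpd i (jac φ) x := by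
  set D := jac φ x with hD
  have hu := isUnit_iff_ne_zero.2 (hφ.det_ne x hx)
  let B : Fin n → Matrix (Fin n) (Fin n) ℝ := fun i =>
    D⁻¹ * ((∑ a, D a i • gam G a (φ x)) * D + mpd i (jac φ) x)
  have hDB : ∀ i, D * B i = (∑ a, D a i • gam G a (φ x)) * D + mpd i (jac φ) x := fun i => by
    simp only [B]; rw [← mul_assoc, Matrix.mul_nonsing_inv _ hu, one_mul]
  have hdJ := fun a b => (jac_smooth hφ.smooth hφ.isOpen).diffAt hφ.isOpen hx a b
  have hφx := hφ.mapsTo hx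
  have hdφ : DifferentiableAt ℝ φ x :=
    (hφ.smooth.contDiffAt (hφ.isOpen.mem_nhds hx)).differentiableAt (by simp)
  rw [← hDB, (hφ.isMetricOn hG).gam_unique hx B]
  · intro i j k
    have h1 : ∀ k, (D * B i) k j = (D * B j) k i := by
      intro k
      rw [hDB, hDB, Matrix.add_apply, Matrix.add_apply, mpd_jac_symm hφ.smooth hφ.isOpen hx i j]
      congr 1
      simp only [Matrix.mul_apply, Matrix.sum_apply, Matrix.smul_apply, smul_eq_mul,
        Finset.sum_mul]
      rw [Finset.sum_comm]
      refine Finset.sum_congr rfl fun a _ => Finset.sum_congr rfl fun b _ => ?_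
      rw [hG.gam_symm hφx]; ring
    have h2 : ∀ i, B i = D⁻¹ * (D * B i) := fun i => by
      rw [← mul_assoc, Matrix.nonsing_inv_mul _ hu, one_mul]
    rw [h2 i, h2 j, Matrix.mul_apply, Matrix.mul_apply]
    exact Finset.sum_congr rfl fun a _ => by rw [h1]
  · intro i
    rw [mpd_congr_on hφ.isOpen hx i hφ.pull]
    have hdG := fun a b => (hG.smooth.comp hφ.smooth hφ.mapsTo).diffAt hφ.isOpen hx a b
    have hdT := fun a b =>
      (jac_smooth hφ.smooth hφ.isOpen).transpose.diffAt hφ.isOpen hx a b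
    have hdTG := fun a b => ((jac_smooth hφ.smooth hφ.isOpen).transpose.mul
      (hG.smooth.comp hφ.smooth hφ.mapsTo)).diffAt hφ.isOpen hx a b
    rw [mpd_mul i hdTG hdJ, mpd_mul i hdT hdG, mpd_transpose,
      mpd_comp hdφ (fun a b => hG.smooth.diffAt hG.isOpen hφx a b), hφ.pull x hx]
    have hsum : ∑ c, pderiv i (fun y => φ y c) x • mpd c G (φ x)
        = (∑ a, D a i • gam G a (φ x)).transpose * G (φ x)
          + G (φ x) * ∑ a, D a i • gam G a (φ x) := by
      rw [Matrix.transpose_sum, Finset.sum_mul, Finset.mul_sum, ← Finset.sum_add_distrib]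
      refine Finset.sum_congr rfl fun a _ => ?_
      rw [hG.compat hφx a, Matrix.transpose_smul, smul_mul_assoc, mul_smul_comm, ← smul_add]
      rfl
    rw [hsum]
    have hT : mpd i (jac φ) x = D * B i - (∑ a, D a i • gam G a (φ x)) * D := by
      rw [hDB]; abel
    rw [hT, ← hD]
    simp only [Matrix.transpose_sub, Matrix.transpose_mul]
    noncomm_ring

/-- By `mul_gam`, the Jacobian is a gauge transformation from the Levi-Civita connection of `G'` to
the pull-back of that of `G`. `gauge_curvature` then reduces the claim to the naturality of
curvature under pull-back of connection matrices. -/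
theorem mul_curvM (hx : x ∈ V) (i j : Fin n) :
    jac φ x * curvM G' i j x =
      (∑ a, ∑ b, (jac φ x a i * jac φ x b j) • curvM G a b (φ x)) * jac φ x := by
  have hφx := hφ.mapsTo hx
  have hJ := jac_smooth hφ.smooth hφ.isOpen
  have hdφ : DifferentiableAt ℝ φ x :=
    (hφ.smooth.contDiffAt (hφ.isOpen.mem_nhds hx)).differentiableAt (by simp)
  let B : Fin n → E n → Matrix (Fin n) (Fin n) ℝ := fun i y =>
    ∑ a, jac φ y a i • gam G a (φ y)
  have hg : ∀ a, MatSmooth V (fun y => gam G a (φ y)) := fun a =>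
    (hG.gam_smooth a).comp hφ.smooth hφ.mapsTo
  have hB : ∀ i, MatSmooth V (B i) := fun i => MatSmooth.sum fun a _ => (hg a).smul (hJ a i)
  have hmet := hφ.isMetricOn hG
  have hgauge := gauge_curvature hφ.isOpen hx hJ hB hmet.gam_smooth
    (fun y hy i => hφ.mul_gam hG hy i) i j
  rw [curvM_eq, hgauge]
  congr 1
  have hmpd : ∀ i j, mpd i (B j) x = ∑ a, mpd i (jac φ) x a j • gam G a (φ x)
      + ∑ a, ∑ b, (jac φ x a i * jac φ x b j) • mpd a (gam G b) (φ x) := by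
    intro i j
    simp only [B]
    rw [mpd_sum _ _ fun a _ => ((hg a).smul (hJ a j)).diffAt hφ.isOpen hx]
    rw [Finset.sum_comm (f := fun a b => (jac φ x a i * jac φ x b j) • mpd a (gam G b) (φ x)),
      ← Finset.sum_add_distrib]
    refine Finset.sum_congr rfl fun a _ => ?_
    rw [mpd_smul i (hJ.diffAt hφ.isOpen hx a j) ((hg a).diffAt hφ.isOpen hx),
      mpd_comp hdφ (fun c d => (hG.gam_smooth a).diffAt hG.isOpen hφx c d), Finset.smul_sum]
    congr 1
    refine Finset.sum_congr rfl fun b _ => ?_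
    rw [smul_smul]; congr 1; exact mul_comm _ _
  have hprod : ∀ i j, B i x * B j x =
      ∑ a, ∑ b, (jac φ x a i * jac φ x b j) • (gam G a (φ x) * gam G b (φ x)) := by
    intro i j
    simp only [B, Finset.sum_mul, Finset.mul_sum, smul_mul_smul_comm]
    exact Finset.sum_comm
  -- The only terms containing second derivatives of `φ`; they are symmetric in `i, j` and drop out
  -- of the curvature.
  have hs : ∑ a, mpd i (jac φ) x a j • gam G a (φ x) = ∑ a, mpd j (jac φ) x a i • gam G a (φ x) :=
    Finset.sum_congr rfl fun a _ => by rw [mpd_jac_symm hφ.smooth hφ.isOpen hx]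
  have hsw : ∀ f : Fin n → Fin n → Matrix (Fin n) (Fin n) ℝ,
      ∑ a, ∑ b, (jac φ x a j * jac φ x b i) • f a b
        = ∑ a, ∑ b, (jac φ x a i * jac φ x b j) • f b a := by
    intro f
    rw [Finset.sum_comm]
    exact Finset.sum_congr rfl fun a _ => Finset.sum_congr rfl fun b _ => by rw [mul_comm]
  simp only [curvM_eq, smul_sub, smul_add, Finset.sum_sub_distrib, Finset.sum_add_distrib]
  rw [hmpd i j, hmpd j i, hprod i j, hprod j i, hs, hsw (fun a b => mpd a (gam G b) (φ x)),
    hsw (fun a b => gam G a (φ x) * gam G b (φ x))]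
  abel

/-- The contracted upper index transforms by the inverse Jacobian and the lower one by the Jacobian,
so the two cancel in the trace. -/
theorem ricci (hx : x ∈ V) (j k : Fin n) :
    ricciCoeff G' j k x = ∑ b, ∑ c, jac φ x b j * jac φ x c k * ricciCoeff G b c (φ x) := by
  set D := jac φ x with hD
  have hu := isUnit_iff_ne_zero.2 (hφ.det_ne x hx)
  have h1 : ∀ i, curvM G' i j x =
      D⁻¹ * ((∑ a, ∑ b, (D a i * D b j) • curvM G a b (φ x)) * D) := fun i => by
    rw [← hφ.mul_curvM hG hx, ← mul_assoc, Matrix.nonsing_inv_mul _ hu, one_mul]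
  have hDi : ∀ a l, ∑ i, D a i * D⁻¹ i l = if a = l then 1 else 0 := fun a l => by
    rw [← Matrix.mul_apply, Matrix.mul_nonsing_inv _ hu, Matrix.one_apply]
  have h2 : ∀ i, curvM G' i j x i k = ∑ l, ∑ a, (D a i * D⁻¹ i l) *
      ∑ b, ∑ c, D b j * D c k * curvM G a b (φ x) l c := by
    intro i
    rw [h1, Matrix.mul_apply]
    refine Finset.sum_congr rfl fun l _ => ?_
    simp only [Matrix.mul_apply, Matrix.sum_apply, Matrix.smul_apply, smul_eq_mul, Finset.mul_sum,
      Finset.sum_mul]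
    rw [Finset.sum_comm]
    refine Finset.sum_congr rfl fun a _ => ?_
    rw [Finset.sum_comm]
    exact Finset.sum_congr rfl fun b _ => Finset.sum_congr rfl fun c _ => by ring
  rw [ricciCoeff_eq]
  simp only [h2]
  rw [Finset.sum_comm]
  have h3 : ∀ l, ∑ i, ∑ a, (D a i * D⁻¹ i l) *
      ∑ b, ∑ c, D b j * D c k * curvM G a b (φ x) l c =
      ∑ b, ∑ c, D b j * D c k * curvM G l b (φ x) l c := by
    intro l
    rw [Finset.sum_comm]
    simp only [← Finset.sum_mul, hDi, ite_mul, one_mul, zero_mul, Finset.sum_ite_eq',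
      Finset.mem_univ, if_true]
  simp only [h3]
  rw [Finset.sum_comm]
  refine Finset.sum_congr rfl fun b _ => ?_
  rw [Finset.sum_comm]
  exact Finset.sum_congr rfl fun c _ => by rw [ricciCoeff_eq, Finset.mul_sum]

end IsCoordChange

/-! ## Curvature from the 2-jet of the metric -/

namespace IsMetricOn

variable (hG : IsMetricOn U G)
include hG

/-- Where `G = 1`, the derivative of `Γ = G⁻¹ lowC` is found by differentiating `G Γ = lowC`, with
metric compatibility supplying the derivative of `G`. The result involves only derivatives of `G`.
-/
theorem curvM_of_eq_one (hx : x ∈ U) (h1 : G x = 1) (i j : Fin n) :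
    curvM G i j x = mpd i (lowC G j) x - mpd j (lowC G i) x
      - (lowC G i x).transpose * lowC G j x + (lowC G j x).transpose * lowC G i x := by
  have hgd := fun i a b => (hG.gam_smooth i).diffAt hG.isOpen hx a b
  have hg : ∀ i, gam G i x = lowC G i x := fun i => by rw [← hG.mul_gam hx, h1, one_mul]
  have hm : ∀ i j, mpd i (lowC G j) x
      = ((lowC G i x).transpose + lowC G i x) * lowC G j x + mpd i (gam G j) x := by
    intro i j
    rw [← mpd_congr_on hG.isOpen hx i (fun y hy => hG.mul_gam hy j),
      mpd_mul i (hG.smooth.diffAt hG.isOpen hx) (hgd j), hG.compat hx, h1, hg, hg, mul_one, one_mul,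
      one_mul]
  rw [curvM_eq, hm, hm, hg, hg]
  noncomm_ring

theorem mpd_lowC (hx : x ∈ U) (i j a b : Fin n) : mpd i (lowC G j) x a b =
    (1 / 2) * (pderiv i (pderiv j fun y => G y b a) x + pderiv i (pderiv b fun y => G y j a) x
      - pderiv i (pderiv a fun y => G y j b) x) := by
  have h := fun c a b => ContDiffOn.diffAt hG.isOpen
    (contDiffOn_pderiv hG.isOpen (hG.smooth a b) c) hx
  simp only [mpd, lowC, Matrix.of_apply]
  rw [pderiv_const_mul i _ (((h _ _ _).fun_add (h _ _ _)).fun_sub (h _ _ _)),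
    pderiv_sub i ((h _ _ _).fun_add (h _ _ _)) (h _ _ _), pderiv_add i (h _ _ _) (h _ _ _)]

theorem pderiv2_symm (hx : x ∈ U) (i j a b : Fin n) :
    pderiv i (pderiv j fun y => G y a b) x = pderiv i (pderiv j fun y => G y b a) x :=
  pderiv_congr_on hG.isOpen hx i fun _ hy => hG.pderiv_symm hy j a b

/-- The quadratic terms are kept because this is applied to the bundle metric, whose mixed
coefficients have non-zero first derivatives at the origin even in adapted coordinates. -/
theorem ricci_of_eq_one (hx : x ∈ U) (h1 : G x = 1) (j k : Fin n) :
    ricciCoeff G j k x = ∑ i, ((1 / 2) * (pderiv i (pderiv j fun y => G y i k) x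
      + pderiv i (pderiv k fun y => G y i j) x - pderiv i (pderiv i fun y => G y j k) x
      - pderiv j (pderiv k fun y => G y i i) x)
      + ∑ a, (lowC G j x a i * lowC G i x a k - lowC G i x a i * lowC G j x a k)) := by
  rw [ricciCoeff_eq]
  refine Finset.sum_congr rfl fun i _ => ?_
  have hc := fun a b i j => pderiv_comm hG.isOpen (hG.smooth a b) hx i j
  rw [hG.curvM_of_eq_one hx h1]
  simp only [Matrix.sub_apply, Matrix.add_apply, hG.mpd_lowC hx, Matrix.mul_apply,
    Matrix.transpose_apply, Finset.sum_sub_distrib]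
  rw [hG.pderiv2_symm hx i j k i, hG.pderiv2_symm hx i k j i, hG.pderiv2_symm hx j i k i]
  ring

/-- The form used on the base: curvature as a linear expression in second derivatives of the metric,
from which all algebraic symmetries can be read off. -/
theorem curvM_of_flat_jet (hx : x ∈ U) (h1 : G x = 1) (h0 : ∀ i, mpd i G x = 0) (i j l k : Fin n) :
    curvM G i j x l k = (1 / 2) * (pderiv i (pderiv k fun y => G y j l) x
      - pderiv i (pderiv l fun y => G y j k) x - pderiv j (pderiv k fun y => G y i l) x
      + pderiv j (pderiv l fun y => G y i k) x) := by
  have h0' : ∀ i a b, pderiv i (fun y => G y a b) x = 0 := fun i a b =>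
    congrFun (congrFun (h0 i) a) b
  have hl : ∀ i, lowC G i x = 0 := fun i => by
    ext a b; simp [lowC, h0']
  have hc := fun a b => pderiv_comm hG.isOpen (hG.smooth a b) hx i j
  rw [hG.curvM_of_eq_one hx h1, hl, hl]
  simp only [Matrix.sub_apply, Matrix.add_apply, hG.mpd_lowC hx, Matrix.transpose_zero, zero_mul,
    Matrix.zero_apply, hc]
  ring

end IsMetricOn

end Connection

set_option linter.unusedSimpArgs false

/-! ## The Ricci tensor of a metric of bundle type from its 2-jet -/

section BundleJet

/-- The index of a horizontal coordinate. -/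
abbrev hor (a : Fin 4) : Fin 6 := Fin.castAdd 2 a

/-- The index of a vertical coordinate. -/
abbrev ver (α : Fin 2) : Fin 6 := Fin.natAdd 4 α

theorem sum_six {A : Type*} [AddCommMonoid A] (f : Fin 6 → A) :
    ∑ i, f i = ∑ a, f (hor a) + ∑ α, f (ver α) :=
  Fin.sum_univ_add (a := 4) (b := 2) f

/-- The 2-jet at `x` of a metric on a 6-dimensional coordinate space which is, to second order, a
metric of bundle type: `P` and `T` are the first and second derivatives of a connection. -/
structure HasBundleJet (K : E 6 → Matrix (Fin 6) (Fin 6) ℝ) (x : E 6) (κ : ℝ)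
    (P : Fin 4 → Fin 4 → Fin 2 → ℝ) (H : Fin 4 → Fin 4 → Fin 4 → Fin 4 → ℝ)
    (T : Fin 4 → Fin 4 → Fin 4 → Fin 2 → ℝ) (Q : Fin 4 → Fin 4 → Fin 2 → Fin 2 → ℝ) : Prop where
  d_hh : ∀ I a b, pderiv I (fun y => K y (hor a) (hor b)) x = 0
  d_hv : ∀ c a α, pderiv (hor c) (fun y => K y (hor a) (ver α)) x = P c a α
  d_hv' : ∀ γ a α, pderiv (ver γ) (fun y => K y (hor a) (ver α)) x = 0
  d_vv : ∀ I α β, pderiv I (fun y => K y (ver α) (ver β)) x = 0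
  dd_hh : ∀ c d a b, pderiv (hor c) (pderiv (hor d) fun y => K y (hor a) (hor b)) x =
    H c d a b + ∑ α, (P c a α * P d b α + P d a α * P c b α)
  dd_hh' : ∀ γ δ a b, pderiv (ver γ) (pderiv (ver δ) fun y => K y (hor a) (hor b)) x = 0
  dd_hh'' : ∀ c δ a b, pderiv (hor c) (pderiv (ver δ) fun y => K y (hor a) (hor b)) x = 0
  dd_hv : ∀ c d a α, pderiv (hor c) (pderiv (hor d) fun y => K y (hor a) (ver α)) x = T c d a α
  dd_hv' : ∀ c δ a α, pderiv (hor c) (pderiv (ver δ) fun y => K y (hor a) (ver α)) x = Q c a δ α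
  dd_hv'' : ∀ γ δ a α, pderiv (ver γ) (pderiv (ver δ) fun y => K y (hor a) (ver α)) x = 0
  dd_vv : ∀ c d α β, pderiv (hor c) (pderiv (hor d) fun y => K y (ver α) (ver β)) x = 0
  dd_vv' : ∀ c δ α β, pderiv (hor c) (pderiv (ver δ) fun y => K y (ver α) (ver β)) x = 0
  dd_vv'' : ∀ γ δ α β, pderiv (ver γ) (pderiv (ver δ) fun y => K y (ver α) (ver β)) x =
    κ * ((if γ = α then 1 else 0) * (if δ = β then 1 else 0)
      + (if δ = α then 1 else 0) * (if γ = β then 1 else 0))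
  skew : ∀ c a γ α, Q c a γ α = - Q c a α γ

namespace HasBundleJet

variable {K : E 6 → Matrix (Fin 6) (Fin 6) ℝ} {x : E 6} {κ : ℝ}
  {P : Fin 4 → Fin 4 → Fin 2 → ℝ} {H : Fin 4 → Fin 4 → Fin 4 → Fin 4 → ℝ}
  {T : Fin 4 → Fin 4 → Fin 4 → Fin 2 → ℝ} {Q : Fin 4 → Fin 4 → Fin 2 → Fin 2 → ℝ}
  {W : Set (E 6)}

variable (hJ : HasBundleJet K x κ P H T Q) (hK : IsMetricOn W K) (hx : x ∈ W)
include hJ hK hx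

theorem d_vh (c a α) : pderiv (hor c) (fun y => K y (ver α) (hor a)) x = P c a α := by
  rw [hK.pderiv_symm hx, hJ.d_hv]

theorem d_vh' (γ a α) : pderiv (ver γ) (fun y => K y (ver α) (hor a)) x = 0 := by
  rw [hK.pderiv_symm hx, hJ.d_hv']

theorem dd_vh' (c δ a α) :
    pderiv (hor c) (pderiv (ver δ) fun y => K y (ver α) (hor a)) x = Q c a δ α := by
  rw [hK.pderiv2_symm hx, hJ.dd_hv']

theorem dd_vh'' (γ δ a α) :
    pderiv (ver γ) (pderiv (ver δ) fun y => K y (ver α) (hor a)) x = 0 := by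
  rw [hK.pderiv2_symm hx, hJ.dd_hv'']

omit hJ in
theorem dd_swap (c δ i j) : pderiv (ver δ) (pderiv (hor c) fun y => K y i j) x =
    pderiv (hor c) (pderiv (ver δ) fun y => K y i j) x :=
  pderiv_comm hK.isOpen (hK.smooth i j) hx _ _

/-- The horizontal part of O'Neill's formula. The products of `P` in the second derivatives of the
horizontal coefficients combine with the quadratic Christoffel terms so that only the skew part of
`P`, the curvature of the connection, survives. -/
theorem ricci_hor (h1 : K x = 1) (b d : Fin 4) :
    ricciCoeff K (hor b) (hor d) x =
      ∑ a, (1 / 2) * (H a b a d + H a d a b - H a a b d - H b d a a)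
      - (1 / 2) * ∑ a, ∑ α, (P b a α - P a b α) * (P d a α - P a d α) := by
  rw [hK.ricci_of_eq_one hx h1]
  simp only [sum_six, lowC, Matrix.of_apply, hJ.d_hh, hJ.d_hv, hJ.d_hv', hJ.d_vv, hJ.dd_hh,
    hJ.dd_hh', hJ.dd_hh'', hJ.dd_hv, hJ.dd_hv', hJ.dd_hv'', hJ.dd_vv, hJ.dd_vv', hJ.dd_vv'',
    hJ.d_vh hK hx, hJ.d_vh' hK hx, hJ.dd_vh' hK hx, hJ.dd_vh'' hK hx,
    dd_swap hK hx]
  -- The mixed derivatives enter this block only through a trace over the fibre, which vanishes by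
  -- skewness.
  have hQ : ∀ c a α, Q c a α α = 0 := fun c a α => by linarith [hJ.skew c a α α]
  simp only [hQ, Fin.sum_univ_two]
  simp only [Fin.sum_univ_four]
  ring

theorem ricci_ver (h1 : K x = 1) (α β : Fin 2) :
    ricciCoeff K (ver α) (ver β) x =
      κ * (if α = β then 1 else 0)
      + (1 / 4) * ∑ a, ∑ c, (P a c α - P c a α) * (P a c β - P c a β) := by
  rw [hK.ricci_of_eq_one hx h1]
  simp only [sum_six, lowC, Matrix.of_apply, hJ.d_hh, hJ.d_hv, hJ.d_hv', hJ.d_vv, hJ.dd_hh,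
    hJ.dd_hh', hJ.dd_hh'', hJ.dd_hv, hJ.dd_hv', hJ.dd_hv'', hJ.dd_vv, hJ.dd_vv', hJ.dd_vv'',
    hJ.d_vh hK hx, hJ.d_vh' hK hx, hJ.dd_vh' hK hx, hJ.dd_vh'' hK hx,
    dd_swap hK hx]
  have hQ : ∀ c a, Q c a α β = - Q c a β α := fun c a => hJ.skew c a α β
  simp only [hQ, Fin.sum_univ_two]
  have : ∀ γ δ : Fin 2, (if γ = δ then (1 : ℝ) else 0) = if δ = γ then 1 else 0 := by
    intro γ δ; simp only [eq_comm]
  simp only [Fin.sum_univ_four]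
  fin_cases α <;> fin_cases β <;> norm_num <;> ring

/-- Every product of first derivatives vanishes here, and only the horizontal second derivatives of
the mixed coefficients remain: a divergence of the curvature. -/
theorem ricci_mixed (h1 : K x = 1) (b : Fin 4) (δ : Fin 2) :
    ricciCoeff K (hor b) (ver δ) x = ∑ a, (1 / 2) * (T a b a δ - T a a b δ) := by
  rw [hK.ricci_of_eq_one hx h1]
  simp only [sum_six, lowC, Matrix.of_apply, hJ.d_hh, hJ.d_hv, hJ.d_hv', hJ.d_vv, hJ.dd_hh,
    hJ.dd_hh', hJ.dd_hh'', hJ.dd_hv, hJ.dd_hv', hJ.dd_hv'', hJ.dd_vv, hJ.dd_vv', hJ.dd_vv'',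
    hJ.d_vh hK hx, hJ.d_vh' hK hx, hJ.dd_vh' hK hx, hJ.dd_vh'' hK hx,
    dd_swap hK hx]
  simp

end HasBundleJet

end BundleJet

/-! ## Functions on the product of the horizontal and the vertical coordinate space -/

section Tensor

/-- The horizontal coordinates. -/
def px (y : E 6) : E 4 := WithLp.toLp 2 fun a => y (hor a)

/-- The vertical coordinates. -/
def pu (y : E 6) : E 2 := WithLp.toLp 2 fun α => y (ver α)

theorem contDiff_px : ContDiff ℝ ∞ px := by
  rw [contDiff_euclidean]
  exact fun a => (EuclideanSpace.proj (𝕜 := ℝ) (hor a)).contDiff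

theorem contDiff_pu : ContDiff ℝ ∞ pu := by
  rw [contDiff_euclidean]
  exact fun a => (EuclideanSpace.proj (𝕜 := ℝ) (ver a)).contDiff

theorem pderiv_coord {n : ℕ} (i j : Fin n) (x : E n) :
    pderiv i (fun y => y j) x = if i = j then 1 else 0 := by
  unfold pderiv
  rw [show (fun y : E n => y j) = EuclideanSpace.proj (𝕜 := ℝ) j from rfl,
    ContinuousLinearMap.fderiv]
  simp [e, eq_comm]

theorem pderiv_hor_px (a b : Fin 4) (y : E 6) :
    pderiv (hor a) (fun y => px y b) y = if a = b then 1 else 0 := by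
  rw [show (fun y => px y b) = fun y : E 6 => y (hor b) from rfl, pderiv_coord]
  simp [(Fin.castAdd_injective 4 2).eq_iff]

theorem pderiv_ver_px (α : Fin 2) (b : Fin 4) (y : E 6) :
    pderiv (ver α) (fun y => px y b) y = 0 := by
  rw [show (fun y => px y b) = fun y : E 6 => y (hor b) from rfl, pderiv_coord, if_neg]
  intro h; have := congrArg Fin.val h; simp at this; omega

theorem pderiv_hor_pu (a : Fin 4) (β : Fin 2) (y : E 6) :
    pderiv (hor a) (fun y => pu y β) y = 0 := by
  rw [show (fun y => pu y β) = fun y : E 6 => y (ver β) from rfl, pderiv_coord, if_neg]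
  intro h; have := congrArg Fin.val h; simp at this; omega

theorem pderiv_ver_pu (α β : Fin 2) (y : E 6) :
    pderiv (ver α) (fun y => pu y β) y = if α = β then 1 else 0 := by
  rw [show (fun y => pu y β) = fun y : E 6 => y (ver β) from rfl, pderiv_coord]
  simp [(Fin.natAdd_injective 2 4).eq_iff]

/-- The product of a function of the horizontal and a function of the vertical coordinates. -/
def tp (f : E 4 → ℝ) (h : E 2 → ℝ) (y : E 6) : ℝ := f (px y) * h (pu y)

variable {f : E 4 → ℝ} {h : E 2 → ℝ} {U : Set (E 4)} {V : Set (E 2)} {y : E 6}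

/-- The product of a set of horizontal and a set of vertical coordinates. -/
def boxSet (U : Set (E 4)) (V : Set (E 2)) : Set (E 6) := px ⁻¹' U ∩ pu ⁻¹' V

theorem isOpen_boxSet (hU : IsOpen U) (hV : IsOpen V) : IsOpen (boxSet U V) :=
  (hU.preimage contDiff_px.continuous).inter (hV.preimage contDiff_pu.continuous)

theorem contDiffOn_tp (hf : ContDiffOn ℝ ∞ f U) (hh : ContDiffOn ℝ ∞ h V) :
    ContDiffOn ℝ ∞ (tp f h) (boxSet U V) :=
  (hf.comp contDiff_px.contDiffOn fun _ hy => hy.1).mul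
    (hh.comp contDiff_pu.contDiffOn fun _ hy => hy.2)

theorem pderiv_hor_comp_px (hf : DifferentiableAt ℝ f (px y)) (a : Fin 4) :
    pderiv (hor a) (fun y => f (px y)) y = pderiv a f (px y) := by
  rw [pderiv_comp (contDiff_px.differentiable (by simp) _) hf]
  simp [pderiv_hor_px]

theorem pderiv_ver_comp_px (hf : DifferentiableAt ℝ f (px y)) (α : Fin 2) :
    pderiv (ver α) (fun y => f (px y)) y = 0 := by
  rw [pderiv_comp (contDiff_px.differentiable (by simp) _) hf]
  simp [pderiv_ver_px]

theorem pderiv_hor_comp_pu (hh : DifferentiableAt ℝ h (pu y)) (a : Fin 4) :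
    pderiv (hor a) (fun y => h (pu y)) y = 0 := by
  rw [pderiv_comp (contDiff_pu.differentiable (by simp) _) hh]
  simp [pderiv_hor_pu]

theorem pderiv_ver_comp_pu (hh : DifferentiableAt ℝ h (pu y)) (α : Fin 2) :
    pderiv (ver α) (fun y => h (pu y)) y = pderiv α h (pu y) := by
  rw [pderiv_comp (contDiff_pu.differentiable (by simp) _) hh]
  simp [pderiv_ver_pu]

variable (hU : IsOpen U) (hV : IsOpen V) (hf : ContDiffOn ℝ ∞ f U) (hh : ContDiffOn ℝ ∞ h V)
  (hy : y ∈ boxSet U V)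
include hU hV hf hh hy

theorem pderiv_hor_tp (a : Fin 4) : pderiv (hor a) (tp f h) y = tp (pderiv a f) h y := by
  have h1 := ContDiffOn.diffAt hU hf hy.1
  have h2 := ContDiffOn.diffAt hV hh hy.2
  have h3 := contDiff_px.differentiable (by simp) y
  have h4 := contDiff_pu.differentiable (by simp) y
  unfold tp
  rw [pderiv_mul _ (f := fun y => f (px y)) (h := fun y => h (pu y)) (h1.comp y h3) (h2.comp y h4),
    pderiv_hor_comp_px h1, pderiv_hor_comp_pu h2]
  ring

theorem pderiv_ver_tp (α : Fin 2) : pderiv (ver α) (tp f h) y = tp f (pderiv α h) y := by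
  have h1 := ContDiffOn.diffAt hU hf hy.1
  have h2 := ContDiffOn.diffAt hV hh hy.2
  have h3 := contDiff_px.differentiable (by simp) y
  have h4 := contDiff_pu.differentiable (by simp) y
  unfold tp
  rw [pderiv_mul _ (f := fun y => f (px y)) (h := fun y => h (pu y)) (h1.comp y h3) (h2.comp y h4),
    pderiv_ver_comp_px h1, pderiv_ver_comp_pu h2]
  ring

theorem pderiv_hor_hor_tp (a b : Fin 4) :
    pderiv (hor a) (pderiv (hor b) (tp f h)) y = tp (pderiv a (pderiv b f)) h y := by
  rw [pderiv_congr_on (isOpen_boxSet hU hV) hy _ fun z hz => pderiv_hor_tp hU hV hf hh hz b]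
  exact pderiv_hor_tp hU hV (contDiffOn_pderiv hU hf b) hh hy a

theorem pderiv_hor_ver_tp (a : Fin 4) (β : Fin 2) :
    pderiv (hor a) (pderiv (ver β) (tp f h)) y = tp (pderiv a f) (pderiv β h) y := by
  rw [pderiv_congr_on (isOpen_boxSet hU hV) hy _ fun z hz => pderiv_ver_tp hU hV hf hh hz β]
  exact pderiv_hor_tp hU hV hf (contDiffOn_pderiv hV hh β) hy a

theorem pderiv_ver_ver_tp (α β : Fin 2) :
    pderiv (ver α) (pderiv (ver β) (tp f h)) y = tp f (pderiv α (pderiv β h)) y := by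
  rw [pderiv_congr_on (isOpen_boxSet hU hV) hy _ fun z hz => pderiv_ver_tp hU hV hf hh hz β]
  exact pderiv_ver_tp hU hV hf (contDiffOn_pderiv hV hh β) hy α

end Tensor

/-! ## Second partial derivatives -/

section SecondDerivatives

variable {n : ℕ} {U : Set (E n)} {x : E n} {f h : E n → ℝ}

theorem pderiv2_add (hU : IsOpen U) (hx : x ∈ U) (hf : ContDiffOn ℝ ∞ f U)
    (hh : ContDiffOn ℝ ∞ h U) (i j : Fin n) :
    pderiv i (pderiv j fun y => f y + h y) x =
      pderiv i (pderiv j f) x + pderiv i (pderiv j h) x := by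
  rw [pderiv_congr_on hU hx i fun y hy => pderiv_add j (hf.diffAt hU hy) (hh.diffAt hU hy)]
  exact pderiv_add i ((contDiffOn_pderiv hU hf j).diffAt hU hx)
    ((contDiffOn_pderiv hU hh j).diffAt hU hx)

theorem pderiv2_const_mul (hU : IsOpen U) (hx : x ∈ U) (hf : ContDiffOn ℝ ∞ f U) (c : ℝ)
    (i j : Fin n) :
    pderiv i (pderiv j fun y => c * f y) x = c * pderiv i (pderiv j f) x := by
  rw [pderiv_congr_on hU hx i fun y hy => pderiv_const_mul j c (hf.diffAt hU hy)]
  exact pderiv_const_mul i c ((contDiffOn_pderiv hU hf j).diffAt hU hx)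

theorem pderiv2_sum {ι : Type*} (s : Finset ι) {F : ι → E n → ℝ} (hU : IsOpen U) (hx : x ∈ U)
    (hF : ∀ k, ContDiffOn ℝ ∞ (F k) U) (i j : Fin n) :
    pderiv i (pderiv j fun y => ∑ k ∈ s, F k y) x = ∑ k ∈ s, pderiv i (pderiv j (F k)) x := by
  rw [pderiv_congr_on hU hx i fun y hy => pderiv_sum s j fun k _ => (hF k).diffAt hU hy]
  exact pderiv_sum s i fun k _ => (contDiffOn_pderiv hU (hF k) j).diffAt hU hx

theorem pderiv2_mul_of_eq_zero (hU : IsOpen U) (hx : x ∈ U) (hf : ContDiffOn ℝ ∞ f U)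
    (hh : ContDiffOn ℝ ∞ h U) (hf0 : f x = 0) (hh0 : h x = 0) (i j : Fin n) :
    pderiv i (pderiv j fun y => f y * h y) x =
      pderiv i f x * pderiv j h x + pderiv j f x * pderiv i h x := by
  have hf' := (contDiffOn_pderiv hU hf j).diffAt hU hx
  have hh' := (contDiffOn_pderiv hU hh j).diffAt hU hx
  rw [pderiv_congr_on hU hx i fun y hy => pderiv_mul j (hf.diffAt hU hy) (hh.diffAt hU hy),
    pderiv_add i (hf'.fun_mul (hh.diffAt hU hx)) ((hf.diffAt hU hx).fun_mul hh'),
    pderiv_mul i hf' (hh.diffAt hU hx), pderiv_mul i (hf.diffAt hU hx) hh', hf0, hh0]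
  ring

end SecondDerivatives

/-! ## The sphere in graph coordinates -/

section Sphere

/-- The cross product. -/
def cr (a b : Fin 3 → ℝ) : Fin 3 → ℝ :=
  ![a 1 * b 2 - a 2 * b 1, a 2 * b 0 - a 0 * b 2, a 0 * b 1 - a 1 * b 0]

/-- The height function of the unit sphere over a disk of radius `r`. -/
def height (r : ℝ) (u : E 2) : ℝ := √(1 - (u 0 ^ 2 + u 1 ^ 2) / r ^ 2)

/-- Graph coordinates for the unit sphere. -/
def sph (r : ℝ) (u : E 2) : Fin 3 → ℝ := ![height r u, u 0 / r, u 1 / r]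

/-- The domain of the graph coordinates. -/
def disk (r : ℝ) : Set (E 2) := {u | u 0 ^ 2 + u 1 ^ 2 < r ^ 2}

variable {r : ℝ} (hr : 0 < r)

theorem contDiff_coord {n : ℕ} (i : Fin n) : ContDiff ℝ ∞ (fun y : E n => y i) :=
  (EuclideanSpace.proj (𝕜 := ℝ) i).contDiff

theorem isOpen_disk (r : ℝ) : IsOpen (disk r) :=
  isOpen_lt (((contDiff_coord 0).continuous.pow 2).add ((contDiff_coord 1).continuous.pow 2))
    continuous_const

include hr in
theorem zero_mem_disk : (0 : E 2) ∈ disk r := by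
  simp [disk]; positivity

include hr in
theorem radicand_pos {u : E 2} (hu : u ∈ disk r) : 0 < 1 - (u 0 ^ 2 + u 1 ^ 2) / r ^ 2 := by
  have : (u 0 ^ 2 + u 1 ^ 2) / r ^ 2 < 1 := (div_lt_one (by positivity)).2 hu
  linarith

theorem contDiff_radicand (r : ℝ) :
    ContDiff ℝ ∞ (fun u : E 2 => 1 - (u 0 ^ 2 + u 1 ^ 2) / r ^ 2) :=
  contDiff_const.sub ((((contDiff_coord 0).pow 2).add ((contDiff_coord 1).pow 2)).div_const _)

include hr in
theorem contDiffOn_height : ContDiffOn ℝ ∞ (height r) (disk r) :=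
  (contDiff_radicand r).contDiffOn.sqrt fun _ hu => (radicand_pos hr hu).ne'

include hr in
theorem contDiffOn_sph (k : Fin 3) : ContDiffOn ℝ ∞ (fun u => sph r u k) (disk r) := by
  fin_cases k
  · exact contDiffOn_height hr
  · exact ((contDiff_coord 0).div_const r).contDiffOn
  · exact ((contDiff_coord 1).div_const r).contDiffOn

include hr in
theorem height_sq {u : E 2} (hu : u ∈ disk r) :
    height r u * height r u = 1 - (u 0 ^ 2 + u 1 ^ 2) / r ^ 2 :=
  Real.mul_self_sqrt (radicand_pos hr hu).le

include hr in
theorem sph_norm {u : E 2} (hu : u ∈ disk r) : ∑ k, sph r u k ^ 2 = 1 := by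
  have := height_sq hr hu
  simp only [Fin.sum_univ_three, sph, Matrix.cons_val_zero, Matrix.cons_val_one, Matrix.cons_val]
  rw [sq, this]
  field_simp
  ring

theorem height_zero : height r 0 = 1 := by simp [height]

theorem pderiv_coord_sq {n : ℕ} (i j : Fin n) (x : E n) :
    pderiv i (fun y => y j ^ 2) x = if i = j then 2 * x j else 0 := by
  have hd := fun j => (contDiff_coord j).differentiable (by simp) x
  simp only [sq]
  rw [pderiv_mul i (hd j) (hd j), pderiv_coord]
  split_ifs <;> ring

theorem pderiv_radicand (α : Fin 2) (u : E 2) :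
    pderiv α (fun u : E 2 => 1 - (u 0 ^ 2 + u 1 ^ 2) / r ^ 2) u = - (2 * u α) / r ^ 2 := by
  have hd := fun j => ((contDiff_coord j).pow 2).differentiable (by simp) u
  have : (fun u : E 2 => 1 - (u 0 ^ 2 + u 1 ^ 2) / r ^ 2) =
      fun u : E 2 => 1 - (1 / r ^ 2) * (u 0 ^ 2 + u 1 ^ 2) := by
    funext u; ring
  rw [this, pderiv_sub α (differentiableAt_const _) (((hd 0).fun_add (hd 1)).const_mul _),
    pderiv_const, pderiv_const_mul α _ ((hd 0).fun_add (hd 1)), pderiv_add α (hd 0) (hd 1),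
    pderiv_coord_sq, pderiv_coord_sq]
  fin_cases α <;> simp <;> ring

include hr in
-- Implicit differentiation of the square of the height, so that derivatives of the square root are
-- never computed. Differentiating once more gives the Hessian at the pole.
theorem height_mul_pderiv {u : E 2} (hu : u ∈ disk r) (α : Fin 2) :
    height r u * pderiv α (height r) u = (-1 / r ^ 2) * u α := by
  have hd := (contDiffOn_height hr).diffAt (isOpen_disk r) hu
  have h1 := pderiv_congr_on (isOpen_disk r) hu α fun u hu => height_sq hr hu
  rw [pderiv_mul α hd hd, pderiv_radicand] at h1
  have h2 : (-1 / r ^ 2) * u α = (1 / 2) * (- (2 * u α) / r ^ 2) := by ring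
  rw [h2, ← h1]; ring

include hr in
theorem pderiv_height_zero (α : Fin 2) : pderiv α (height r) 0 = 0 := by
  have := height_mul_pderiv hr (zero_mem_disk hr) α
  rw [height_zero] at this
  simpa using this

include hr in
theorem pderiv2_height_zero (α β : Fin 2) : pderiv α (pderiv β (height r)) 0 =
    if α = β then -1 / r ^ 2 else 0 := by
  have h0 := zero_mem_disk hr
  have hd := (contDiffOn_height hr).diffAt (isOpen_disk r) h0
  have hd' := (contDiffOn_pderiv (isOpen_disk r) (contDiffOn_height hr) β).diffAt (isOpen_disk r) h0
  have h1 := pderiv_congr_on (isOpen_disk r) h0 α fun u hu => height_mul_pderiv hr hu β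
  rw [pderiv_mul α hd hd', pderiv_height_zero hr, height_zero,
    pderiv_const_mul α _ ((contDiff_coord β).differentiable (by simp) _), pderiv_coord] at h1
  split_ifs at h1 ⊢ <;> linarith

theorem pderiv_sph_zero (α : Fin 2) (u : E 2) :
    pderiv α (fun u => sph r u 0) u = pderiv α (height r) u := rfl

theorem pderiv_sph_one (α : Fin 2) (u : E 2) :
    pderiv α (fun u => sph r u 1) u = if α = 0 then 1 / r else 0 := by
  have : (fun u => sph r u 1) = fun u : E 2 => (1 / r) * u 0 := by
    funext u; simp [sph]; ring
  rw [this, pderiv_const_mul α _ ((contDiff_coord 0).differentiable (by simp) _), pderiv_coord]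
  split_ifs <;> ring

theorem pderiv_sph_two (α : Fin 2) (u : E 2) :
    pderiv α (fun u => sph r u 2) u = if α = 1 then 1 / r else 0 := by
  have : (fun u => sph r u 2) = fun u : E 2 => (1 / r) * u 1 := by
    funext u; simp [sph]; ring
  rw [this, pderiv_const_mul α _ ((contDiff_coord 1).differentiable (by simp) _), pderiv_coord]
  split_ifs <;> ring

/-- The vector `∂_α S` for the graph coordinates `S` of the sphere. -/
def dsph (r : ℝ) (α : Fin 2) (u : E 2) : Fin 3 → ℝ := fun k => pderiv α (fun u => sph r u k) u

include hr in
theorem contDiffOn_dsph (α : Fin 2) (k : Fin 3) : ContDiffOn ℝ ∞ (fun u => dsph r α u k) (disk r) :=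
  contDiffOn_pderiv (isOpen_disk r) (contDiffOn_sph hr k) α

theorem contDiffOn_cr {n : ℕ} {U : Set (E n)} {a b : E n → Fin 3 → ℝ}
    (ha : ∀ k, ContDiffOn ℝ ∞ (fun y => a y k) U) (hb : ∀ k, ContDiffOn ℝ ∞ (fun y => b y k) U)
    (k : Fin 3) : ContDiffOn ℝ ∞ (fun y => cr (a y) (b y) k) U := by
  fin_cases k
  · exact ((ha 1).mul (hb 2)).sub ((ha 2).mul (hb 1))
  · exact ((ha 2).mul (hb 0)).sub ((ha 0).mul (hb 2))
  · exact ((ha 0).mul (hb 1)).sub ((ha 1).mul (hb 0))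

include hr in
theorem dsph_zero (α : Fin 2) :
    dsph r α 0 = ![0, if α = 0 then 1 / r else 0, if α = 1 then 1 / r else 0] := by
  ext k
  fin_cases k
  · exact pderiv_height_zero hr α
  · exact pderiv_sph_one α 0
  · exact pderiv_sph_two α 0

theorem sph_zero : sph r 0 = ![1, 0, 0] := by
  ext k; fin_cases k <;> simp [sph, height_zero]

include hr in
theorem cr_sph_dsph_zero (α : Fin 2) : cr (sph r 0) (dsph r α 0) =
    ![0, if α = 1 then - (1 / r) else 0, if α = 0 then 1 / r else 0] := by
  rw [dsph_zero hr, sph_zero]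
  ext k
  fin_cases k <;> simp [cr]
  split_ifs <;> simp

include hr in
-- By the product rule the derivative is `∂_β S × ∂_α S + S × ∂_β ∂_α S`. The first term is skew.
-- The second vanishes at the pole, because only the height has second derivatives and so `∂_β ∂_α
-- S` is parallel to `S`.
theorem pderiv_cr_sph_dsph_skew (α β : Fin 2) (k : Fin 3) :
    pderiv β (fun u => cr (sph r u) (dsph r α u) k) 0 =
      - pderiv α (fun u => cr (sph r u) (dsph r β u) k) 0 := by
  have h0 := zero_mem_disk hr
  have hS := fun k => (contDiffOn_sph hr k).diffAt (isOpen_disk r) h0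
  have hD := fun α k => (contDiffOn_dsph hr α k).diffAt (isOpen_disk r) h0
  have key : ∀ α β k, pderiv β (fun u => cr (sph r u) (dsph r α u) k) 0 =
      cr (dsph r β 0) (dsph r α 0) k
        + cr (sph r 0) (fun k => pderiv β (fun u => dsph r α u k) 0) k := by
    intro α β k
    have h := fun a b => pderiv_mul β (hS a) (hD α b)
    fin_cases k
    · refine (pderiv_sub β ((hS 1).fun_mul (hD α 2)) ((hS 2).fun_mul (hD α 1))).trans ?_
      rw [h, h]; simp [cr, dsph]; ring
    · refine (pderiv_sub β ((hS 2).fun_mul (hD α 0)) ((hS 0).fun_mul (hD α 2))).trans ?_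
      rw [h, h]; simp [cr, dsph]; ring
    · refine (pderiv_sub β ((hS 0).fun_mul (hD α 1)) ((hS 1).fun_mul (hD α 0))).trans ?_
      rw [h, h]; simp [cr, dsph]; ring
  have h1 : ∀ α β : Fin 2, pderiv β (fun u => dsph r α u 1) 0 = 0 := fun α β => by
    simp only [dsph, pderiv_sph_one, pderiv_const]
  have h2 : ∀ α β : Fin 2, pderiv β (fun u => dsph r α u 2) 0 = 0 := fun α β => by
    simp only [dsph, pderiv_sph_two, pderiv_const]
  rw [key, key, sph_zero]
  fin_cases k <;> simp [cr, h1, h2] <;> ring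

/-- The coefficients of the round metric of radius `r` in graph coordinates. -/
def roundCoeff (r : ℝ) (α β : Fin 2) (u : E 2) : ℝ := r ^ 2 * ∑ k, dsph r α u k * dsph r β u k

include hr in
theorem contDiffOn_roundCoeff (α β : Fin 2) : ContDiffOn ℝ ∞ (roundCoeff r α β) (disk r) :=
  contDiffOn_const.mul (ContDiffOn.sum fun k _ =>
    (contDiffOn_dsph hr α k).mul (contDiffOn_dsph hr β k))

/-- The first fundamental form of a graph. The factor `1 / r` in the graph coordinates makes the
metric of the sphere of radius `r` standard at the pole. -/
theorem roundCoeff_eq (hr : 0 < r) (α β : Fin 2) (u : E 2) : roundCoeff r α β u =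
    (if α = β then 1 else 0) + r ^ 2 * (pderiv α (height r) u * pderiv β (height r) u) := by
  simp only [roundCoeff, dsph, Fin.sum_univ_three, pderiv_sph_zero, pderiv_sph_one, pderiv_sph_two]
  have : r ≠ 0 := hr.ne'
  fin_cases α <;> fin_cases β <;> simp <;> field_simp <;> ring

include hr in
theorem roundCoeff_zero (α β : Fin 2) : roundCoeff r α β 0 = if α = β then 1 else 0 := by
  rw [roundCoeff_eq hr, pderiv_height_zero hr]; simp

include hr in
theorem pderiv_roundCoeff_zero (γ α β : Fin 2) : pderiv γ (roundCoeff r α β) 0 = 0 := by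
  have h0 := zero_mem_disk hr
  have hd := fun α => (contDiffOn_pderiv (isOpen_disk r) (contDiffOn_height hr) α).diffAt
    (isOpen_disk r) h0
  rw [show roundCoeff r α β = _ from funext (roundCoeff_eq hr α β),
    pderiv_add γ (differentiableAt_const _) (((hd α).fun_mul (hd β)).const_mul _), pderiv_const,
    pderiv_const_mul γ _ ((hd α).fun_mul (hd β)), pderiv_mul γ (hd α) (hd β),
    pderiv_height_zero hr, pderiv_height_zero hr]
  ring

include hr in
theorem pderiv2_roundCoeff_zero (γ δ α β : Fin 2) : pderiv γ (pderiv δ (roundCoeff r α β)) 0 =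
    (1 / r ^ 2) * ((if γ = α then 1 else 0) * (if δ = β then 1 else 0)
      + (if δ = α then 1 else 0) * (if γ = β then 1 else 0)) := by
  have h0 := zero_mem_disk hr
  have hO := isOpen_disk r
  have hs := fun α => contDiffOn_pderiv hO (contDiffOn_height hr) α
  rw [show roundCoeff r α β = _ from funext (roundCoeff_eq hr α β),
    pderiv2_add hO h0 contDiffOn_const (contDiffOn_const.mul ((hs α).mul (hs β))),
    pderiv2_const_mul hO h0 ((hs α).mul (hs β)),
    pderiv2_mul_of_eq_zero hO h0 (hs α) (hs β) (pderiv_height_zero hr α) (pderiv_height_zero hr β)]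
  have : pderiv γ (pderiv δ fun _ : E 2 => if α = β then (1 : ℝ) else 0) 0 = 0 := by
    rw [pderiv_congr_on hO h0 γ fun y _ => pderiv_const δ _ y, pderiv_const]
  rw [this]
  simp only [pderiv2_height_zero hr]
  have : r ≠ 0 := hr.ne'
  split_ifs <;> field_simp <;> ring

end Sphere

/-! ## The metric of a sphere bundle with connection form `θ` -/

section BundleMetric

variable (r : ℝ) (G : E 4 → Matrix (Fin 4) (Fin 4) ℝ) (θ : Fin 4 → E 4 → Fin 3 → ℝ)

/-- The components of the vertical parts of the coordinate vectors. -/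
def bundleVec (I : Fin 6) (y : E 6) : Fin 3 → ℝ :=
  Fin.addCases (m := 4) (n := 2) (motive := fun _ => Fin 3 → ℝ)
    (fun a => cr (θ a (px y)) (sph r (pu y))) (fun α => dsph r α (pu y)) I

/-- The pull-back to the bundle of the metric `G` of the base. -/
def baseCoeff (I J : Fin 6) (y : E 6) : ℝ :=
  Fin.addCases (m := 4) (n := 2) (motive := fun _ => ℝ)
    (fun a => Fin.addCases (m := 4) (n := 2) (motive := fun _ => ℝ)
      (fun b => G (px y) a b) (fun _ => 0) J) (fun _ => 0) I

/-- The coefficient matrix of the metric on the bundle of spheres of radius `r`. -/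
def bundleMetric (y : E 6) : Matrix (Fin 6) (Fin 6) ℝ :=
  Matrix.of fun I J => baseCoeff G I J y + r ^ 2 * ∑ k, bundleVec r θ I y k * bundleVec r θ J y k

/-- The coefficients `(e_k × S) · (e_l × S)`. -/
def crossCoeff (k l : Fin 3) (u : E 2) : ℝ :=
  (if k = l then ∑ j, sph r u j ^ 2 else 0) - sph r u k * sph r u l

theorem crossCoeff_zero (k l : Fin 3) :
    crossCoeff r k l 0 = if k = l then if k = 0 then 0 else 1 else 0 := by
  unfold crossCoeff
  rw [sph_zero]
  fin_cases k <;> fin_cases l <;> simp [Fin.sum_univ_three]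

theorem bundleVec_hor (a : Fin 4) (y : E 6) :
    bundleVec r θ (hor a) y = cr (θ a (px y)) (sph r (pu y)) :=
  Fin.addCases_left (m := 4) (n := 2) (motive := fun _ => Fin 3 → ℝ) a

theorem bundleVec_ver (α : Fin 2) (y : E 6) : bundleVec r θ (ver α) y = dsph r α (pu y) :=
  Fin.addCases_right (m := 4) (n := 2) (motive := fun _ => Fin 3 → ℝ) α

theorem baseCoeff_hor_hor (a b : Fin 4) (y : E 6) :
    baseCoeff G (hor a) (hor b) y = G (px y) a b := by
  unfold baseCoeff
  exact (Fin.addCases_left (m := 4) (n := 2) (motive := fun _ => ℝ) a).trans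
    (Fin.addCases_left (m := 4) (n := 2) (motive := fun _ => ℝ) b)

theorem baseCoeff_hor_ver (a : Fin 4) (β : Fin 2) (y : E 6) :
    baseCoeff G (hor a) (ver β) y = 0 := by
  unfold baseCoeff
  exact (Fin.addCases_left (m := 4) (n := 2) (motive := fun _ => ℝ) a).trans
    (Fin.addCases_right (m := 4) (n := 2) (motive := fun _ => ℝ) β)

theorem baseCoeff_ver (α : Fin 2) (J : Fin 6) (y : E 6) :
    baseCoeff G (ver α) J y = 0 := by
  unfold baseCoeff
  exact Fin.addCases_right (m := 4) (n := 2) (motive := fun _ => ℝ) α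

/-- Lagrange's identity for cross products. With `|S|²` left unevaluated in `crossCoeff` the
identity is polynomial and holds for all `y`, not only over the disk. Writing the coefficient as a
sum of products of a function on the base and a function on the fibre lets partial derivatives act
factor by factor. -/
theorem bundleMetric_hor_hor (a b : Fin 4) :
    (fun y => bundleMetric r G θ y (hor a) (hor b)) = fun y => tp (fun x => G x a b) (fun _ => 1) y
      + ∑ p : Fin 3 × Fin 3,
        r ^ 2 * tp (fun x => θ a x p.1 * θ b x p.2) (crossCoeff r p.1 p.2) y := by
  funext y
  simp only [bundleMetric, Matrix.of_apply, baseCoeff_hor_hor, bundleVec_hor, tp, crossCoeff,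
    Fintype.sum_prod_type, Fin.sum_univ_three, cr]
  simp
  ring

theorem bundleMetric_hor_ver (a : Fin 4) (β : Fin 2) :
    (fun y => bundleMetric r G θ y (hor a) (ver β)) = fun y => ∑ k,
      r ^ 2 * tp (fun x => θ a x k) (fun u => cr (sph r u) (dsph r β u) k) y := by
  funext y
  simp only [bundleMetric, Matrix.of_apply, baseCoeff_hor_ver, bundleVec_hor, bundleVec_ver, tp,
    Fin.sum_univ_three, cr]
  simp
  ring

theorem bundleMetric_ver_ver (α β : Fin 2) :
    (fun y => bundleMetric r G θ y (ver α) (ver β)) = tp (fun _ => 1) (roundCoeff r α β) := by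
  funext y
  simp only [bundleMetric, Matrix.of_apply, baseCoeff_ver, bundleVec_ver, tp, roundCoeff]
  ring

theorem bundleMetric_symm {y : E 6} (hs : ∀ a b, G (px y) a b = G (px y) b a) (I J : Fin 6) :
    bundleMetric r G θ y I J = bundleMetric r G θ y J I := by
  have hb : baseCoeff G I J y = baseCoeff G J I y := by
    refine Fin.addCases (m := 4) (n := 2) (fun a => ?_) (fun α => ?_) I <;>
    refine Fin.addCases (m := 4) (n := 2) (fun b => ?_) (fun β => ?_) J
    · exact (baseCoeff_hor_hor G a b y).trans ((hs a b).trans (baseCoeff_hor_hor G b a y).symm)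
    · exact (baseCoeff_hor_ver G a β y).trans (baseCoeff_ver G β (hor a) y).symm
    · exact (baseCoeff_ver G α (hor b) y).trans (baseCoeff_hor_ver G b α y).symm
    · exact (baseCoeff_ver G α (ver β) y).trans (baseCoeff_ver G β (ver α) y).symm
  simp only [bundleMetric, Matrix.of_apply, hb, mul_comm]

end BundleMetric

/-! ### The 2-jet and the Ricci tensor of the bundle metric at the origin -/

section BundleMetricJet

variable {r : ℝ} {G : E 4 → Matrix (Fin 4) (Fin 4) ℝ} {θ : Fin 4 → E 4 → Fin 3 → ℝ}
  {U : Set (E 4)}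

theorem px_zero : px 0 = 0 := by ext i; simp [px]

theorem pu_zero : pu 0 = 0 := by ext i; simp [pu]

/-- The second derivatives of a metric at the origin. -/
def jet2 (G : E 4 → Matrix (Fin 4) (Fin 4) ℝ) (c d a b : Fin 4) : ℝ :=
  pderiv c (pderiv d fun x => G x a b) 0

/-- The coefficients `e_k · (S × ∂_α S)` at the origin. -/
def momentCoeff (r : ℝ) (k : Fin 3) (α : Fin 2) : ℝ := cr (sph r 0) (dsph r α 0) k

/-- The first derivatives of the mixed coefficients of the bundle metric. -/
def connJet1 (r : ℝ) (θ : Fin 4 → E 4 → Fin 3 → ℝ) (c a : Fin 4) (α : Fin 2) : ℝ :=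
  ∑ k, r ^ 2 * (pderiv c (fun x => θ a x k) 0 * momentCoeff r k α)

/-- The second horizontal derivatives of the mixed coefficients of the bundle metric. -/
def connJet2 (r : ℝ) (θ : Fin 4 → E 4 → Fin 3 → ℝ) (c d a : Fin 4) (α : Fin 2) : ℝ :=
  ∑ k, r ^ 2 * (pderiv c (pderiv d fun x => θ a x k) 0 * momentCoeff r k α)

/-- The mixed second derivatives of the mixed coefficients of the bundle metric. -/
def connJetMixed (r : ℝ) (θ : Fin 4 → E 4 → Fin 3 → ℝ) (c a : Fin 4) (γ α : Fin 2) : ℝ :=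
  ∑ k, r ^ 2 * (pderiv c (fun x => θ a x k) 0 *
    pderiv γ (fun u => cr (sph r u) (dsph r α u) k) 0)

variable (hr : 0 < r)
include hr

theorem contDiffOn_crossCoeff (k l : Fin 3) : ContDiffOn ℝ ∞ (crossCoeff r k l) (disk r) := by
  have hs := contDiffOn_sph hr
  unfold crossCoeff
  refine ContDiffOn.sub ?_ ((hs k).mul (hs l))
  split_ifs
  · exact ContDiffOn.sum fun j _ => (hs j).pow 2
  · exact contDiffOn_const

theorem contDiffOn_moment (k : Fin 3) (α : Fin 2) :
    ContDiffOn ℝ ∞ (fun u => cr (sph r u) (dsph r α u) k) (disk r) :=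
  contDiffOn_cr (contDiffOn_sph hr) (contDiffOn_dsph hr α) k

variable (hG : IsMetricOn U G) (hθ : ∀ a k, ContDiffOn ℝ ∞ (fun x => θ a x k) U)
include hG hθ

theorem contDiffOn_bundleMetric (I J : Fin 6) :
    ContDiffOn ℝ ∞ (fun y => bundleMetric r G θ y I J) (boxSet U (disk r)) := by
  have hb : ContDiffOn ℝ ∞ (baseCoeff G I J) (boxSet U (disk r)) := by
    refine Fin.addCases (m := 4) (n := 2) (fun a => ?_) (fun α => ?_) I <;>
    refine Fin.addCases (m := 4) (n := 2) (fun b => ?_) (fun β => ?_) J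
    · exact ((hG.smooth a b).comp contDiff_px.contDiffOn fun _ hy => hy.1).congr
        fun y _ => baseCoeff_hor_hor G a b y
    · exact (contDiffOn_const (c := 0)).congr fun y _ => baseCoeff_hor_ver G a β y
    · exact (contDiffOn_const (c := 0)).congr fun y _ => baseCoeff_ver G α _ y
    · exact (contDiffOn_const (c := 0)).congr fun y _ => baseCoeff_ver G α _ y
  have hv : ∀ I k, ContDiffOn ℝ ∞ (fun y => bundleVec r θ I y k) (boxSet U (disk r)) := by
    intro I k
    refine Fin.addCases (m := 4) (n := 2) (fun a => ?_) (fun α => ?_) I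
    · refine (contDiffOn_cr (a := fun y => θ a (px y)) (b := fun y => sph r (pu y))
        (fun k => (hθ a k).comp contDiff_px.contDiffOn fun _ hy => hy.1)
        (fun k => (contDiffOn_sph hr k).comp contDiff_pu.contDiffOn fun _ hy => hy.2) k).congr
        fun y _ => congrFun (bundleVec_hor r θ a y) k
    · exact ((contDiffOn_dsph hr α k).comp contDiff_pu.contDiffOn fun _ hy => hy.2).congr
        fun y _ => congrFun (bundleVec_ver r θ α y) k
  exact hb.add (contDiffOn_const.mul (ContDiffOn.sum fun k _ => (hv I k).mul (hv J k)))

variable (h0 : (0 : E 4) ∈ U) (hG1 : G 0 = 1) (hθ0 : ∀ a k, θ a 0 k = 0)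
include h0 hG1 hθ0

omit hG hθ h0 in
theorem bundleMetric_zero : bundleMetric r G θ 0 = 1 := by
  have hw : ∀ a, θ a 0 = 0 := fun a => funext (hθ0 a)
  have hv : ∀ a, bundleVec r θ (hor a) 0 = 0 := fun a => by
    rw [bundleVec_hor, px_zero, hw]; ext k; fin_cases k <;> simp [cr]
  ext I J
  refine Fin.addCases (m := 4) (n := 2) (fun a => ?_) (fun α => ?_) I <;>
  refine Fin.addCases (m := 4) (n := 2) (fun b => ?_) (fun β => ?_) J
  · have : bundleMetric r G θ 0 (hor a) (hor b) = if a = b then 1 else 0 := by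
      simp only [bundleMetric, Matrix.of_apply, baseCoeff_hor_hor, hv, px_zero, hG1,
        Matrix.one_apply]
      simp
    refine this.trans ?_
    rw [Matrix.one_apply]
    simp [(Fin.castAdd_injective 4 2).eq_iff]
  · have : bundleMetric r G θ 0 (hor a) (ver β) = 0 := by
      simp only [bundleMetric, Matrix.of_apply, baseCoeff_hor_ver, hv]
      simp
    refine this.trans (Matrix.one_apply_ne ?_).symm
    intro h; have := congrArg Fin.val h; simp at this; omega
  · have : bundleMetric r G θ 0 (ver α) (hor b) = 0 := by
      simp only [bundleMetric, Matrix.of_apply, baseCoeff_ver, hv]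
      simp
    refine this.trans (Matrix.one_apply_ne ?_).symm
    intro h; have := congrArg Fin.val h; simp at this; omega
  · have : bundleMetric r G θ 0 (ver α) (ver β) = if α = β then 1 else 0 := by
      have := congrFun (bundleMetric_ver_ver r G θ α β) 0
      simp only [tp, pu_zero, roundCoeff_zero hr, one_mul] at this
      exact this
    refine this.trans ?_
    rw [Matrix.one_apply]
    simp [(Fin.natAdd_injective 2 4).eq_iff]

theorem bundleMetric_isMetricOn : ∃ W, IsMetricOn W (bundleMetric r G θ) ∧ (0 : E 6) ∈ W ∧
    W ⊆ boxSet U (disk r) := by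
  have hbox := isOpen_boxSet hG.isOpen (isOpen_disk r)
  have hsm : MatSmooth (boxSet U (disk r)) (bundleMetric r G θ) := contDiffOn_bundleMetric hr hG hθ
  refine ⟨boxSet U (disk r) ∩ (fun y => (bundleMetric r G θ y).det) ⁻¹' {0}ᶜ, ⟨?_, ?_, ?_, ?_⟩,
    ⟨⟨?_, ?_⟩, ?_⟩, Set.inter_subset_left⟩
  · exact hsm.det.continuousOn.isOpen_inter_preimage hbox isOpen_compl_singleton
  · exact hsm.mono Set.inter_subset_left
  · exact fun y hy => bundleMetric_symm r G θ fun a b => hG.symm _ hy.1.1 a b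
  · exact fun y hy => hy.2
  · simpa [px_zero] using h0
  · simpa [pu_zero] using zero_mem_disk hr
  · simp [bundleMetric_zero hr hG1 hθ0]

variable (hdG : ∀ i, mpd i G 0 = 0)
include hdG

/-- All coefficients are sums of products `tp`, so each derivative at the origin is a product of a
base factor and a fibre factor. The normalizations of `G` and θ remove everything except the listed
terms. -/
theorem bundleMetric_jet : HasBundleJet (bundleMetric r G θ) 0 (1 / r ^ 2) (connJet1 r θ) (jet2 G)
    (connJet2 r θ) (connJetMixed r θ) := by
  have hU := hG.isOpen
  have hV := isOpen_disk r
  have h0' := zero_mem_disk hr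
  have hB : (0 : E 6) ∈ boxSet U (disk r) :=
    ⟨by simpa [px_zero] using h0, by simpa [pu_zero] using zero_mem_disk hr⟩
  have hO := isOpen_boxSet hU hV
  have hdG' : ∀ i a b, pderiv i (fun x => G x a b) 0 = 0 := fun i a b =>
    congrFun (congrFun (hdG i) a) b
  have c1 : ∀ {n : ℕ} {U : Set (E n)}, ContDiffOn ℝ ∞ (fun _ : E n => (1 : ℝ)) U :=
    contDiffOn_const
  have z1 : ∀ {n : ℕ} (i : Fin n), pderiv i (fun _ : E n => (1 : ℝ)) = fun _ => 0 := fun i =>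
    funext fun x => pderiv_const i 1 x
  have z2 : ∀ {n : ℕ} (i : Fin n), pderiv i (fun _ : E n => (0 : ℝ)) = fun _ => 0 := fun i =>
    funext fun x => pderiv_const i 0 x
  have hww := fun a b k l => (hθ a k).mul (hθ b l)
  have dww : ∀ c a b k l, pderiv c (fun x => θ a x k * θ b x l) 0 = 0 := fun c a b k l => by
    rw [pderiv_mul c ((hθ a k).diffAt hU h0) ((hθ b l).diffAt hU h0), hθ0, hθ0]; ring
  have ddww := fun a b k l =>
    pderiv2_mul_of_eq_zero hU h0 (hθ a k) (hθ b l) (hθ0 a k) (hθ0 b l)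
  have hX := contDiffOn_crossCoeff hr
  have hM := contDiffOn_moment hr
  have hR := contDiffOn_roundCoeff hr
  have t1 := fun a b => contDiffOn_tp (hG.smooth a b) (c1 (U := disk r))
  have t2 := fun a b k l => contDiffOn_tp (hww a b k l) (hX k l)
  have t2c := fun a b (p : Fin 3 × Fin 3) =>
    (contDiffOn_const (c := r ^ 2)).mul (t2 a b p.1 p.2)
  have t3 := fun a k α => contDiffOn_tp (hθ a k) (hM k α)
  have t3c := fun a k α => (contDiffOn_const (c := r ^ 2)).mul (t3 a k α)
  have t4 := fun α β => contDiffOn_tp (c1 (U := U)) (hR α β)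
  have d_hh : ∀ I a b, pderiv I (fun y => bundleMetric r G θ y (hor a) (hor b)) 0 =
      pderiv I (tp (fun x => G x a b) (fun _ => 1)) 0 + ∑ p : Fin 3 × Fin 3,
        r ^ 2 * pderiv I (tp (fun x => θ a x p.1 * θ b x p.2) (crossCoeff r p.1 p.2)) 0 := by
    intro I a b
    rw [bundleMetric_hor_hor, pderiv_add I ((t1 a b).diffAt hO hB)
      ((ContDiffOn.sum fun p _ => t2c a b p).diffAt hO hB),
      pderiv_sum _ I fun p _ => (t2c a b p).diffAt hO hB]
    congr 1
    exact Finset.sum_congr rfl fun p _ => pderiv_const_mul I _ ((t2 a b _ _).diffAt hO hB)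
  have dd_hh : ∀ I J a b, pderiv I (pderiv J fun y => bundleMetric r G θ y (hor a) (hor b)) 0 =
      pderiv I (pderiv J (tp (fun x => G x a b) (fun _ => 1))) 0 + ∑ p : Fin 3 × Fin 3,
        r ^ 2 * pderiv I (pderiv J
          (tp (fun x => θ a x p.1 * θ b x p.2) (crossCoeff r p.1 p.2))) 0 := by
    intro I J a b
    rw [bundleMetric_hor_hor, pderiv2_add hO hB (t1 a b)
      (ContDiffOn.sum fun p _ => t2c a b p), pderiv2_sum _ hO hB fun p => t2c a b p]
    congr 1
    exact Finset.sum_congr rfl fun p _ => pderiv2_const_mul hO hB (t2 a b _ _) _ _ _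
  have d_hv : ∀ I a α, pderiv I (fun y => bundleMetric r G θ y (hor a) (ver α)) 0 =
      ∑ k, r ^ 2 * pderiv I (tp (fun x => θ a x k) (fun u => cr (sph r u) (dsph r α u) k)) 0 := by
    intro I a α
    rw [bundleMetric_hor_ver, pderiv_sum _ I fun k _ => (t3c a k α).diffAt hO hB]
    exact Finset.sum_congr rfl fun k _ => pderiv_const_mul I _ ((t3 a k α).diffAt hO hB)
  have dd_hv : ∀ I J a α, pderiv I (pderiv J fun y => bundleMetric r G θ y (hor a) (ver α)) 0 =
      ∑ k, r ^ 2 * pderiv I (pderiv J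
        (tp (fun x => θ a x k) (fun u => cr (sph r u) (dsph r α u) k))) 0 := by
    intro I J a α
    rw [bundleMetric_hor_ver, pderiv2_sum _ hO hB fun k => t3c a k α]
    exact Finset.sum_congr rfl fun k _ => pderiv2_const_mul hO hB (t3 a k α) _ _ _
  constructor
  · intro I a b
    rw [d_hh]
    refine Fin.addCases (m := 4) (n := 2) (fun c => ?_) (fun γ => ?_) I
    · rw [pderiv_hor_tp hU hV (hG.smooth a b) c1 hB c]
      simp_rw [pderiv_hor_tp hU hV (hww a b _ _) (hX _ _) hB c]
      simp [tp, px_zero, hdG', dww]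
    · rw [pderiv_ver_tp hU hV (hG.smooth a b) c1 hB γ]
      simp_rw [pderiv_ver_tp hU hV (hww a b _ _) (hX _ _) hB γ]
      simp [tp, px_zero, z1, hθ0]
  · intro c a α
    rw [d_hv]
    simp_rw [pderiv_hor_tp hU hV (hθ a _) (hM _ α) hB c]
    simp [tp, px_zero, pu_zero, connJet1, momentCoeff]
  · intro γ a α
    rw [d_hv]
    simp_rw [pderiv_ver_tp hU hV (hθ a _) (hM _ α) hB γ]
    simp [tp, px_zero, hθ0]
  · intro I α β
    rw [bundleMetric_ver_ver]
    refine Fin.addCases (m := 4) (n := 2) (fun c => ?_) (fun γ => ?_) I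
    · rw [pderiv_hor_tp hU hV c1 (hR α β) hB c]; simp [tp, z1]
    · rw [pderiv_ver_tp hU hV c1 (hR α β) hB γ]; simp [tp, pu_zero, pderiv_roundCoeff_zero hr]
  · intro c d a b
    rw [dd_hh, pderiv_hor_hor_tp hU hV (hG.smooth a b) c1 hB c d]
    simp_rw [pderiv_hor_hor_tp hU hV (hww a b _ _) (hX _ _) hB c d]
    -- Since θ vanishes at the origin, second derivatives of products of θ are products of first
    -- derivatives. At the pole `crossCoeff` is the projection to the plane orthogonal to `S`, and
    -- this plane is also the span of the vectors `momentCoeff`; hence the sum of products of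
    -- `connJet1`.
    simp only [tp, px_zero, pu_zero, ddww, jet2, connJet1, momentCoeff, cr_sph_dsph_zero hr,
      crossCoeff_zero, Fintype.sum_prod_type, Fin.sum_univ_three, Fin.sum_univ_two]
    have : r ≠ 0 := hr.ne'
    simp
    field_simp
    ring
  · intro γ δ a b
    rw [dd_hh, pderiv_ver_ver_tp hU hV (hG.smooth a b) c1 hB γ δ]
    simp_rw [pderiv_ver_ver_tp hU hV (hww a b _ _) (hX _ _) hB γ δ]
    simp [tp, px_zero, z1, z2, hθ0]
  · intro c δ a b
    rw [dd_hh, pderiv_hor_ver_tp hU hV (hG.smooth a b) c1 hB c δ]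
    simp_rw [pderiv_hor_ver_tp hU hV (hww a b _ _) (hX _ _) hB c δ]
    simp [tp, px_zero, z1, dww]
  · intro c d a α
    rw [dd_hv]
    simp_rw [pderiv_hor_hor_tp hU hV (hθ a _) (hM _ α) hB c d]
    simp [tp, px_zero, pu_zero, connJet2, momentCoeff]
  · intro c δ a α
    rw [dd_hv]
    simp_rw [pderiv_hor_ver_tp hU hV (hθ a _) (hM _ α) hB c δ]
    simp [tp, px_zero, pu_zero, connJetMixed]
  · intro γ δ a α
    rw [dd_hv]
    simp_rw [pderiv_ver_ver_tp hU hV (hθ a _) (hM _ α) hB γ δ]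
    simp [tp, px_zero, hθ0]
  · intro c d α β
    rw [bundleMetric_ver_ver, pderiv_hor_hor_tp hU hV c1 (hR α β) hB c d]
    simp [tp, z1, z2]
  · intro c δ α β
    rw [bundleMetric_ver_ver, pderiv_hor_ver_tp hU hV c1 (hR α β) hB c δ]
    simp [tp, z1]
  · intro γ δ α β
    rw [bundleMetric_ver_ver, pderiv_ver_ver_tp hU hV c1 (hR α β) hB γ δ]
    simp only [tp, pu_zero, pderiv2_roundCoeff_zero hr, one_mul]
  · intro c a γ α
    simp only [connJetMixed]
    rw [← Finset.sum_neg_distrib]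
    exact Finset.sum_congr rfl fun k _ => by rw [pderiv_cr_sph_dsph_skew hr α γ]; ring

/-- The exterior derivative of the connection form at the origin. -/
def dConn (θ : Fin 4 → E 4 → Fin 3 → ℝ) (k : Fin 3) (i j : Fin 4) : ℝ :=
  pderiv i (fun x => θ j x k) 0 - pderiv j (fun x => θ i x k) 0

/-- The pole is the axis 0, and `S × ∂_α S` there has no component along it. Only the components 1
and 2 of the curvature contribute, each `momentCoeff` carrying a factor `1 / r` against the `r ^ 2`
of the metric. -/
theorem bundleMetric_ricci_hor (b d : Fin 4) :
    ricciCoeff (bundleMetric r G θ) (hor b) (hor d) 0 = ricciCoeff G b d 0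
      - r ^ 2 / 2 * ∑ a, (dConn θ 1 b a * dConn θ 1 d a + dConn θ 2 b a * dConn θ 2 d a) := by
  obtain ⟨W, hW, h0W, -⟩ := bundleMetric_isMetricOn hr hG hθ h0 hG1 hθ0
  have hl : ∀ i, lowC G i 0 = 0 := fun i => by
    ext a b
    have hdG' : ∀ i a b, pderiv i (fun x => G x a b) 0 = 0 := fun i a b =>
      congrFun (congrFun (hdG i) a) b
    simp [lowC, hdG']
  rw [(bundleMetric_jet hr hG hθ h0 hG1 hθ0 hdG).ricci_hor hW h0W (bundleMetric_zero hr hG1 hθ0),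
    hG.ricci_of_eq_one h0 hG1, Finset.mul_sum, Finset.mul_sum]
  simp only [hl, Matrix.zero_apply, mul_zero, sub_zero, Finset.sum_const_zero, add_zero, jet2]
  congr 1
  refine Finset.sum_congr rfl fun a _ => ?_
  simp only [connJet1, momentCoeff, cr_sph_dsph_zero hr, Fin.sum_univ_two, Fin.sum_univ_three,
    dConn]
  have : r ≠ 0 := hr.ne'
  simp
  field_simp
  ring

theorem bundleMetric_ricci_ver (α β : Fin 2) :
    ricciCoeff (bundleMetric r G θ) (ver α) (ver β) 0 = 1 / r ^ 2 * (if α = β then 1 else 0)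
      + r ^ 2 / 4 * ∑ a, ∑ c, ((![dConn θ 2 a c, - dConn θ 1 a c] : Fin 2 → ℝ) α
        * (![dConn θ 2 a c, - dConn θ 1 a c] : Fin 2 → ℝ) β) := by
  obtain ⟨W, hW, h0W, -⟩ := bundleMetric_isMetricOn hr hG hθ h0 hG1 hθ0
  rw [(bundleMetric_jet hr hG hθ h0 hG1 hθ0 hdG).ricci_ver hW h0W (bundleMetric_zero hr hG1 hθ0)]
  simp only [Finset.mul_sum]
  congr 1
  refine Finset.sum_congr rfl fun a _ => Finset.sum_congr rfl fun c _ => ?_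
  simp only [connJet1, momentCoeff, cr_sph_dsph_zero hr, Fin.sum_univ_three, dConn]
  have : r ≠ 0 := hr.ne'
  fin_cases α <;> fin_cases β <;> simp <;> field_simp <;> ring

/-- The hypothesis is that the connection form satisfies the Yang-Mills equation at the origin; the
mixed block is a linear combination of the components of its left-hand side. -/
theorem bundleMetric_ricci_mixed (b : Fin 4) (δ : Fin 2)
    (h : ∀ k, ∑ a, (pderiv a (pderiv b fun x => θ a x k) 0
      - pderiv a (pderiv a fun x => θ b x k) 0) = 0) :
    ricciCoeff (bundleMetric r G θ) (hor b) (ver δ) 0 = 0 := by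
  obtain ⟨W, hW, h0W, -⟩ := bundleMetric_isMetricOn hr hG hθ h0 hG1 hθ0
  rw [(bundleMetric_jet hr hG hθ h0 hG1 hθ0 hdG).ricci_mixed hW h0W (bundleMetric_zero hr hG1 hθ0)]
  have : ∀ a, (1 / 2) * (connJet2 r θ a b a δ - connJet2 r θ a a b δ) =
      ∑ k, r ^ 2 / 2 * momentCoeff r k δ * (pderiv a (pderiv b fun x => θ a x k) 0
        - pderiv a (pderiv a fun x => θ b x k) 0) := by
    intro a
    simp only [connJet2, Fin.sum_univ_three]; ring
  simp only [this]
  rw [Finset.sum_comm]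
  simp only [← Finset.mul_sum, h, mul_zero, Finset.sum_const_zero]

end BundleMetricJet

/-! ### Parametrizations of the base manifold and the invariance of its curvature -/

section BaseManifold

variable {M : Type u} [TopologicalSpace M] [ChartedSpace (E 4) M]

/-- The derivative of a map from coordinate space into `M`. -/
def dmap (ψ : E 4 → M) (x : E 4) : E 4 →L[ℝ] E 4 := mfderiv (𝓡 4) (𝓡 4) ψ x

/-- Local parametrizations of `M`. -/
abbrev IsParam (ψ : E 4 → M) (U : Set (E 4)) : Prop := IsLocalParam (𝓡 4) (Set.univ : Set M) ψ U

theorem e_expand {n : ℕ} (v : E n) : v = ∑ i, v i • (e i : E n) := by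
  ext j
  simp [e, Finset.sum_apply, Pi.single_apply]

theorem fderiv_eq_jac {n m : ℕ} {φ : E n → E m} {x : E n} (hφ : DifferentiableAt ℝ φ x) (i : Fin n) :
    fderiv ℝ φ x (e i) = ∑ a, jac φ x a i • (e a : E m) := by
  conv_lhs => rw [e_expand (fderiv ℝ φ x (e i))]
  exact Finset.sum_congr rfl fun a _ => by rw [jac, Matrix.of_apply, pderiv_eq_apply hφ]

theorem jac_mulVec {n m : ℕ} {φ : E n → E m} {x : E n} (hφ : DifferentiableAt ℝ φ x) (v : E n)
    (a : Fin m) : (fderiv ℝ φ x v) a = (jac φ x).mulVec v a := by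
  conv_lhs => rw [e_expand v]
  simp only [map_sum, map_smul, Matrix.mulVec, dotProduct]
  rw [WithLp.ofLp_sum, Finset.sum_apply]
  exact Finset.sum_congr rfl fun i _ => by
    simp [jac, pderiv_eq_apply hφ, mul_comm]

theorem det_jac_ne_zero {n : ℕ} {φ : E n → E n} {x : E n} (hφ : DifferentiableAt ℝ φ x)
    (hinj : Function.Injective (fderiv ℝ φ x)) : (jac φ x).det ≠ 0 := by
  intro h
  obtain ⟨v, hv, hv0⟩ := Matrix.exists_mulVec_eq_zero_iff.2 h
  apply hv
  have : fderiv ℝ φ x (WithLp.toLp 2 v) = 0 := by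
    ext a
    rw [jac_mulVec hφ]
    exact congrFun hv0 a
  have h2 := hinj (this.trans (map_zero _).symm)
  exact congrArg WithLp.ofLp h2

theorem fderiv_injective {n : ℕ} {φ : E n → E n} {x : E n} (hφ : DifferentiableAt ℝ φ x)
    (hdet : (jac φ x).det ≠ 0) : Function.Injective (fderiv ℝ φ x) := by
  rw [injective_iff_map_eq_zero]
  intro v hv
  by_contra hne
  refine hdet (Matrix.exists_mulVec_eq_zero_iff.1 ⟨v, fun h => hne (by ext i; exact congrFun h i), ?_⟩)
  funext a
  rw [← jac_mulVec hφ, hv]; rfl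

variable [IsManifold (𝓡 4) ∞ M] (g : Metric M)

/-- The coefficients of the metric of `M` in a parametrization. -/
abbrev baseMetric (ψ : E 4 → M) : E 4 → Matrix (Fin 4) (Fin 4) ℝ :=
  pullbackCoeff (𝓡 4) (metricForm g) ψ

/-- The metric at `q` as a bilinear form on coordinate space. -/
def gform (q : M) : E 4 →L[ℝ] E 4 →L[ℝ] ℝ := g.inner q

theorem gform_symm (q : M) (v w : E 4) : gform g q v w = gform g q w v := g.symm q v w

theorem gform_pos (q : M) (v : E 4) (hv : v ≠ 0) : 0 < gform g q v v := g.pos q v hv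

theorem baseMetric_apply (ψ : E 4 → M) (x : E 4) (i j : Fin 4) :
    baseMetric g ψ x i j = gform g (ψ x) (dmap ψ x (e i)) (dmap ψ x (e j)) := rfl

variable {ψ : E 4 → M} {U : Set (E 4)}

theorem IsParam.mdifferentiableAt (hψ : IsParam ψ U) {x : E 4} (hx : x ∈ U) :
    MDifferentiableAt (𝓡 4) (𝓡 4) ψ x :=
  (hψ.smooth.contMDiffAt (hψ.isOpen.mem_nhds hx)).mdifferentiableAt (by simp)

/-- The coordinate field is the tangent map of `ψ` applied to a constant section of the tangent
bundle of coordinate space. This yields the smoothness of the metric coefficients. -/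
theorem contMDiffOn_tangent (hψ : IsParam ψ U) (i : Fin 4) :
    ContMDiffOn (𝓡 4) (𝓡 4).tangent ∞
      (fun x => (⟨ψ x, mfderiv (𝓡 4) (𝓡 4) ψ x (e i)⟩ : TangentBundle (𝓡 4) M)) U := by
  have h1 := hψ.smooth.contMDiffOn_tangentMapWithin (m := ∞) (by simp)
    hψ.isOpen.uniqueMDiffOn
  have h2 : ContMDiff (𝓡 4) (𝓡 4).tangent ∞
      (fun x : E 4 => (⟨x, e i⟩ : TangentBundle (𝓡 4) (E 4))) := by
    intro x
    rw [Bundle.contMDiffAt_totalSpace]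
    refine ⟨contMDiffAt_id, ?_⟩
    have hc : (fun y : E 4 => ((trivializationAt (E 4) (TangentSpace (𝓡 4) : E 4 → Type) x)
        (⟨y, e i⟩ : TangentBundle (𝓡 4) (E 4))).2) = fun _ => e i := by
      funext y
      simp [TangentBundle.trivializationAt_apply]
    exact hc ▸ contMDiffAt_const
  have h3 := h1.comp h2.contMDiffOn (fun x hx => by simpa using hx : U ⊆ _)
  refine h3.congr fun x hx => ?_
  simp only [Function.comp, tangentMapWithin]
  rw [mfderivWithin_of_isOpen hψ.isOpen hx]

theorem baseMetric_smooth (hψ : IsParam ψ U) : MatSmooth U (baseMetric g ψ) := by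
  intro i j
  have h1 : ContMDiffOn (𝓡 4) ((𝓡 4).prod 𝓘(ℝ, E 4 →L[ℝ] E 4 →L[ℝ] ℝ)) ∞
      (fun x => Bundle.TotalSpace.mk' (E 4 →L[ℝ] E 4 →L[ℝ] ℝ)
        (E := fun q : M => TangentSpace (𝓡 4) q →L[ℝ] TangentSpace (𝓡 4) q →L[ℝ] ℝ) (ψ x)
        (g.inner (ψ x))) U := g.contMDiff.comp_contMDiffOn hψ.smooth
  have h2 := ContMDiffOn.clm_bundle_apply₂ (F₁ := E 4) (F₂ := E 4) (F₃ := ℝ)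
    (E₁ := (TangentSpace (𝓡 4) : M → Type)) (E₂ := (TangentSpace (𝓡 4) : M → Type))
    (E₃ := Bundle.Trivial M ℝ) h1 (contMDiffOn_tangent hψ i) (contMDiffOn_tangent hψ j)
  rw [← contMDiffOn_iff_contDiffOn]
  intro x hx
  have h3 := (Bundle.contMDiffWithinAt_totalSpace.1 (h2 x hx)).2
  exact h3

theorem baseMetric_isMetricOn (hψ : IsParam ψ U) : IsMetricOn U (baseMetric g ψ) where
  isOpen := hψ.isOpen
  smooth := baseMetric_smooth g hψ
  symm := fun y _ i j => gform_symm g _ _ _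
  det_ne := fun y hy h => by
    obtain ⟨v, hv, hv0⟩ := Matrix.exists_mulVec_eq_zero_iff.2 h
    have hne : dmap ψ y (WithLp.toLp 2 v) ≠ 0 := fun h0 => hv <| by
      have := hψ.immersive y hy (h0.trans (map_zero (dmap ψ y)).symm)
      exact congrArg WithLp.ofLp this
    have hp := gform_pos g (ψ y) _ hne
    have : gform g (ψ y) (dmap ψ y (WithLp.toLp 2 v)) (dmap ψ y (WithLp.toLp 2 v))
        = ∑ i, v i * (baseMetric g ψ y).mulVec v i := by
      rw [e_expand (WithLp.toLp 2 v)]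
      simp only [map_sum, map_smul, Matrix.mulVec, dotProduct, FunLike.coe_sum,
        Finset.sum_apply, FunLike.coe_smul, Pi.smul_apply, smul_eq_mul, Finset.mul_sum,
        baseMetric_apply]
      rw [Finset.sum_comm]
      exact Finset.sum_congr rfl fun i _ => Finset.sum_congr rfl fun j _ => by ring
    rw [this, hv0] at hp
    simp at hp

theorem isParam_chart_symm (p : M) : IsParam (chartAt (E 4) p).symm (chartAt (E 4) p).target where
  isOpen := (chartAt (E 4) p).open_target
  smooth := contMDiffOn_chart_symm
  immersive := fun y hy => by
    have := (mdifferentiable_chart (I := 𝓡 4) p).symm.mfderiv_injective hy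
    exact this
  mapsTo := Set.mapsTo_univ _ _

theorem dmap_comp {φ : E 4 → E 4} {x : E 4} (hψ : IsParam ψ U) (hx : φ x ∈ U)
    (hφ : DifferentiableAt ℝ φ x) {ψ' : E 4 → M} (h : ψ' =ᶠ[𝓝 x] ψ ∘ φ) :
    dmap ψ' x = dmap ψ (φ x) ∘L fderiv ℝ φ x := by
  unfold dmap
  rw [h.mfderiv_eq, mfderiv_comp x (IsParam.mdifferentiableAt hψ hx)
    hφ.mdifferentiableAt, mfderiv_eq_fderiv]
  rfl

/-- Changes of coordinates between two parametrizations. -/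
theorem isCoordChange_of_comp {ψ' : E 4 → M} {V U' : Set (E 4)} {φ : E 4 → E 4}
    (hψ : IsParam ψ U) (hψ' : IsParam ψ' U') (hV : IsOpen V) (hVU : V ⊆ U')
    (hφ : ContDiffOn ℝ ∞ φ V) (hm : Set.MapsTo φ V U) (h : ∀ y ∈ V, ψ' y = ψ (φ y)) :
    IsCoordChange V U φ (baseMetric g ψ') (baseMetric g ψ) := by
  have hd : ∀ y ∈ V, DifferentiableAt ℝ φ y := fun y hy =>
    (hφ.contDiffAt (hV.mem_nhds hy)).differentiableAt (by simp)
  have hc : ∀ y ∈ V, dmap ψ' y = dmap ψ (φ y) ∘L fderiv ℝ φ y := fun y hy =>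
    dmap_comp hψ (hm hy) (hd y hy) (Filter.eventuallyEq_of_mem (hV.mem_nhds hy) h)
  refine ⟨hV, hφ, hm, fun y hy => det_jac_ne_zero (hd y hy) ?_, fun y hy => ?_⟩
  · have h1 : Function.Injective (dmap ψ' y) := hψ'.immersive y (hVU hy)
    rw [hc y hy] at h1
    exact Function.Injective.of_comp h1
  · ext i j
    rw [baseMetric_apply, hc y hy, h y hy, Matrix.mul_apply]
    simp only [ContinuousLinearMap.comp_apply, fderiv_eq_jac (hd y hy), map_sum, map_smul,
      FunLike.coe_sum, Finset.sum_apply, FunLike.coe_smul, Pi.smul_apply,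
      smul_eq_mul, Matrix.mul_apply, Matrix.transpose_apply, baseMetric_apply, Finset.sum_mul,
      Finset.mul_sum]
    exact Finset.sum_congr rfl fun a _ => Finset.sum_congr rfl fun b _ => by ring

theorem chartCoeff_eq (p : M) : chartCoeff g p = baseMetric g (chartAt (E 4) p).symm := rfl

/-- A tangent vector at `p` is by definition its component vector in the preferred chart at `p`, so
the inverse chart has identity derivative at that one point. -/
theorem dmap_chart_symm (p : M) :
    dmap (chartAt (E 4) p).symm (chartAt (E 4) p p) = ContinuousLinearMap.id ℝ (E 4) := by
  have h := mfderivWithin_range_extChartAt_symm (I := 𝓡 4) (x := p)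
  have hr : Set.range (𝓡 4) = (Set.univ : Set (E 4)) := by simp
  rw [hr, mfderivWithin_univ] at h
  exact h

/-- The coordinate expression of a parametrization in the preferred chart at `q`. -/
def chartRep (ψ : E 4 → M) (q : M) (x : E 4) : E 4 := chartAt (E 4) q (ψ x)

/-- The domain of `chartRep`. -/
def chartDom (ψ : E 4 → M) (U : Set (E 4)) (q : M) : Set (E 4) :=
  U ∩ ψ ⁻¹' (chartAt (E 4) q).source

theorem isOpen_chartDom (hψ : IsParam ψ U) (q : M) : IsOpen (chartDom ψ U q) :=
  hψ.smooth.continuousOn.isOpen_inter_preimage hψ.isOpen (chartAt (E 4) q).open_source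

theorem contDiffOn_chartRep (hψ : IsParam ψ U) (q : M) :
    ContDiffOn ℝ ∞ (chartRep ψ q) (chartDom ψ U q) := by
  rw [← contMDiffOn_iff_contDiffOn]
  exact (contMDiffOn_chart (I := 𝓡 4) (n := ∞) (x := q)).comp
    (hψ.smooth.mono Set.inter_subset_left) fun x hx => hx.2

theorem isCoordChange_chartRep (hψ : IsParam ψ U) (q : M) :
    IsCoordChange (chartDom ψ U q) (chartAt (E 4) q).target (chartRep ψ q) (baseMetric g ψ)
      (chartCoeff g q) :=
  isCoordChange_of_comp g (isParam_chart_symm q) hψ (isOpen_chartDom hψ q) Set.inter_subset_left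
    (contDiffOn_chartRep hψ q) (fun _ hx => (chartAt (E 4) q).map_source hx.2)
    fun _ hx => ((chartAt (E 4) q).left_inv hx.2).symm

theorem mem_chartDom {x : E 4} (hx : x ∈ U) : x ∈ chartDom ψ U (ψ x) :=
  ⟨hx, mem_chart_source _ _⟩

theorem chartCoeff_isMetricOn (q : M) : IsMetricOn (chartAt (E 4) q).target (chartCoeff g q) :=
  baseMetric_isMetricOn g (isParam_chart_symm q)

/-- The chart varies with the point `ψ x`, so this is an identity at `x` only. It shows that the
tensors of the base, defined in the preferred chart of each point, have the expected components in
an arbitrary parametrization. -/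
theorem dmap_eq_fderiv_chartRep (hψ : IsParam ψ U) {x : E 4} (hx : x ∈ U) :
    dmap ψ x = fderiv ℝ (chartRep ψ (ψ x)) x := by
  have hV := isOpen_chartDom hψ (ψ x)
  have hd : DifferentiableAt ℝ (chartRep ψ (ψ x)) x :=
    ((contDiffOn_chartRep hψ (ψ x)).contDiffAt (hV.mem_nhds (mem_chartDom hx))).differentiableAt
      (by simp)
  rw [dmap_comp (isParam_chart_symm (ψ x)) ((chartAt (E 4) (ψ x)).map_source (mem_chart_source _ _))
    hd (Filter.eventuallyEq_of_mem (hV.mem_nhds (mem_chartDom hx))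
      fun y hy => ((chartAt (E 4) (ψ x)).left_inv hy.2).symm)]
  rw [show chartRep ψ (ψ x) x = chartAt (E 4) (ψ x) (ψ x) from rfl, dmap_chart_symm]
  rfl

theorem dmap_apply_coord (hψ : IsParam ψ U) {x : E 4} (hx : x ∈ U) (i a : Fin 4) :
    (dmap ψ x (e i)) a = jac (chartRep ψ (ψ x)) x a i := by
  have hd : DifferentiableAt ℝ (chartRep ψ (ψ x)) x :=
    ((contDiffOn_chartRep hψ (ψ x)).contDiffAt ((isOpen_chartDom hψ (ψ x)).mem_nhds
      (mem_chartDom hx))).differentiableAt (by simp)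
  rw [dmap_eq_fderiv_chartRep hψ hx, jac, Matrix.of_apply, pderiv_eq_apply hd]

/-- The Ricci tensor in a parametrization. -/
theorem ricci_dmap (hψ : IsParam ψ U) {x : E 4} (hx : x ∈ U) (i j : Fin 4) :
    ricci g (ψ x) (dmap ψ x (e i)) (dmap ψ x (e j)) = ricciCoeff (baseMetric g ψ) i j x := by
  rw [(isCoordChange_chartRep g hψ (ψ x)).ricci (chartCoeff_isMetricOn g _) (mem_chartDom hx)]
  unfold ricci coords
  refine Finset.sum_congr rfl fun a _ => Finset.sum_congr rfl fun b _ => ?_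
  rw [dmap_apply_coord hψ hx, dmap_apply_coord hψ hx]
  simp only [chartRep]; ring

/-- The curvature tensor in a parametrization. -/
theorem curvature_dmap (hψ : IsParam ψ U) {x : E 4} (hx : x ∈ U) (i j k : Fin 4) :
    (curvature g (ψ x) (dmap ψ x (e i)) (dmap ψ x (e j)) (dmap ψ x (e k)) : E 4) =
      - ∑ l, curvM (baseMetric g ψ) i j x l k • dmap ψ x (e l) := by
  refine (PiLp.ext fun m => ?_ : (_ : E 4) = _)
  have h := congrFun (congrFun ((isCoordChange_chartRep g hψ (ψ x)).mul_curvM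
    (chartCoeff_isMetricOn g _) (mem_chartDom hx) i j) m) k
  have h1 : (- ∑ l, curvM (baseMetric g ψ) i j x l k • dmap ψ x (e l) : E 4) m =
      - ((jac (chartRep ψ (ψ x)) x) * curvM (baseMetric g ψ) i j x) m k := by
    rw [Matrix.mul_apply, PiLp.neg_apply, WithLp.ofLp_sum, Finset.sum_apply]
    congr 1
    refine Finset.sum_congr rfl fun l _ => ?_
    rw [PiLp.smul_apply, dmap_apply_coord hψ hx, smul_eq_mul, mul_comm]
  rw [h1, h]
  simp only [curvature, coords, Matrix.mul_apply, Matrix.sum_apply, Matrix.smul_apply,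
    smul_eq_mul, Finset.sum_mul]
  congr 1
  have h2 : ∀ a i, (dmap ψ x (e i)).ofLp a = jac (chartRep ψ (ψ x)) x a i := fun a i =>
    dmap_apply_coord hψ hx i a
  simp only [h2]
  have h3 : ∀ F : Fin 4 → Fin 4 → Fin 4 → ℝ, ∑ a, ∑ b, ∑ c, F a b c = ∑ c, ∑ a, ∑ b, F a b c := by
    intro F
    rw [Finset.sum_comm' (s := Finset.univ) (t := fun _ => Finset.univ) (t' := Finset.univ)
      (s' := fun _ => Finset.univ) (by simp)]
    rw [Finset.sum_comm]
    simp only [Fin.sum_univ_four]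
    ring
  rw [h3]
  refine Finset.sum_congr rfl fun c _ => Finset.sum_congr rfl fun a _ =>
    Finset.sum_congr rfl fun b _ => ?_
  simp only [curvM, Matrix.of_apply, chartRep]; ring

theorem scalarCurvature_param (hψ : IsParam ψ U) {x : E 4} (hx : x ∈ U) :
    scalarCurvature g (ψ x) =
      ∑ i, ∑ j, (baseMetric g ψ x)⁻¹ i j * ricciCoeff (baseMetric g ψ) i j x := by
  have hC := isCoordChange_chartRep g hψ (ψ x)
  have hx' := mem_chartDom (ψ := ψ) hx
  set J := jac (chartRep ψ (ψ x)) x with hJ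
  set R : Matrix (Fin 4) (Fin 4) ℝ :=
    Matrix.of fun i j => ricciCoeff (chartCoeff g (ψ x)) i j (chartRep ψ (ψ x) x) with hR
  set G := chartCoeff g (ψ x) (chartRep ψ (ψ x) x) with hG
  have hu := isUnit_iff_ne_zero.2 (hC.det_ne x hx')
  have key : ∀ A B : Matrix (Fin 4) (Fin 4) ℝ, ∑ i, ∑ j, A i j * B i j = (A * B.transpose).trace := by
    intro A B
    simp [Matrix.trace, Matrix.mul_apply]
  have h1 : (Matrix.of fun i j => ricciCoeff (baseMetric g ψ) i j x) = J.transpose * R * J := by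
    ext i j
    rw [Matrix.of_apply, hC.ricci (chartCoeff_isMetricOn g _) hx']
    simp only [Matrix.mul_apply, Matrix.transpose_apply, Finset.sum_mul]
    rw [Finset.sum_comm]
    exact Finset.sum_congr rfl fun a _ => Finset.sum_congr rfl fun b _ => by
      simp only [hR, Matrix.of_apply]; ring
  have h2 : ∑ i, ∑ j, (baseMetric g ψ x)⁻¹ i j * ricciCoeff (baseMetric g ψ) i j x =
      ((baseMetric g ψ x)⁻¹ * (J.transpose * R * J).transpose).trace := by
    rw [← h1, ← key]; rfl
  rw [h2, hC.pull x hx', Matrix.mul_inv_rev, Matrix.mul_inv_rev]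
  have h3 : scalarCurvature g (ψ x) = (G⁻¹ * R.transpose).trace := by
    rw [← key]; rfl
  have hJT : (J.transpose)⁻¹ * J.transpose = 1 := Matrix.nonsing_inv_mul _ (by simpa using hu)
  rw [h3, Matrix.transpose_mul, Matrix.transpose_mul, Matrix.transpose_transpose]
  have h4 : J⁻¹ * (G⁻¹ * J.transpose⁻¹) * (J.transpose * (R.transpose * J)) =
      J⁻¹ * (G⁻¹ * R.transpose * J) := by
    rw [mul_assoc, mul_assoc, ← mul_assoc (J.transpose)⁻¹, hJT, one_mul, mul_assoc]
  rw [h4, Matrix.trace_mul_comm J⁻¹, mul_assoc, Matrix.mul_nonsing_inv _ hu, mul_one]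

end BaseManifold

/-- The inverse function theorem, with a smooth inverse on an open set. -/
theorem exists_smooth_localInverse {F : Type*} [NormedAddCommGroup F] [NormedSpace ℝ F]
    [CompleteSpace F] {θ : F → F} (hθ : ContDiff ℝ ∞ θ) {a : F} {f' : F ≃L[ℝ] F}
    (h : HasFDerivAt θ (f' : F →L[ℝ] F) a) :
    ∃ Θ : OpenPartialHomeomorph F F, (Θ : F → F) = θ ∧ a ∈ Θ.source ∧
      ContDiffOn ℝ ∞ Θ.symm Θ.target ∧ ∀ x ∈ Θ.source, Function.Injective (fderiv ℝ θ x) := by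
  -- The usual theorem gives smoothness of the inverse at one point. Restricting to the open set
  -- where the derivative is invertible gives smoothness on the whole target, and immersivity on the
  -- whole source.
  have hS : IsOpen (fderiv ℝ θ ⁻¹' Set.range ((↑) : (F ≃L[ℝ] F) → F →L[ℝ] F)) :=
    ContinuousLinearEquiv.isOpen.preimage (hθ.continuous_fderiv (by simp))
  set S := fderiv ℝ θ ⁻¹' Set.range ((↑) : (F ≃L[ℝ] F) → F →L[ℝ] F) with hSdef
  let Θ₀ := hθ.contDiffAt.toOpenPartialHomeomorph θ h (by simp)
  have hs : (Θ₀.restrOpen S hS).source = Θ₀.source ∩ S := rfl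
  refine ⟨Θ₀.restrOpen S hS, rfl, ⟨hθ.contDiffAt.mem_toOpenPartialHomeomorph_source h (by simp), ?_⟩,
    ?_, ?_⟩
  · exact ⟨f', h.fderiv.symm⟩
  · intro y hy
    have hx := (Θ₀.restrOpen S hS).map_target hy
    obtain ⟨f, hf⟩ := hx.2
    refine ((Θ₀.restrOpen S hS).contDiffAt_symm (f₀' := f) hy ?_ hθ.contDiffAt).contDiffWithinAt
    rw [hf]
    exact (hθ.differentiable (by simp) _).hasFDerivAt
  · intro x hx
    obtain ⟨f, hf⟩ := hx.2
    rw [← hf]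
    exact f.injective

/-! ## Normal coordinates to second order -/

section Quadratic

/-- A quadratic map. -/
def quadMap {n : ℕ} (c₀ : E n) (L : Matrix (Fin n) (Fin n) ℝ) (Q : Fin n → Fin n → Fin n → ℝ)
    (x : E n) : E n :=
  WithLp.toLp 2 fun c => c₀ c + ∑ i, L c i * x i + (1 / 2) * ∑ i, ∑ j, Q c i j * (x i * x j)

variable {n : ℕ} {c₀ : E n} {L : Matrix (Fin n) (Fin n) ℝ} {Q : Fin n → Fin n → Fin n → ℝ}

theorem contDiff_quadMap : ContDiff ℝ ∞ (quadMap c₀ L Q) := by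
  rw [contDiff_euclidean]
  intro c
  refine (contDiff_const.add (ContDiff.sum fun i _ => contDiff_const.mul (contDiff_coord i))).add
    (contDiff_const.mul (ContDiff.sum fun i _ => ContDiff.sum fun j _ => contDiff_const.mul
      ((contDiff_coord i).mul (contDiff_coord j))))

theorem quadMap_zero : quadMap c₀ L Q 0 = c₀ := by
  ext c; simp [quadMap]

theorem pderiv_linear (a : Fin n → ℝ) (k : Fin n) (x : E n) :
    pderiv k (fun x => ∑ i, a i * x i) x = a k := by
  have hd := fun i => (contDiff_coord i).differentiable (by simp) x
  rw [pderiv_sum _ _ fun i _ => (hd i).const_mul _]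
  simp_rw [pderiv_const_mul k _ (hd _), pderiv_coord]
  simp

theorem jac_quadMap (hQ : ∀ c i j, Q c i j = Q c j i) (x : E n) (c k : Fin n) :
    jac (quadMap c₀ L Q) x c k = L c k + ∑ j, Q c k j * x j := by
  have hd : ∀ i, DifferentiableAt ℝ (fun x : E n => x i) x := fun i =>
    (contDiff_coord i).differentiable (by simp) x
  have hq : ∀ i j, DifferentiableAt ℝ (fun x : E n => Q c i j * (x i * x j)) x := fun i j =>
    ((hd i).fun_mul (hd j)).const_mul _
  have hs : ∀ i, DifferentiableAt ℝ (fun x : E n => ∑ j, Q c i j * (x i * x j)) x := fun i =>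
    DifferentiableAt.fun_sum fun j _ => hq i j
  have hl : DifferentiableAt ℝ (fun x : E n => ∑ i, L c i * x i) x :=
    DifferentiableAt.fun_sum fun j _ => (hd j).const_mul _
  have hss : DifferentiableAt ℝ (fun x : E n => ∑ i, ∑ j, Q c i j * (x i * x j)) x :=
    DifferentiableAt.fun_sum fun i _ => hs i
  simp only [jac, quadMap, Matrix.of_apply]
  rw [pderiv_add k ((differentiableAt_const _).fun_add hl) (hss.const_mul _),
    pderiv_add k (differentiableAt_const _) hl, pderiv_const, pderiv_linear,
    pderiv_const_mul k _ hss, pderiv_sum _ _ fun i _ => hs i]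
  simp_rw [pderiv_sum Finset.univ k fun j _ => hq _ j, pderiv_const_mul k _ ((hd _).fun_mul (hd _)),
    pderiv_mul k (hd _) (hd _), pderiv_coord]
  simp only [mul_add, Finset.sum_add_distrib, ite_mul, one_mul, zero_mul, mul_ite, mul_one,
    mul_zero, Finset.sum_ite_eq, Finset.mem_univ, if_true]
  rw [Finset.sum_comm]
  simp only [Finset.sum_ite_eq, Finset.mem_univ, if_true, hQ c _ k]
  ring

theorem mpd_jac_quadMap (hQ : ∀ c i j, Q c i j = Q c j i) (x : E n) (m c k : Fin n) :
    mpd m (jac (quadMap c₀ L Q)) x c k = Q c k m := by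
  have hd := fun i => (contDiff_coord (n := n) i).differentiable (by simp) x
  simp only [mpd, Matrix.of_apply, jac_quadMap hQ]
  rw [pderiv_add m (differentiableAt_const _) (DifferentiableAt.fun_sum fun j _ =>
    (hd j).const_mul _), pderiv_const, pderiv_linear, zero_add]

end Quadratic

section NormalParam

variable {M : Type u} [TopologicalSpace M] [ChartedSpace (E 4) M] [IsManifold (𝓡 4) ∞ M]
  (g : Metric M) {ψ : E 4 → M} {U : Set (E 4)}

theorem isParam_comp (hψ : IsParam ψ U) {V : Set (E 4)} {φ : E 4 → E 4} (hV : IsOpen V)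
    (hφ : ContDiffOn ℝ ∞ φ V) (hm : Set.MapsTo φ V U)
    (hinj : ∀ x ∈ V, Function.Injective (fderiv ℝ φ x)) : IsParam (ψ ∘ φ) V where
  isOpen := hV
  smooth := hψ.smooth.comp hφ.contMDiffOn hm
  immersive := fun x hx => by
    have h := dmap_comp hψ (hm hx) ((hφ.contDiffAt (hV.mem_nhds hx)).differentiableAt (by simp))
      (Filter.EventuallyEq.refl _ (ψ ∘ φ))
    have h2 : Function.Injective (dmap (ψ ∘ φ) x) := by
      have h3 : Function.Injective (dmap ψ (φ x)) := hψ.immersive _ (hm hx)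
      rw [h]
      exact h3.comp (hinj x hx)
    exact h2
  mapsTo := Set.mapsTo_univ _ _

/-- `ψ` is a parametrization of a neighbourhood of `p` with coordinate vectors `b` at `p`, for
which the metric is standard to first order at the origin. -/
structure IsNormalParam (p : M) (b : Fin 4 → E 4) (ψ : E 4 → M) (U : Set (E 4)) : Prop where
  param : IsParam ψ U
  zero_mem : (0 : E 4) ∈ U
  map_zero : ψ 0 = p
  dmap_zero : ∀ i, dmap ψ 0 (e i) = b i
  metric_one : baseMetric g ψ 0 = 1
  metric_flat : ∀ i, mpd i (baseMetric g ψ) 0 = 0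
  inverse : ∃ (O : Set M) (χ : M → E 4), IsOpen O ∧ p ∈ O ∧ ContMDiffOn (𝓡 4) (𝓡 4) ∞ χ O ∧
    Set.MapsTo χ O U ∧ χ p = 0 ∧ ∀ q ∈ O, ψ (χ q) = q

/-- Precompose the inverse chart with a quadratic map whose linear part sends the coordinate vectors
to `b` and whose quadratic part cancels the Christoffel symbols. Geodesics and the exponential map
are not needed, because only the 1-jet of the metric must be standard. -/
theorem exists_isNormalParam (p : M) (b : Fin 4 → E 4)
    (hb : ∀ i j, gform g p (b i) (b j) = if i = j then 1 else 0) :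
    ∃ ψ U, IsNormalParam g p b ψ U := by
  set c := chartAt (E 4) p with hc
  set x₀ : E 4 := c p with hx₀
  have hx₀t : x₀ ∈ c.target := c.map_source (mem_chart_source _ _)
  set G := chartCoeff g p with hG
  have hmet := chartCoeff_isMetricOn g p
  let L : Matrix (Fin 4) (Fin 4) ℝ := Matrix.of fun a i => b i a
  -- In the transformation law `J Γ' = Γ(J) J + dJ` the term `dJ` is `Q` at the origin; this choice
  -- makes the right-hand side vanish there.
  let Q : Fin 4 → Fin 4 → Fin 4 → ℝ := fun k i j =>
    - ∑ a, ∑ d, L a i * L d j * gam G a x₀ k d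
  have hQ : ∀ k i j, Q k i j = Q k j i := by
    intro k i j
    simp only [Q]
    rw [Finset.sum_comm]
    congr 1
    refine Finset.sum_congr rfl fun a _ => Finset.sum_congr rfl fun d _ => ?_
    rw [hmet.gam_symm hx₀t]; ring
  let θ : E 4 → E 4 := quadMap x₀ L Q
  have hθ : ContDiff ℝ ∞ θ := contDiff_quadMap
  have hθ0 : θ 0 = x₀ := quadMap_zero
  have hJ0 : jac θ 0 = L := by
    ext a k; simp only [θ]; rw [jac_quadMap hQ]; simp
  have hGL : L.transpose * G x₀ * L = 1 := by
    ext i j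
    have h1 := hb i j
    rw [e_expand (b i), e_expand (b j)] at h1
    simp only [map_sum, map_smul, FunLike.coe_sum, Finset.sum_apply,
      FunLike.coe_smul, Pi.smul_apply, smul_eq_mul, Finset.mul_sum] at h1
    rw [Matrix.one_apply, ← h1]
    simp only [Matrix.mul_apply, Matrix.transpose_apply, Finset.sum_mul, L, Matrix.of_apply]
    refine Finset.sum_congr rfl fun a _ => Finset.sum_congr rfl fun d _ => ?_
    have h2 : G x₀ d a = gform g p (e d) (e a) := by
      rw [hG, chartCoeff_eq, baseMetric_apply, hx₀, hc, dmap_chart_symm,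
        (chartAt (E 4) p).left_inv (mem_chart_source _ _)]
      rfl
    rw [h2]; ring
  have hdetL : L.det ≠ 0 := fun h => by
    have := congrArg Matrix.det hGL
    simp [Matrix.det_mul, h] at this
  have hinj0 : Function.Injective (fderiv ℝ θ 0) :=
    fderiv_injective (hθ.differentiable (by simp) _) (by rwa [hJ0])
  let f' : E 4 ≃L[ℝ] E 4 := (LinearEquiv.ofInjectiveEndo (fderiv ℝ θ 0 : E 4 →ₗ[ℝ] E 4)
    hinj0).toContinuousLinearEquiv
  have hf' : HasFDerivAt θ (f' : E 4 →L[ℝ] E 4) 0 := by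
    have : (f' : E 4 →L[ℝ] E 4) = fderiv ℝ θ 0 := by ext1 v; rfl
    rw [this]
    exact (hθ.differentiable (by simp) _).hasFDerivAt
  obtain ⟨Θ, hΘ, h0Θ, hΘs, hΘi⟩ := exists_smooth_localInverse hθ hf'
  have hU : IsOpen (Θ.source ∩ θ ⁻¹' c.target) :=
    Θ.open_source.inter (c.open_target.preimage hθ.continuous)
  have h0U : (0 : E 4) ∈ Θ.source ∩ θ ⁻¹' c.target := ⟨h0Θ, by simpa [hθ0] using hx₀t⟩
  have hpar : IsParam (c.symm ∘ θ) (Θ.source ∩ θ ⁻¹' c.target) :=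
    isParam_comp (isParam_chart_symm p) hU hθ.contDiffOn (fun x hx => hx.2) fun x hx => hΘi x hx.1
  have hcc : IsCoordChange (Θ.source ∩ θ ⁻¹' c.target) c.target θ (baseMetric g (c.symm ∘ θ)) G :=
    isCoordChange_of_comp g (isParam_chart_symm p) hpar hU subset_rfl hθ.contDiffOn
      (fun x hx => hx.2) fun _ _ => rfl
  have hmet' := baseMetric_isMetricOn g hpar
  have hgam : ∀ i, gam (baseMetric g (c.symm ∘ θ)) i 0 = 0 := by
    intro i
    have h1 := hcc.mul_gam hmet h0U i
    rw [hJ0, hθ0] at h1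
    have h2 : (∑ a, L a i • gam G a x₀) * L + mpd i (jac θ) 0 = 0 := by
      ext k j
      have h3 : mpd i (jac θ) 0 k j = Q k j i := mpd_jac_quadMap hQ 0 i k j
      rw [Matrix.add_apply, h3, hQ]
      simp only [Q, Matrix.mul_apply, Matrix.sum_apply, Matrix.smul_apply, smul_eq_mul,
        Finset.sum_mul, Matrix.zero_apply]
      rw [Finset.sum_comm, ← sub_eq_add_neg, sub_eq_zero]
      exact Finset.sum_congr rfl fun a _ => Finset.sum_congr rfl fun d _ => by ring
    rw [h2] at h1
    have hu := isUnit_iff_ne_zero.2 hdetL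
    rw [← one_mul (gam _ i 0), ← Matrix.nonsing_inv_mul L hu, mul_assoc, h1, mul_zero]
  refine ⟨c.symm ∘ θ, Θ.source ∩ θ ⁻¹' c.target, hpar, h0U, ?_, ?_, ?_, ?_, ?_⟩
  · simp only [Function.comp, hθ0]
    exact c.left_inv (mem_chart_source _ _)
  · intro i
    rw [dmap_comp (isParam_chart_symm p) (show θ 0 ∈ c.target by rw [hθ0]; exact hx₀t)
      (hθ.differentiable (by simp) _) (Filter.EventuallyEq.refl _ _), hθ0, hx₀, hc, dmap_chart_symm]
    refine PiLp.ext fun a => ?_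
    have := pderiv_eq_apply (hθ.differentiable (by simp) 0) i a
    change (fderiv ℝ θ 0 (e i)) a = b i a
    rw [← this]
    have := congrFun (congrFun hJ0 a) i
    exact this
  · rw [hcc.pull 0 h0U, hJ0, hθ0, hGL]
  · intro i
    rw [hmet'.compat h0U, hgam]; simp
  · refine ⟨c.source ∩ c ⁻¹' Θ.target, fun q => Θ.symm (c q),
      c.isOpen_inter_preimage Θ.open_target, ⟨mem_chart_source _ _, ?_⟩, ?_, ?_, ?_, ?_⟩
    · have := Θ.map_source h0Θ
      rw [hΘ, hθ0] at this
      exact this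
    · exact hΘs.contMDiffOn.comp ((contMDiffOn_chart (I := 𝓡 4) (n := ∞) (x := p)).mono
        Set.inter_subset_left) fun q hq => hq.2
    · intro q hq
      refine ⟨Θ.map_target hq.2, ?_⟩
      have : θ (Θ.symm (c q)) = c q := by rw [← hΘ]; exact Θ.right_inv hq.2
      simp only [Set.mem_preimage, this]
      exact c.map_source hq.1
    · have := Θ.left_inv h0Θ
      rw [hΘ, hθ0] at this
      exact this
    · intro q hq
      have : θ (Θ.symm (c q)) = c q := by rw [← hΘ]; exact Θ.right_inv hq.2
      simp only [Function.comp, this]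
      exact c.left_inv hq.1

end NormalParam

/-! ### Symmetric orthonormal frames, standard to first order -/

section Frame

open scoped Matrix.Norms.L2Operator in
/-- A smooth symmetric square root of a symmetric matrix function near a point where it is `1`. -/
theorem exists_sqrt {m n : ℕ} {U : Set (E m)} (hU : IsOpen U) {x₀ : E m} (hx₀ : x₀ ∈ U)
    {H : E m → Matrix (Fin n) (Fin n) ℝ} (hH : MatSmooth U H)
    (hs : ∀ x ∈ U, (H x).transpose = H x) (h1 : H x₀ = 1) :
    ∃ (V : Set (E m)) (X : E m → Matrix (Fin n) (Fin n) ℝ), IsOpen V ∧ V ⊆ U ∧ x₀ ∈ V ∧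
      MatSmooth V X ∧ (∀ x ∈ V, (X x).transpose = X x) ∧ (∀ x ∈ V, X x * X x = H x) ∧
      X x₀ = 1 := by
  let A := Matrix (Fin n) (Fin n) ℝ
  have : CompleteSpace A := FiniteDimensional.complete ℝ A
  have hsq : ContDiff ℝ ∞ (fun X : A => X * X) := contDiff_id.mul contDiff_id
  let f' : A ≃L[ℝ] A := (LinearEquiv.smulOfNeZero ℝ A (2 : ℝ) two_ne_zero).toContinuousLinearEquiv
  have hf' : HasFDerivAt (fun X : A => X * X) (f' : A →L[ℝ] A) 1 := by
    have := (hasFDerivAt_id (𝕜 := ℝ) (1 : A)).mul' (hasFDerivAt_id (𝕜 := ℝ) (1 : A))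
    refine HasFDerivAt.congr_fderiv (f := fun X : A => X * X) this ?_
    ext1 Y
    change _ = (2 : ℝ) • Y
    simp [two_smul]
  obtain ⟨Θ, hΘ, h1Θ, hΘs, -⟩ := exists_smooth_localInverse hsq hf'
  have hHc : ContDiffOn ℝ ∞ (fun x => (H x : A)) U := by
    have : (fun x => (H x : A)) =
        fun x => ∑ i, ∑ j, H x i j • (Matrix.single i j (1 : ℝ) : A) := by
      funext x
      conv_lhs => rw [Matrix.matrix_eq_sum_single (H x)]
      simp [Matrix.smul_single]
    rw [this]
    exact ContDiffOn.sum fun i _ => ContDiffOn.sum fun j _ => (hH i j).smul contDiffOn_const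
  have hV1 : IsOpen (U ∩ H ⁻¹' Θ.target) := hHc.continuousOn.isOpen_inter_preimage hU Θ.open_target
  have hX : ContDiffOn ℝ ∞ (fun x => Θ.symm (H x)) (U ∩ H ⁻¹' Θ.target) :=
    hΘs.comp (hHc.mono Set.inter_subset_left) fun x hx => hx.2
  have hst : ContinuousOn (fun x => star (Θ.symm (H x))) (U ∩ H ⁻¹' Θ.target) :=
    hX.continuousOn.star
  have hX0 : Θ.symm (H x₀) = 1 := by
    have := Θ.left_inv h1Θ
    simp only [hΘ, mul_one] at this
    rw [h1, this]
  have hmem : x₀ ∈ U ∩ H ⁻¹' Θ.target := by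
    refine ⟨hx₀, ?_⟩
    have := Θ.map_source h1Θ
    simp only [hΘ, mul_one] at this
    rw [Set.mem_preimage, h1]
    exact this
  have hsqX : ∀ x ∈ U ∩ H ⁻¹' Θ.target, Θ.symm (H x) * Θ.symm (H x) = H x := fun x hx => by
    have := Θ.right_inv hx.2
    rw [hΘ] at this
    exact this
  refine ⟨(U ∩ H ⁻¹' Θ.target) ∩ (fun x => star (Θ.symm (H x))) ⁻¹' Θ.source,
    fun x => Θ.symm (H x), hst.isOpen_inter_preimage hV1 Θ.open_source,
    fun x hx => hx.1.1, ⟨hmem, ?_⟩, ?_, ?_, fun x hx => hsqX x hx.1, hX0⟩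
  · rw [Set.mem_preimage, hX0, star_one]; exact h1Θ
  · intro a b
    let ℓ : A →ₗ[ℝ] ℝ := Matrix.entryLinearMap ℝ ℝ a b
    exact (ℓ.toContinuousLinearMap.contDiff.comp_contDiffOn hX).mono Set.inter_subset_left
  · intro x hx
    have hsource := Θ.map_target hx.1.2
    -- The transpose of a square root of the symmetric matrix `H x` is another square root. On the
    -- shrunken domain both lie where squaring is injective.
    have h2 : star (Θ.symm (H x)) = Θ.symm (H x) := by
      refine Θ.injOn hx.2 hsource ?_
      rw [hΘ]
      change star (Θ.symm (H x)) * star (Θ.symm (H x)) = Θ.symm (H x) * Θ.symm (H x)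
      rw [← star_mul, hsqX x hx.1, Matrix.star_eq_conjTranspose,
        Matrix.conjTranspose_eq_transpose_of_trivial, hs x hx.1.1]
    rwa [Matrix.star_eq_conjTranspose, Matrix.conjTranspose_eq_transpose_of_trivial] at h2

/-- A symmetric orthonormal frame, standard to first order at the origin. -/
structure IsNormalFrame {n : ℕ} (G : E n → Matrix (Fin n) (Fin n) ℝ) (V : Set (E n))
    (X : E n → Matrix (Fin n) (Fin n) ℝ) : Prop where
  isOpen : IsOpen V
  zero_mem : (0 : E n) ∈ V
  smooth : MatSmooth V X
  symm : ∀ x ∈ V, (X x).transpose = X x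
  orthonormal : ∀ x ∈ V, X x * G x * X x = 1
  zero : X 0 = 1
  flat : ∀ i, mpd i X 0 = 0

/-- Take `X = G^(-1/2)`, the smooth square root of `G⁻¹` near the origin. Differentiating `X G X =
1` where `X = G = 1` and `dG = 0` gives `2 dX = 0`. The vanishing of `dX` is what later makes the
frame connection vanish at the origin. -/
theorem exists_isNormalFrame {n : ℕ} {U : Set (E n)} {G : E n → Matrix (Fin n) (Fin n) ℝ}
    (hG : IsMetricOn U G) (h0 : (0 : E n) ∈ U) (hG1 : G 0 = 1) (hdG : ∀ i, mpd i G 0 = 0) :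
    ∃ V X, V ⊆ U ∧ IsNormalFrame G V X := by
  obtain ⟨V, X, hV, hVU, h0V, hX, hs, hsq, hX0⟩ := exists_sqrt hG.isOpen h0
    (hG.smooth.inv hG.det_ne) (fun x hx => by
      rw [Matrix.transpose_nonsing_inv]
      congr 1
      ext a b; exact hG.symm x hx b a) (by rw [hG1, inv_one])
  have hor : ∀ x ∈ V, X x * G x * X x = 1 := fun x hx => by
    have h := Matrix.nonsing_inv_mul (G x) (isUnit_iff_ne_zero.2 (hG.det_ne x (hVU hx)))
    rw [← hsq x hx, mul_assoc] at h
    exact mul_eq_one_comm.1 h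
  refine ⟨V, X, hVU, hV, h0V, hX, hs, hor, hX0, fun i => ?_⟩
  have hGV := hG.smooth.mono hVU
  have h := mpd_congr_on hV h0V i hor
  rw [mpd_const, mpd_mul i ((hX.mul hGV).diffAt hV h0V) (hX.diffAt hV h0V),
    mpd_mul i (hX.diffAt hV h0V) (hGV.diffAt hV h0V), hX0, hG1, hdG] at h
  simp only [mul_one, one_mul, add_zero] at h
  ext a b
  have := congrFun (congrFun h a) b
  simp only [Matrix.add_apply, Matrix.zero_apply] at this ⊢
  linarith

end Frame

/-! ### Orientation of the frame near the base point -/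

section OrientedFrame

variable {M : Type u} [TopologicalSpace M] [ChartedSpace (E 4) M] [IsManifold (𝓡 4) ∞ M]
  (g : Metric M) {ψ : E 4 → M} {U : Set (E 4)}

/-- The vectors of the frame with coefficient matrix `X` in a parametrization. -/
def frameVec (ψ : E 4 → M) (X : E 4 → Matrix (Fin 4) (Fin 4) ℝ) (x : E 4) (i : Fin 4) : E 4 :=
  ∑ a, X x a i • dmap ψ x (e a)

theorem gform_frameVec (X : E 4 → Matrix (Fin 4) (Fin 4) ℝ) (x : E 4) (i j : Fin 4) :
    gform g (ψ x) (frameVec ψ X x i) (frameVec ψ X x j) =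
      ((X x).transpose * baseMetric g ψ x * X x) i j := by
  simp only [frameVec, map_sum, map_smul, FunLike.coe_sum, Finset.sum_apply,
    FunLike.coe_smul, Pi.smul_apply, smul_eq_mul, Finset.mul_sum, Matrix.mul_apply,
    Matrix.transpose_apply, Finset.sum_mul, baseMetric_apply]
  exact Finset.sum_congr rfl fun a _ => Finset.sum_congr rfl fun d _ => by ring

theorem linearIndependent_of_orthonormal {q : M} {v : Fin 4 → E 4}
    (hv : ∀ i j, gform g q (v i) (v j) = if i = j then 1 else 0) : LinearIndependent ℝ v := by
  rw [Fintype.linearIndependent_iff]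
  intro c hc j
  have := congrArg (fun w => gform g q w (v j)) hc
  simpa [hv] using this

/-- The basis of the tangent space formed by four orthonormal vectors. -/
theorem exists_basis_of_orthonormal {q : M} {v : Fin 4 → E 4}
    (hv : ∀ i j, gform g q (v i) (v j) = if i = j then 1 else 0) :
    ∃ b : Module.Basis (Fin 4) ℝ (TangentSpace (𝓡 4) q), ∀ i, b i = v i := by
  have hl : LinearIndependent ℝ (M := E 4) v := linearIndependent_of_orthonormal g hv
  let b := basisOfLinearIndependentOfCardEqFinrank hl (by simp)
  exact ⟨b, fun i => congrFun (coe_basisOfLinearIndependentOfCardEqFinrank hl (by simp)) i⟩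

variable (o : ManifoldOrientation M)

/-- In a fixed trivialization of the tangent bundle the derivative of `ψ` becomes an ordinary
derivative, which varies smoothly with `x`. -/
theorem trivialization_dmap (hψ : IsParam ψ U) {x : E 4} (hx : x ∈ U) (p : M)
    (hp : ψ x ∈ (chartAt (E 4) p).source) (v : E 4) :
    ((trivializationAt (E 4) (TangentSpace (𝓡 4) : M → Type) p).continuousLinearMapAt ℝ (ψ x)
      (dmap ψ x v) : E 4) = fderiv ℝ (chartRep ψ p) x v := by
  rw [TangentBundle.continuousLinearMapAt_trivializationAt hp]
  have h1 : MDifferentiableAt (𝓡 4) (𝓡 4) (extChartAt (𝓡 4) p) (ψ x) :=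
    mdifferentiableAt_extChartAt hp
  have h2 := mfderiv_comp x h1 (IsParam.mdifferentiableAt hψ hx)
  have h3 : (extChartAt (𝓡 4) p : M → E 4) ∘ ψ = chartRep ψ p := by
    funext y; simp [chartRep]
  rw [← mfderiv_eq_fderiv, ← h3, h2]
  rfl

/-- In the trivialization at `p` the orientation is constant near `p`. The matrix comparing the
frame with `b` is the identity at the origin, so its determinant stays positive nearby. -/
theorem eventually_frame_oriented {p : M} (b : Module.Basis (Fin 4) ℝ (TangentSpace (𝓡 4) p))
    (hb : IsOrientedOrthonormal g o p b) (hψ : IsNormalParam g p b ψ U)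
    {V : Set (E 4)} {X : E 4 → Matrix (Fin 4) (Fin 4) ℝ}
    (hX : IsNormalFrame (baseMetric g ψ) V X) :
    ∀ᶠ x in 𝓝 (0 : E 4), ∀ b' : Module.Basis (Fin 4) ℝ (TangentSpace (𝓡 4) (ψ x)),
      (∀ i, b' i = frameVec ψ X x i) → IsOrientedOrthonormal g o (ψ x) b' := by
  have hpar := hψ.param
  have hUn := hpar.isOpen.mem_nhds hψ.zero_mem
  have hcont : Filter.Tendsto ψ (𝓝 0) (𝓝 p) := by
    have := (hpar.smooth.contMDiffAt hUn).continuousAt.tendsto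
    rwa [hψ.map_zero] at this
  have ho := hcont.eventually (o.locallyConstant p)
  have hdom := isOpen_chartDom hpar p
  have h0dom : (0 : E 4) ∈ chartDom ψ U p :=
    ⟨hψ.zero_mem, by rw [Set.mem_preimage, hψ.map_zero]; exact mem_chart_source _ _⟩
  let J := jac (chartRep ψ p)
  have hJs : MatSmooth (chartDom ψ U p) J :=
    IsCoordChange.jac_smooth (contDiffOn_chartRep hpar p) hdom
  have hdet0 := (isCoordChange_chartRep g hpar p).det_ne 0 h0dom
  have hu := isUnit_iff_ne_zero.2 hdet0
  -- The coefficients of the trivialized frame at `x` with respect to `b`, both read in the chart at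
  -- `p`.
  let C : E 4 → Matrix (Fin 4) (Fin 4) ℝ := fun x => (J 0)⁻¹ * (J x * X x)
  have hCs : MatSmooth (chartDom ψ U p ∩ V) C :=
    (matSmooth_const _).mul ((hJs.mono Set.inter_subset_left).mul
      (hX.smooth.mono Set.inter_subset_right))
  have hC0 : C 0 = 1 := by
    simp only [C, hX.zero, mul_one]
    exact Matrix.nonsing_inv_mul _ hu
  have hCdet : ∀ᶠ x in 𝓝 (0 : E 4), 0 < (C x).det := by
    have hc : ContinuousAt (fun x => (C x).det) 0 := hCs.det.continuousOn.continuousAt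
      ((hdom.inter hX.isOpen).mem_nhds ⟨h0dom, hX.zero_mem⟩)
    refine hc.eventually (lt_mem_nhds ?_)
    simp [hC0]
  have hdiff : ∀ x ∈ chartDom ψ U p, DifferentiableAt ℝ (chartRep ψ p) x := fun x hx =>
    ((contDiffOn_chartRep hpar p).contDiffAt (hdom.mem_nhds hx)).differentiableAt (by simp)
  filter_upwards [ho, hCdet, hdom.mem_nhds h0dom, hX.isOpen.mem_nhds hX.zero_mem]
    with x hox hCx hxd hxV b' hb'
  refine ⟨fun i j => ?_, ?_⟩
  · have := gform_frameVec g (ψ := ψ) X x i j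
    rw [hX.symm x hxV, hX.orthonormal x hxV, Matrix.one_apply, ← hb', ← hb'] at this
    exact this
  · obtain ⟨hq, hmap⟩ := hox
    set T := ((trivializationAt (E 4) (TangentSpace (𝓡 4) : M → Type)
        p).continuousLinearEquivAt ℝ (ψ x) hq).toLinearEquiv with hT
    let b₀ : Module.Basis (Fin 4) ℝ (E 4) := b
    have hb0 : ∀ j, b₀ j = fderiv ℝ (chartRep ψ p) 0 (e j) := fun j => by
      have h1 := hψ.dmap_zero j
      rw [dmap_eq_fderiv_chartRep hpar hψ.zero_mem, hψ.map_zero] at h1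
      exact h1.symm
    have hTb : ∀ i, (T (b' i) : E 4) = ∑ j, C x j i • b₀ j := by
      intro i
      have h1 : (T (b' i) : E 4) = fderiv ℝ (chartRep ψ p) x (∑ a, X x a i • (e a : E 4)) := by
        rw [← trivialization_dmap hpar hxd.1 p hxd.2, hb' i, hT]
        have hfv : frameVec ψ X x i = dmap ψ x (∑ a, X x a i • (e a : E 4)) := by
          simp only [frameVec, map_sum, map_smul]
        rw [hfv]
        exact congrFun (Bundle.Trivialization.coe_continuousLinearEquivAt_eq _ hq) _
      rw [h1]
      simp only [map_sum, map_smul, hb0, fderiv_eq_jac (hdiff x hxd), fderiv_eq_jac (hdiff 0 h0dom),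
        Finset.smul_sum, smul_smul]
      have h2 : J 0 * C x = J x * X x := by
        simp only [C]
        rw [← mul_assoc, Matrix.mul_nonsing_inv _ hu, one_mul]
      rw [Finset.sum_comm]
      conv_rhs => rw [Finset.sum_comm]
      refine Finset.sum_congr rfl fun a _ => ?_
      rw [← Finset.sum_smul, ← Finset.sum_smul]
      congr 1
      have h3 := congrFun (congrFun h2 a) i
      rw [Matrix.mul_apply, Matrix.mul_apply] at h3
      refine Eq.trans ?_ (h3.symm.trans ?_)
      · exact Finset.sum_congr rfl fun c _ => mul_comm _ _
      · exact Finset.sum_congr rfl fun c _ => mul_comm _ _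
    have hpos : 0 < b₀.det (b'.map T) := by
      rw [Module.Basis.det_apply]
      have : b₀.toMatrix (b'.map T) = C x := by
        ext j i
        rw [Module.Basis.toMatrix_apply, Module.Basis.map_apply]
        erw [hTb i]
        simp [Finsupp.single_apply]
      erw [this]
      exact hCx
    have h1 : b₀.orientation = (b'.map T).orientation :=
      (Module.Basis.orientation_eq_iff_det_pos b₀ (b'.map T)).2 hpos
    rw [Module.Basis.orientation_map] at h1
    have h2 : Orientation.map (Fin 4) T b'.orientation = Orientation.map (Fin 4) T (o.or (ψ x)) := by
      refine h1.symm.trans ?_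
      refine Eq.trans ?_ hmap.symm
      exact hb.2
    exact (Orientation.map (Fin 4) T).injective h2

end OrientedFrame

/-! ## Anti-self-dual skew matrices -/

section Jmat

/-- The anti-self-dual skew matrix with components `S`. -/
def jmat (S : Fin 3 → ℝ) : Matrix (Fin 4) (Fin 4) ℝ :=
  !![0, -S 0, -S 1, -S 2; S 0, 0, S 2, -S 1; S 1, -S 2, 0, S 0; S 2, S 1, -S 0, 0]

/-- The components of the anti-self-dual part of a skew matrix, as an element of `so(3)`. -/
def asd (A : Matrix (Fin 4) (Fin 4) ℝ) : Fin 3 → ℝ :=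
  ![A 3 2 - A 1 0, A 1 3 - A 2 0, A 2 1 - A 3 0]

theorem jmat_transpose (S : Fin 3 → ℝ) : (jmat S).transpose = -jmat S := by
  ext i j; fin_cases i <;> fin_cases j <;> simp [jmat]

theorem trace_jmat_mul (S T : Fin 3 → ℝ) : (jmat S * jmat T).trace = -4 * ∑ k, S k * T k := by
  simp [jmat, Matrix.trace, Fin.sum_univ_four, Fin.sum_univ_three]
  ring

theorem jmat_sum_smul {ι : Type*} (s : Finset ι) (c : ι → ℝ) (S : ι → Fin 3 → ℝ) :
    jmat (∑ a ∈ s, c a • S a) = ∑ a ∈ s, c a • jmat (S a) := by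
  have hadd : ∀ S T, jmat (S + T) = jmat S + jmat T := fun S T => by
    ext i j; fin_cases i <;> fin_cases j <;> simp [jmat] <;> ring
  have hsmul : ∀ (c : ℝ) S, jmat (c • S) = c • jmat S := fun c S => by
    ext i j; fin_cases i <;> fin_cases j <;> simp [jmat]
  have h0 : jmat 0 = 0 := by
    ext i j; fin_cases i <;> fin_cases j <;> simp [jmat]
  induction s using Finset.cons_induction with
  | empty => simp [h0]
  | cons a s ha ih => rw [Finset.sum_cons, Finset.sum_cons, hadd, hsmul, ih]

theorem jmat_add (S T : Fin 3 → ℝ) : jmat (S + T) = jmat S + jmat T := by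
  ext i j; fin_cases i <;> fin_cases j <;> simp [jmat] <;> ring

/-- In `so(4) = so(3) ⊕ so(3)` the self-dual summand commutes with every `jmat S`, and the
anti-self-dual one acts by the cross product. Thus a metric connection acts on Λ²₋ through `asd`
alone. -/
theorem commutator_jmat {A : Matrix (Fin 4) (Fin 4) ℝ} (hA : A.transpose = -A) (S : Fin 3 → ℝ) :
    A * jmat S - jmat S * A = jmat (cr (asd A) S) := by
  have h : ∀ i j, A j i = -A i j := fun i j => congrFun (congrFun hA i) j
  have h00 : A 0 0 = 0 := by linarith [h 0 0]
  have h11 : A 1 1 = 0 := by linarith [h 1 1]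
  have h22 : A 2 2 = 0 := by linarith [h 2 2]
  have h33 : A 3 3 = 0 := by linarith [h 3 3]
  ext i j
  simp only [Matrix.sub_apply, Matrix.mul_apply, Fin.sum_univ_four]
  fin_cases i <;> fin_cases j <;>
    simp [jmat, asd, cr, h00, h11, h22, h33, h 1 0, h 2 0, h 3 0, h 2 1, h 3 1, h 3 2] <;> ring

/-- Complementary minors of a special orthogonal matrix. -/
theorem complementary_minor {O : Matrix (Fin 4) (Fin 4) ℝ} (hO : O.transpose * O = 1)
    (hdet : O.det = 1) (v w : Fin 4 → ℝ) :
    (Matrix.of ![fun i => O i 0, fun i => O i 1, v, w]).det =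
      (O.transpose.mulVec v) 2 * (O.transpose.mulVec w) 3
        - (O.transpose.mulVec v) 3 * (O.transpose.mulVec w) 2 := by
  have hO2 : ∀ i j, ∑ k, O k i * O k j = if i = j then 1 else 0 := fun i j => by
    have := congrFun (congrFun hO i) j
    simpa [Matrix.mul_apply, Matrix.one_apply] using this
  have h1 : (Matrix.of ![fun i => O i 0, fun i => O i 1, v, w]) * O =
      Matrix.of ![![1, 0, 0, 0], ![0, 1, 0, 0], O.transpose.mulVec v, O.transpose.mulVec w] := by
    ext i j
    rw [Matrix.mul_apply]
    fin_cases i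
    · have := hO2 0 j
      simp only [Matrix.of_apply]
      fin_cases j <;> simpa using this
    · have := hO2 1 j
      simp only [Matrix.of_apply]
      fin_cases j <;> simpa using this
    · simp [Matrix.mulVec, dotProduct, mul_comm]
    · simp [Matrix.mulVec, dotProduct, mul_comm]
  have h2 := congrArg Matrix.det h1
  rw [Matrix.det_mul, hdet, mul_one] at h2
  rw [h2]
  simp [Matrix.det_succ_row_zero, Fin.sum_univ_succ, Fin.succAbove]
  ring

/-- Anti-self-duality does not depend on the oriented orthonormal frame. The entries of the
conjugate are combinations of 2 × 2 minors of `O`, and for a special orthogonal matrix a minor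
equals its complementary cofactor. -/
theorem jmat_conj_apply {O : Matrix (Fin 4) (Fin 4) ℝ} (hO : O.transpose * O = 1)
    (hdet : O.det = 1) (S : Fin 3 → ℝ) :
    (O.transpose * jmat S * O) 3 2 = -(O.transpose * jmat S * O) 1 0 := by
  have key : ∀ a b : Fin 4, O a 2 * O b 3 - O a 3 * O b 2 =
      (Matrix.of ![fun i => O i 0, fun i => O i 1, Pi.single a 1, Pi.single b 1]).det := by
    intro a b
    rw [complementary_minor hO hdet]
    simp
  have h01 := key 0 1
  have h02 := key 0 2
  have h03 := key 0 3
  have h12 := key 1 2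
  have h13 := key 1 3
  have h23 := key 2 3
  simp [Matrix.det_succ_row_zero, Fin.sum_univ_succ, Fin.succAbove] at h01 h02 h03 h12 h13 h23
  simp only [Matrix.mul_apply, Fin.sum_univ_four, Matrix.transpose_apply]
  simp [jmat]
  linear_combination S 0 * h01 + S 1 * h02 + S 2 * h03 - S 2 * h12 + S 1 * h13 - S 0 * h23

end Jmat

/-! ### Oriented orthonormal bases and the points of the twistor space -/

section Asd

variable {M : Type u} [TopologicalSpace M] [ChartedSpace (E 4) M] [IsManifold (𝓡 4) ∞ M]
  (g : Metric M) (o : ManifoldOrientation M)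

/-- Normalize an orthogonal basis of the bilinear form, then correct the orientation by sign
changes, which preserve orthonormality. -/
theorem exists_orientedOrthonormal (p : M) :
    ∃ b : Module.Basis (Fin 4) ℝ (TangentSpace (𝓡 4) p), IsOrientedOrthonormal g o p b := by
  let B : LinearMap.BilinForm ℝ (E 4) := (ContinuousLinearMap.coeLM ℝ).comp (gform g p).toLinearMap
  have hB : ∀ v w, B v w = gform g p v w := fun v w => rfl
  obtain ⟨v, hv⟩ := LinearMap.BilinForm.exists_orthogonal_basis (B := B)
    ⟨fun v w => gform_symm g p v w⟩
  let v' := v.reindex (finCongr (by simp : Module.finrank ℝ (E 4) = 4))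
  have hpos : ∀ i, 0 < gform g p (v' i) (v' i) := fun i => gform_pos g p _ (v'.ne_zero i)
  have horth : ∀ i j, i ≠ j → gform g p (v' i) (v' j) = 0 := fun i j hij => by
    rw [← hB]
    simp only [v', Module.Basis.reindex_apply]
    exact hv (by simpa using hij)
  have hn : ∀ i j, gform g p ((√(gform g p (v' i) (v' i)))⁻¹ • v' i)
      ((√(gform g p (v' j) (v' j)))⁻¹ • v' j) = if i = j then 1 else 0 := fun i j => by
    by_cases hij : i = j
    · subst hij
      have h1 := Real.sq_sqrt (hpos i).le
      have h2 := (Real.sqrt_pos.2 (hpos i)).ne'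
      simp only [map_smul, FunLike.coe_smul, Pi.smul_apply, smul_eq_mul, if_true]
      field_simp
      exact h1.symm
    · simp [hij, horth i j hij]
  obtain ⟨b, hb⟩ := exists_basis_of_orthonormal g hn
  have hbo : ∀ i j, gform g p (b i) (b j) = if i = j then 1 else 0 := fun i j => by
    erw [hb i, hb j]
    exact hn i j
  have hneg₁ : ∀ v w : E 4, gform g p (-v) w = -gform g p v w := fun v w => by simp
  have hneg₂ : ∀ v w : E 4, gform g p v (-w) = -gform g p v w := fun v w => by simp
  refine ⟨b.adjustToOrientation (o.or p), fun i j => ?_, b.orientation_adjustToOrientation _⟩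
  change gform g p _ _ = _
  have := hbo i j
  by_cases hij : i = j
  · subst hij
    rcases b.adjustToOrientation_apply_eq_or_eq_neg (o.or p) i with h | h
    · rw [h]; exact this
    · rw [h]; erw [hneg₁, hneg₂, neg_neg]; exact this
  · rw [if_neg hij] at this ⊢
    rcases b.adjustToOrientation_apply_eq_or_eq_neg (o.or p) i with h | h <;>
    rcases b.adjustToOrientation_apply_eq_or_eq_neg (o.or p) j with h' | h' <;> rw [h, h']
    · exact this
    · erw [hneg₂, this, neg_zero]
    · erw [hneg₁, this, neg_zero]
    · erw [hneg₁, hneg₂, this, neg_zero, neg_zero]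

/-- `b` is a positively oriented orthonormal basis of the coordinate space at `p`. -/
def IsFrame (p : M) (b : Module.Basis (Fin 4) ℝ (E 4)) : Prop := IsOrientedOrthonormal g o p b

variable {g o} {p : M} {b b' : Module.Basis (Fin 4) ℝ (E 4)}

variable (g o) in
theorem exists_isFrame (p : M) : ∃ b : Module.Basis (Fin 4) ℝ (E 4), IsFrame g o p b :=
  exists_orientedOrthonormal g o p

theorem IsFrame.gform (hb : IsFrame g o p b) (i j : Fin 4) :
    gform g p (b i) (b j) = if i = j then 1 else 0 := hb.1 i j

theorem IsFrame.gform_sum (hb : IsFrame g o p b) (c d : Fin 4 → ℝ) :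
    Twistor.gform g p (∑ i, c i • b i : E 4) (∑ i, d i • b i : E 4) = ∑ i, c i * d i := by
  simp [hb.gform, Finset.mul_sum, mul_comm]

theorem IsFrame.expand (hb : IsFrame g o p b)
    (v : E 4) : v = ∑ i, Twistor.gform g p v (b i) • (b i : E 4) := by
  have h1 : ∀ i, Twistor.gform g p v (b i) = b.repr v i := fun i => by
    conv_lhs => rw [← b.sum_repr v, map_sum]
    simp [hb.gform, -Module.Basis.sum_repr]
  simp only [h1]
  exact (b.sum_repr v).symm

/-- The coefficient matrix of a positively oriented orthonormal family in another one is special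
orthogonal. -/
theorem IsFrame.toMatrix (hb : IsFrame g o p b)
    (hb' : IsFrame g o p b') :
    (b.toMatrix b').transpose * b.toMatrix b' = 1 ∧ (b.toMatrix b').det = 1 := by
  have h1 : (b.toMatrix b').transpose * b.toMatrix b' = 1 := by
    ext i j
    have h := hb'.gform i j
    rw [← b.sum_toMatrix_smul_self b' i, ← b.sum_toMatrix_smul_self b' j] at h
    rw [Matrix.mul_apply, Matrix.one_apply, ← h]
    exact (hb.gform_sum _ _).symm
  refine ⟨h1, ?_⟩
  have h2 := congrArg Matrix.det h1
  rw [Matrix.det_mul, Matrix.det_transpose, Matrix.det_one] at h2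
  have h3 : 0 < b.det b' :=
    (Module.Basis.orientation_eq_iff_det_pos b b').1 (hb.2.trans hb'.2.symm)
  rw [Module.Basis.det_apply] at h3
  nlinarith

/-- A basis with special orthogonal coefficients is positively oriented and orthonormal. -/
theorem IsFrame.of_toMatrix (hb : IsFrame g o p b)
    {O : Matrix (Fin 4) (Fin 4) ℝ} (hO : O.transpose * O = 1) (hdet : 0 < O.det)
    {v : Fin 4 → E 4} (hv : ∀ j, v j = ∑ i, O i j • (b i : E 4)) :
    ∃ b' : Module.Basis (Fin 4) ℝ (E 4), IsFrame g o p b' ∧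
      ∀ i, b' i = v i := by
  have hvo : ∀ i j, Twistor.gform g p (v i) (v j) = if i = j then 1 else 0 := fun i j => by
    rw [hv i, hv j]
    refine (hb.gform_sum _ _).trans ?_
    have := congrFun (congrFun hO i) j
    rwa [Matrix.mul_apply, Matrix.one_apply] at this
  obtain ⟨b', hb'⟩ : ∃ b' : Module.Basis (Fin 4) ℝ (E 4), ∀ i, b' i = v i :=
    exists_basis_of_orthonormal g hvo
  refine ⟨b', ⟨fun i j => ?_, ?_⟩, hb'⟩
  · change Twistor.gform g p (b' i) (b' j) = _
    rw [hb' i, hb' j]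
    exact hvo i j
  · rw [← hb.2]
    refine ((Module.Basis.orientation_eq_iff_det_pos b b').2 ?_).symm
    rw [Module.Basis.det_apply]
    have : b.toMatrix b' = O := by
      ext i j
      rw [Module.Basis.toMatrix_apply, hb' j, hv j, map_sum]
      simp [Finsupp.single_apply]
    exact this ▸ hdet

/-- The endomorphism `K` has the matrix `A` with respect to the vectors `v`. -/
def HasMatrix (v : Fin 4 → E 4) (K : E 4 →L[ℝ] E 4) (A : Matrix (Fin 4) (Fin 4) ℝ) : Prop :=
  ∀ j, K (v j) = ∑ i, A i j • v i

theorem HasMatrix.apply_sum {v : Fin 4 → E 4} {K : E 4 →L[ℝ] E 4} {A : Matrix (Fin 4) (Fin 4) ℝ}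
    (h : HasMatrix v K A) (c : Fin 4 → ℝ) :
    K (∑ j, c j • v j) = ∑ i, (A.mulVec c) i • v i := by
  simp only [map_sum, map_smul, h _, Finset.smul_sum, smul_smul, Matrix.mulVec, dotProduct,
    Finset.sum_smul]
  rw [Finset.sum_comm]
  exact Finset.sum_congr rfl fun i _ => Finset.sum_congr rfl fun j _ => by rw [mul_comm]

theorem HasMatrix.toMatrix {K : E 4 →L[ℝ] E 4} {A : Matrix (Fin 4) (Fin 4) ℝ}
    {c : Module.Basis (Fin 4) ℝ (E 4)} (h : HasMatrix c K A) :
    LinearMap.toMatrix c c (K : E 4 →ₗ[ℝ] E 4) = A := by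
  ext i j
  rw [LinearMap.toMatrix_apply]
  erw [h j]
  simp [Finsupp.single_apply]

theorem HasMatrix.twoVectorInner {K L : E 4 →L[ℝ] E 4} {A B : Matrix (Fin 4) (Fin 4) ℝ}
    {c : Module.Basis (Fin 4) ℝ (E 4)} (hA : HasMatrix c K A) (hB : HasMatrix c L B) :
    twoVectorInner K L = -(1 / 4) * (A * B).trace := by
  rw [Twistor.twoVectorInner, LinearMap.trace_eq_matrix_trace ℝ c]
  have : LinearMap.toMatrix c c ((K ∘L L : E 4 →L[ℝ] E 4) : E 4 →ₗ[ℝ] E 4) = A * B := by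
    rw [← hA.toMatrix, ← hB.toMatrix, ← LinearMap.toMatrix_comp]
    rfl
  rw [this]

theorem IsFrame.gform_apply (hb : IsFrame g o p b)
    {K : E 4 →L[ℝ] E 4} {A : Matrix (Fin 4) (Fin 4) ℝ} (h : HasMatrix b K A) (c d : Fin 4 → ℝ) :
    Twistor.gform g p (K (∑ i, c i • b i : E 4)) (∑ i, d i • b i : E 4) =
      dotProduct (A.mulVec c) d := by
  rw [h.apply_sum c, hb.gform_sum]
  rfl

/-- Anti-self-dual matrices define unit two-vectors in the twistor space. -/
theorem IsFrame.mem_twistorSpace (hb : IsFrame g o p b)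
    {σ : EndBundle M} (hp : σ.proj = p) {S : Fin 3 → ℝ} (hS : ∑ k, S k ^ 2 = 1)
    (h : HasMatrix b (endo σ) (jmat S)) : σ ∈ twistorSpace g o := by
  obtain ⟨q, K'⟩ := σ
  obtain rfl : q = p := hp
  let K : E 4 →L[ℝ] E 4 := K'
  have hcomp : ∀ c d : Fin 4 → ℝ, Twistor.gform g q (K (∑ i, c i • b i : E 4))
      (∑ i, d i • b i : E 4) = dotProduct ((jmat S).mulVec c) d := hb.gform_apply h
  refine ⟨fun (X Y : E 4) => ?_, fun (b' : Module.Basis (Fin 4) ℝ (E 4)) hb' => ?_, ?_⟩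
  · change Twistor.gform g q (K X) Y = -Twistor.gform g q X (K Y)
    rw [Twistor.gform_symm g q X (K Y)]
    have hX := hb.expand (v := X)
    have hY := hb.expand (v := Y)
    rw [hX, hY, hcomp, hcomp]
    rw [dotProduct_comm ((jmat S).mulVec _), Matrix.dotProduct_mulVec, ← Matrix.mulVec_transpose,
      jmat_transpose, Matrix.neg_mulVec, neg_dotProduct]
  · have hb'' : IsFrame g o q b' := hb'
    obtain ⟨hO, hdet⟩ := hb.toMatrix hb''
    have h1 := jmat_conj_apply hO hdet S
    have h2 : ∀ i j, Twistor.gform g q (K (b' j : E 4)) (b' i : E 4) =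
        ((b.toMatrix b').transpose * jmat S * b.toMatrix b') i j := fun i j => by
      rw [← b.sum_toMatrix_smul_self b' i, ← b.sum_toMatrix_smul_self b' j]
      refine (hcomp _ _).trans ?_
      rw [dotProduct_comm, mul_assoc, Matrix.mul_apply]
      simp [dotProduct, Matrix.mulVec, Matrix.mul_apply]
    rw [← h2, ← h2] at h1
    exact h1
  · have h3 : HasMatrix (b : Module.Basis (Fin 4) ℝ (E 4)) K (jmat S) := h
    change Twistor.twoVectorInner (K : E 4 →L[ℝ] E 4) K = 1
    rw [h3.twoVectorInner h3, trace_jmat_mul]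
    simp only [← pow_two, hS]; norm_num

/-- The cyclic permutations of the last three vectors of a frame. -/
theorem IsFrame.cycle (hb : IsFrame g o p b) :
    ∃ b' : Module.Basis (Fin 4) ℝ (E 4), IsFrame g o p b' ∧
      ∀ i, b' i = b (![0, 2, 3, 1] i) := by
  refine hb.of_toMatrix (O := !![1, 0, 0, 0; 0, 0, 0, 1; 0, 1, 0, 0; 0, 0, 1, 0]) ?_ ?_
    (v := fun i => b (![0, 2, 3, 1] i)) ?_
  · ext i j; fin_cases i <;> fin_cases j <;> simp [Matrix.mul_apply, Fin.sum_univ_four]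
  · simp [Matrix.det_succ_row_zero, Fin.sum_univ_succ, Fin.succAbove]
  · intro j; fin_cases j <;> simp [Fin.sum_univ_four]

/-- The components of a point of the twistor space in an oriented orthonormal basis. -/
def asdComp (g : Metric M) (q : M) (v : Fin 4 → E 4) (K : E 4 →L[ℝ] E 4) : Fin 3 → ℝ :=
  ![gform g q (K (v 0)) (v 1), gform g q (K (v 0)) (v 2), gform g q (K (v 0)) (v 3)]

/-- The defining condition gives one linear relation per oriented basis. A frame and its two cyclic
permutations give the three relations which, with skewness, put the matrix into the form `jmat`. -/
theorem IsFrame.hasMatrix_asdComp {σ : EndBundle M} {b : Module.Basis (Fin 4) ℝ (E 4)} (hb : IsFrame g o σ.proj b)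
    (hσ : σ ∈ twistorSpace g o) :
    HasMatrix b (endo σ) (jmat (asdComp g σ.proj b (endo σ))) ∧
      ∑ k, asdComp g σ.proj b (endo σ) k ^ 2 = 1 := by
  obtain ⟨q, K'⟩ := σ
  let K : E 4 →L[ℝ] E 4 := K'
  obtain ⟨h1', h2', h3⟩ := hσ
  have h1 : ∀ X Y : E 4, Twistor.gform g q (K X) Y = -Twistor.gform g q X (K Y) := h1'
  have h2 : ∀ b : Module.Basis (Fin 4) ℝ (E 4), IsFrame g o q b →
    Twistor.gform g q (K (b 2)) (b 3) = -Twistor.gform g q (K (b 0)) (b 1) := h2'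
  have hskew : ∀ i j, Twistor.gform g q (K (b j)) (b i) = -Twistor.gform g q (K (b i)) (b j) :=
    fun i j => (h1 (b j) (b i)).trans (by rw [← gform_symm g q])
  obtain ⟨b1, hb1, e1⟩ := hb.cycle
  obtain ⟨b2, hb2, e2⟩ := hb1.cycle
  have h0 : ∀ i, Twistor.gform g q (K (b i)) (b i) = 0 := fun i => by linarith [hskew i i]
  have k0 : Twistor.gform g q (K (b 2)) (b 3) = -Twistor.gform g q (K (b 0)) (b 1) := h2 b hb
  have k1 : Twistor.gform g q (K (b 3)) (b 1) = -Twistor.gform g q (K (b 0)) (b 2) := by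
    have := h2 b1 hb1
    simpa [e1] using this
  have k2 : Twistor.gform g q (K (b 1)) (b 2) = -Twistor.gform g q (K (b 0)) (b 3) := by
    have := h2 b2 hb2
    simpa [e1, e2] using this
  have hm : HasMatrix b K (jmat (asdComp g q b K)) := fun j => by
    refine (hb.expand (v := K (b j))).trans (Finset.sum_congr rfl fun i _ => ?_)
    congr 1
    have s1 := hskew 0 1
    have s2 := hskew 0 2
    have s3 := hskew 0 3
    have s4 := hskew 1 2
    have s5 := hskew 1 3
    have s6 := hskew 2 3
    fin_cases i <;> fin_cases j <;> simp [jmat, asdComp, h0] <;> linarith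
  refine ⟨hm, ?_⟩
  have h4 : HasMatrix b K (jmat (asdComp g q b K)) := hm
  have h5 : Twistor.twoVectorInner (K : E 4 →L[ℝ] E 4) K = 1 := h3
  rw [h4.twoVectorInner h4, trace_jmat_mul] at h5
  change ∑ k, asdComp g q b K k ^ 2 = 1
  simp only [pow_two]
  linarith

theorem exists_unit_orthogonal (S : Fin 3 → ℝ) :
    ∃ v : Fin 3 → ℝ, ∑ k, v k ^ 2 = 1 ∧ ∑ k, S k * v k = 0 := by
  simp only [Fin.sum_univ_three]
  by_cases h : S 0 ^ 2 + S 1 ^ 2 = 0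
  · have h0 : S 0 = 0 := by nlinarith [sq_nonneg (S 0), sq_nonneg (S 1)]
    exact ⟨![1, 0, 0], by simp, by simp [h0]⟩
  · have h1 : 0 ≤ S 0 ^ 2 + S 1 ^ 2 := by positivity
    have h2 := Real.sq_sqrt h1
    have h3 : √(S 0 ^ 2 + S 1 ^ 2) ≠ 0 := fun h4 => h (by rw [← h2, h4]; ring)
    refine ⟨![-S 1 / √(S 0 ^ 2 + S 1 ^ 2), S 0 / √(S 0 ^ 2 + S 1 ^ 2), 0], ?_, ?_⟩
    · simp [div_pow, h2]
      rw [← add_div, add_comm, div_self h]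
    · simp; ring

/-- Every point of the twistor space is of the form `E₁ ∧ E₂ - E₃ ∧ E₄`. -/
theorem exists_adapted {σ : EndBundle M} (hσ : σ ∈ twistorSpace g o) :
    ∃ b : Module.Basis (Fin 4) ℝ (E 4),
      IsFrame g o σ.proj b ∧ HasMatrix b (endo σ) (jmat ![1, 0, 0]) := by
  obtain ⟨b, hb⟩ := exists_isFrame g o σ.proj
  obtain ⟨hm, hS⟩ := hb.hasMatrix_asdComp hσ
  set S := asdComp g σ.proj b (endo σ)
  obtain ⟨v, hv, hSv⟩ := exists_unit_orthogonal S
  simp only [Fin.sum_univ_three] at hv hSv hS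
  -- The rotation of the last three vectors with columns `S`, `v`, `S × v`; it takes the axis 0 to
  -- `S`. Orthonormality and the determinant follow from Lagrange's identity `|S × v|² = |S|² |v|² -
  -- (S · v)²`.
  let O : Matrix (Fin 4) (Fin 4) ℝ := !![1, 0, 0, 0;
    0, S 0, v 0, S 1 * v 2 - S 2 * v 1;
    0, S 1, v 1, S 2 * v 0 - S 0 * v 2;
    0, S 2, v 2, S 0 * v 1 - S 1 * v 0]
  have hO : O.transpose * O = 1 := by
    ext i j
    fin_cases i <;> fin_cases j <;> simp [O, Matrix.mul_apply, Fin.sum_univ_four] <;>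
      first
        | ring1
        | linarith
        | linear_combination (v 0 ^ 2 + v 1 ^ 2 + v 2 ^ 2) * hS + hv -
            (S 0 * v 0 + S 1 * v 1 + S 2 * v 2) * hSv
  have hdet : 0 < O.det := by
    have : O.det = 1 := by
      simp [O, Matrix.det_succ_row_zero, Fin.sum_univ_succ, Fin.succAbove]
      linear_combination (v 0 ^ 2 + v 1 ^ 2 + v 2 ^ 2) * hS + hv -
            (S 0 * v 0 + S 1 * v 1 + S 2 * v 2) * hSv
    rw [this]; norm_num
  obtain ⟨b', hb', e'⟩ := hb.of_toMatrix hO hdet (v := fun j => ∑ i, O i j • (b i : E 4))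
    fun j => rfl
  refine ⟨b', hb', fun j => ?_⟩
  have hc : jmat S * O = O * jmat ![1, 0, 0] := by
    ext i j
    fin_cases i <;> fin_cases j <;>
      simp [O, jmat, Matrix.mul_apply, Fin.sum_univ_four] <;>
      first
        | ring1
        | linarith
        | linear_combination (v 0) * hS - S 0 * hSv
        | linear_combination (v 1) * hS - S 1 * hSv
        | linear_combination (v 2) * hS - S 2 * hSv
  have h1 : (b' j : E 4) = ∑ i, O i j • (b i : E 4) := e' j
  have h2 : ∀ i, (b' i : E 4) = ∑ l, O l i • (b l : E 4) := e'
  change endo σ (b' j : E 4) = ∑ i, jmat ![1, 0, 0] i j • (b' i : E 4)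
  rw [h1]
  simp only [h2]
  refine (hm.apply_sum (fun i => O i j)).trans ?_
  simp only [Finset.smul_sum, smul_smul]
  rw [Finset.sum_comm]
  refine Finset.sum_congr rfl fun i _ => ?_
  rw [← Finset.sum_smul]
  congr 1
  have := congrFun (congrFun hc i) j
  rw [Matrix.mul_apply, Matrix.mul_apply] at this
  exact this.trans (Finset.sum_congr rfl fun _ _ => mul_comm _ _)

end Asd

/-! ## Maps into the bundle of endomorphisms -/

section Mcl

/-- The linear map with a given matrix. -/
def mcl (A : Matrix (Fin 4) (Fin 4) ℝ) : E 4 →L[ℝ] E 4 :=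
  Matrix.toEuclideanCLM (n := Fin 4) (𝕜 := ℝ) A

/-- The matrix of a linear map. -/
def toMat (L : E 4 →L[ℝ] E 4) : Matrix (Fin 4) (Fin 4) ℝ := Matrix.of fun i j => L (e j) i

theorem mcl_apply (A : Matrix (Fin 4) (Fin 4) ℝ) (v : E 4) (i : Fin 4) :
    mcl A v i = A.mulVec v i := by
  simp [mcl]

theorem toMat_mcl (A : Matrix (Fin 4) (Fin 4) ℝ) : toMat (mcl A) = A := by
  ext i j
  simp [toMat, mcl_apply, e]

theorem mcl_toMat (L : E 4 →L[ℝ] E 4) : mcl (toMat L) = L := by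
  ext v i
  rw [mcl_apply]
  conv_rhs => rw [e_expand v]
  simp [toMat, Matrix.mulVec, dotProduct, mul_comm]

theorem mcl_mul (A B : Matrix (Fin 4) (Fin 4) ℝ) : mcl (A * B) = mcl A ∘L mcl B :=
  map_mul (Matrix.toEuclideanCLM (n := Fin 4) (𝕜 := ℝ)) A B

theorem mcl_injective {A B : Matrix (Fin 4) (Fin 4) ℝ} (h : mcl A = mcl B) : A = B := by
  rw [← toMat_mcl A, h, toMat_mcl]

theorem toMat_comp (L L' : E 4 →L[ℝ] E 4) : toMat (L ∘L L') = toMat L * toMat L' := by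
  apply mcl_injective
  rw [mcl_mul, mcl_toMat, mcl_toMat, mcl_toMat]

theorem toMat_add (L L' : E 4 →L[ℝ] E 4) : toMat (L + L') = toMat L + toMat L' := rfl

theorem toMat_sub (L L' : E 4 →L[ℝ] E 4) : toMat (L - L') = toMat L - toMat L' := rfl

theorem toMat_fderiv {φ : E 4 → E 4} {x : E 4} (hφ : DifferentiableAt ℝ φ x) :
    toMat (fderiv ℝ φ x) = jac φ x := by
  ext i j
  rw [toMat, jac, Matrix.of_apply, Matrix.of_apply, pderiv_eq_apply hφ]

theorem twoVectorInner_eq (K L : E 4 →L[ℝ] E 4) :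
    twoVectorInner K L = -(1 / 4) * (toMat K * toMat L).trace := by
  let c : Module.Basis (Fin 4) ℝ (E 4) := (EuclideanSpace.basisFun (Fin 4) ℝ).toBasis
  have h : ∀ K, HasMatrix c K (toMat K) := fun K j => by
    have hc : ∀ j, c j = e j := fun j => by simp [c, e]
    simp only [hc]
    exact e_expand (K (e j))
  exact (h K).twoVectorInner (h L)

variable {n : ℕ} {B : E n → E 4 →L[ℝ] E 4} {W : Set (E n)}

/-- An entry of the matrix, as a linear form. -/
def entryForm (i j : Fin 4) : (E 4 →L[ℝ] E 4) →L[ℝ] ℝ :=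
  (EuclideanSpace.proj i).comp (ContinuousLinearMap.apply ℝ (E 4) (e j))

theorem contDiffAt_iff_toMat {y : E n} :
    ContDiffAt ℝ ∞ B y ↔ ∀ i j, ContDiffAt ℝ ∞ (fun y => toMat (B y) i j) y := by
  constructor
  · intro h i j
    exact (entryForm i j).contDiff.contDiffAt.comp y h
  · intro h
    have : B = fun y => ∑ i, ∑ j, toMat (B y) i j • mcl (Matrix.single i j 1) := by
      funext y
      conv_lhs => rw [← mcl_toMat (B y), Matrix.matrix_eq_sum_single (toMat (B y))]
      simp only [mcl, map_sum]
      refine Finset.sum_congr rfl fun i _ => Finset.sum_congr rfl fun j _ => ?_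
      rw [← map_smul, Matrix.smul_single, smul_eq_mul, mul_one]
    rw [this]
    exact ContDiffAt.sum fun i _ => ContDiffAt.sum fun j _ => (h i j).smul contDiffAt_const

theorem toMat_fderiv_clm {y : E n} (hB : DifferentiableAt ℝ B y) (i : Fin n) :
    toMat (fderiv ℝ B y (e i)) = mpd i (fun y => toMat (B y)) y := by
  ext a b
  rw [mpd, Matrix.of_apply, pderiv]
  have h : (fun y => toMat (B y) a b) = entryForm a b ∘ B := rfl
  rw [h, fderiv_comp y (entryForm a b).differentiableAt hB, ContinuousLinearMap.fderiv]
  rfl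

end Mcl

section EndBundle

variable {M : Type u} [TopologicalSpace M] [ChartedSpace (E 4) M] [IsManifold (𝓡 4) ∞ M]
  (g : Metric M) {ψ : E 4 → M} {U : Set (E 4)}

/-- The endomorphism `σ` as a matrix in the chart at `q`. -/
def trivSnd (q : M) (σ : EndBundle M) : E 4 →L[ℝ] E 4 :=
  (trivializationAt (E 4 →L[ℝ] E 4) (EndFibre : M → Type) q σ).2

theorem trivSnd_eq (q : M) (σ : EndBundle M) : trivSnd q σ =
    ContinuousLinearMap.inCoordinates (E 4) (TangentSpace (𝓡 4) : M → Type) (E 4)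
      (TangentSpace (𝓡 4) : M → Type) q σ.proj q σ.proj σ.snd := by
  rw [trivSnd, hom_trivializationAt_apply]

/-- Passage between the matrix in a fixed chart and the matrix in the parametrization, written as an
intertwining relation so that it can be differentiated without inverses. -/
theorem trivSnd_comp (hψ : IsParam ψ U) {x : E 4} (q : M) (hx : x ∈ chartDom ψ U q)
    {σ : EndBundle M} (hσ : σ.proj = ψ x) {K : Matrix (Fin 4) (Fin 4) ℝ} :
    endo σ ∘L dmap ψ x = dmap ψ x ∘L mcl K ↔
      toMat (trivSnd q σ) * jac (chartRep ψ q) x = jac (chartRep ψ q) x * K := by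
  obtain ⟨p, L⟩ := σ
  obtain rfl : p = ψ x := hσ
  have hd : DifferentiableAt ℝ (chartRep ψ q) x :=
    ((contDiffOn_chartRep hψ q).contDiffAt ((isOpen_chartDom hψ q).mem_nhds hx)).differentiableAt
      (by simp)
  set T := trivializationAt (E 4) (TangentSpace (𝓡 4) : M → Type) q
  have hq : ψ x ∈ T.baseSet := hx.2
  have hT : ∀ v : E 4, (T.continuousLinearMapAt ℝ (ψ x) (dmap ψ x v) : E 4) =
      fderiv ℝ (chartRep ψ q) x v := fun v => trivialization_dmap hψ hx.1 q hx.2 v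
  have hS : ∀ v : E 4, trivSnd q ⟨ψ x, L⟩ (fderiv ℝ (chartRep ψ q) x v) =
      T.continuousLinearMapAt ℝ (ψ x) (L (dmap ψ x v)) := fun v => by
    rw [trivSnd_eq, ← hT]
    simp only [ContinuousLinearMap.inCoordinates, ContinuousLinearMap.comp_apply]
    congr 2
    exact T.symmL_continuousLinearMapAt hq _
  have hinj : Function.Injective (T.continuousLinearMapAt ℝ (ψ x)) := fun v w h => by
    have := congrArg (T.symmL ℝ (ψ x)) h
    rwa [T.symmL_continuousLinearMapAt hq, T.symmL_continuousLinearMapAt hq] at this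
  have h1 : toMat (trivSnd q ⟨ψ x, L⟩) * jac (chartRep ψ q) x = jac (chartRep ψ q) x * K ↔
      trivSnd q ⟨ψ x, L⟩ ∘L fderiv ℝ (chartRep ψ q) x = fderiv ℝ (chartRep ψ q) x ∘L mcl K := by
    rw [← toMat_fderiv hd, ← toMat_mcl K, ← toMat_comp, ← toMat_comp, toMat_mcl]
    exact ⟨fun h => by rw [← mcl_toMat (_ ∘L _), h, mcl_toMat], fun h => by rw [h]⟩
  rw [h1]
  constructor
  · intro h
    refine ContinuousLinearMap.ext fun v => ?_
    have hv : L (dmap ψ x v) = dmap ψ x (mcl K v) := DFunLike.congr_fun h v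
    rw [ContinuousLinearMap.comp_apply, hS, hv]
    exact hT _
  · intro h
    refine ContinuousLinearMap.ext fun v => ?_
    have hv := DFunLike.congr_fun h v
    rw [ContinuousLinearMap.comp_apply, hS, ContinuousLinearMap.comp_apply, ← hT] at hv
    exact hinj hv

variable {n : ℕ}

/-- The map `Ψ` into the bundle of endomorphisms is given, in the parametrization `ψ`, by the base
point `X` and the matrix `K`. -/
structure IsRep (ψ : E 4 → M) (U : Set (E 4)) (W : Set (E n)) (Ψ : E n → EndBundle M)
    (X : E n → E 4) (K : E n → Matrix (Fin 4) (Fin 4) ℝ) : Prop where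
  isOpen : IsOpen W
  smooth_base : ContDiffOn ℝ ∞ X W
  mapsTo : Set.MapsTo X W U
  smooth_mat : MatSmooth W K
  proj : ∀ y ∈ W, (Ψ y).proj = ψ (X y)
  endo : ∀ y ∈ W, Twistor.endo (Ψ y) ∘L dmap ψ (X y) = dmap ψ (X y) ∘L mcl (K y)

theorem contMDiffAt_end_iff {Ψ : E n → EndBundle M} {y : E n} :
    ContMDiffAt (𝓡 n) endModel ∞ Ψ y ↔ ContMDiffAt (𝓡 n) (𝓡 4) ∞ (fun z => (Ψ z).proj) y ∧
      ContDiffAt ℝ ∞ (fun z => trivSnd (Ψ y).proj (Ψ z)) y := by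
  rw [Bundle.contMDiffAt_totalSpace, ← contMDiffAt_iff_contDiffAt]
  rfl

end EndBundle

/-! ### Derivatives of maps into End(TM) and their covariant derivatives -/

section Rep

variable {M : Type u} [TopologicalSpace M] [ChartedSpace (E 4) M] [IsManifold (𝓡 4) ∞ M]
  (g : Metric M) {ψ : E 4 → M} {U : Set (E 4)} {n : ℕ} {W : Set (E n)} {Ψ : E n → EndBundle M}
  {X : E n → E 4} {K : E n → Matrix (Fin 4) (Fin 4) ℝ}

/-- The tangent space of End(TM) at a point is read in the preferred chart at that point, so the
derivative consists of the ordinary derivatives of the two local components in the chart frozen at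
`Ψ y`. -/
theorem mfderiv_end {y : E n} (h : ContMDiffAt (𝓡 n) endModel ∞ Ψ y) (v : E n) :
    (mfderiv (𝓡 n) endModel Ψ y v : E 4 × (E 4 →L[ℝ] E 4)) =
      (fderiv ℝ (fun z => (chartAt (E 4) (Ψ y).proj (Ψ z).proj : E 4)) y v,
        fderiv ℝ (fun z => trivSnd (Ψ y).proj (Ψ z)) y v) := by
  obtain ⟨h1, h2⟩ := contMDiffAt_end_iff.1 h
  have hsrc : ∀ᶠ z in 𝓝 y, (Ψ z).proj ∈ (chartAt (E 4) (Ψ y).proj).source :=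
    h1.continuousAt.eventually
      ((chartAt (E 4) (Ψ y).proj).open_source.mem_nhds (mem_chart_source _ _))
  have hw : writtenInExtChartAt (𝓡 n) endModel y Ψ =ᶠ[𝓝 y]
      fun z => ((chartAt (E 4) (Ψ y).proj (Ψ z).proj : E 4), trivSnd (Ψ y).proj (Ψ z)) := by
    filter_upwards [hsrc] with z hz
    have hz' : (Ψ z).proj ∈ (trivializationAt (E 4 →L[ℝ] E 4) (EndFibre : M → Type)
        (Ψ y).proj).baseSet := by
      rw [hom_trivializationAt_baseSet]
      exact ⟨hz, hz⟩
    simp only [writtenInExtChartAt, endModel, FiberBundle.extChartAt]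
    have h3 := (trivializationAt (E 4 →L[ℝ] E 4) (EndFibre : M → Type) (Ψ y).proj).coe_fst' hz'
    simp only [mfld_simps]
    refine Prod.ext ?_ rfl
    exact congrArg (chartAt (E 4) (Ψ y).proj) h3
  have hd1 : DifferentiableAt ℝ (fun z => (chartAt (E 4) (Ψ y).proj (Ψ z).proj : E 4)) y := by
    have h4 := (contMDiffAt_of_mem_maximalAtlas (I := 𝓡 4) (n := ∞)
      (IsManifold.chart_mem_maximalAtlas (Ψ y).proj) (mem_chart_source (E 4) (Ψ y).proj)).comp y h1
    exact (contMDiffAt_iff_contDiffAt.1 h4).differentiableAt (by simp)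
  have hd2 := h2.differentiableAt (by simp)
  have hr : Set.range (𝓡 n) = Set.univ := by simp
  rw [(h.mdifferentiableAt (by simp)).mfderiv, hr, fderivWithin_univ]
  have hy : extChartAt (𝓡 n) y y = y := rfl
  rw [hy, hw.fderiv_eq]
  rw [hd1.fderiv_prodMk hd2]
  rfl

namespace IsRep

theorem eventually_mem (h : IsRep ψ U W Ψ X K) (hψ : IsParam ψ U) {y : E n} (hy : y ∈ W) :
    ∃ W' ⊆ W, IsOpen W' ∧ y ∈ W' ∧ ∀ z ∈ W', X z ∈ chartDom ψ U (Ψ y).proj := by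
  refine ⟨W ∩ X ⁻¹' chartDom ψ U (Ψ y).proj, Set.inter_subset_left,
    h.smooth_base.continuousOn.isOpen_inter_preimage h.isOpen (isOpen_chartDom hψ _),
    ⟨hy, ?_⟩, fun z hz => hz.2⟩
  rw [h.proj y hy]
  exact mem_chartDom (h.mapsTo hy)

theorem contMDiffOn (h : IsRep ψ U W Ψ X K) (hψ : IsParam ψ U) :
    ContMDiffOn (𝓡 n) endModel ∞ Ψ W := by
  intro y hy
  refine ContMDiffAt.contMDiffWithinAt (contMDiffAt_end_iff.2 ⟨?_, ?_⟩)
  · have h1 : ContMDiffOn (𝓡 n) (𝓡 4) ∞ (ψ ∘ X) W :=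
      hψ.smooth.comp h.smooth_base.contMDiffOn h.mapsTo
    refine (h1.contMDiffAt (h.isOpen.mem_nhds hy)).congr_of_eventuallyEq ?_
    filter_upwards [h.isOpen.mem_nhds hy] with z hz using h.proj z hz
  · obtain ⟨W', hW', hopen, hyW, hdom⟩ := h.eventually_mem hψ hy
    rw [contDiffAt_iff_toMat]
    set q := (Ψ y).proj
    have hJ : MatSmooth W' (fun z => jac (chartRep ψ q) (X z)) :=
      (IsCoordChange.jac_smooth (contDiffOn_chartRep hψ q) (isOpen_chartDom hψ q)).comp
        (h.smooth_base.mono hW') hdom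
    have hdet : ∀ z ∈ W', (jac (chartRep ψ q) (X z)).det ≠ 0 := fun z hz => by
      have hd : DifferentiableAt ℝ (chartRep ψ q) (X z) := ((contDiffOn_chartRep hψ q).contDiffAt
        ((isOpen_chartDom hψ q).mem_nhds (hdom z hz))).differentiableAt (by simp)
      have hT := fun v => trivialization_dmap hψ (hdom z hz).1 q (hdom z hz).2 v
      refine det_jac_ne_zero hd fun v w hvw => ?_
      rw [← hT, ← hT] at hvw
      have hq : ψ (X z) ∈ (trivializationAt (E 4) (TangentSpace (𝓡 4) : M → Type) q).baseSet :=
        (hdom z hz).2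
      have h3 := congrArg ((trivializationAt (E 4) (TangentSpace (𝓡 4) : M → Type) q).symmL ℝ
        (ψ (X z))) hvw
      erw [Bundle.Trivialization.symmL_continuousLinearMapAt _ hq,
        Bundle.Trivialization.symmL_continuousLinearMapAt _ hq] at h3
      exact hψ.immersive _ (hdom z hz).1 h3
    have hB : MatSmooth W' (fun z => toMat (trivSnd q (Ψ z))) := by
      refine ((hJ.mul (h.smooth_mat.mono hW')).mul (hJ.inv hdet)).congr fun z hz => ?_
      have h4 := (trivSnd_comp hψ q (hdom z hz) (h.proj z (hW' hz)) (K := K z)).1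
        (h.endo z (hW' hz))
      rw [← h4, mul_assoc, Matrix.mul_nonsing_inv _ (isUnit_iff_ne_zero.2 (hdet z hz)), mul_one]
    exact fun i j => (hB i j).contDiffAt (hopen.mem_nhds hyW)

end IsRep

/-- A smooth map into the bundle of endomorphisms is represented by its base point and matrix. -/
theorem exists_isRep (hψ : IsParam ψ U) (hW : IsOpen W)
    (hΨ : ContMDiffOn (𝓡 n) endModel ∞ Ψ W) (hX : ContDiffOn ℝ ∞ X W) (hm : Set.MapsTo X W U)
    (hp : ∀ y ∈ W, (Ψ y).proj = ψ (X y)) : ∃ K, IsRep ψ U W Ψ X K := by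
  let D : E n → Matrix (Fin 4) (Fin 4) ℝ := fun y => toMat (dmap ψ (X y))
  have hdD : ∀ y ∈ W, (D y).det ≠ 0 := fun y hy => by
    have hd : DifferentiableAt ℝ (chartRep ψ (ψ (X y))) (X y) :=
      ((contDiffOn_chartRep hψ _).contDiffAt ((isOpen_chartDom hψ _).mem_nhds
        (mem_chartDom (hm hy)))).differentiableAt (by simp)
    simp only [D]
    rw [dmap_eq_fderiv_chartRep hψ (hm hy), toMat_fderiv hd]
    refine det_jac_ne_zero hd ?_
    rw [← dmap_eq_fderiv_chartRep hψ (hm hy)]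
    exact hψ.immersive _ (hm hy)
  let K : E n → Matrix (Fin 4) (Fin 4) ℝ := fun y => (D y)⁻¹ * (toMat (endo (Ψ y)) * D y)
  have hendo : ∀ y ∈ W, endo (Ψ y) ∘L dmap ψ (X y) = dmap ψ (X y) ∘L mcl (K y) := fun y hy => by
    rw [← mcl_toMat (_ ∘L _), ← mcl_toMat (_ ∘L mcl _), toMat_comp, toMat_comp, toMat_mcl]
    congr 1
    simp only [K]
    rw [← mul_assoc (toMat (dmap ψ (X y))),
      Matrix.mul_nonsing_inv _ (isUnit_iff_ne_zero.2 (hdD y hy)), one_mul]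
  refine ⟨K, hW, hX, hm, ?_, hp, hendo⟩
  intro a b y hy
  refine ContDiffAt.contDiffWithinAt ?_
  -- The matrix `D` refers to the preferred chart of a moving point and need not even be continuous.
  -- Smoothness of `K` is therefore checked in the chart at the fixed point `q`, where `K` is a
  -- conjugate of a smooth matrix.
  set q := ψ (X y)
  have hqy : (Ψ y).proj = q := hp y hy
  have hW'o : IsOpen (W ∩ X ⁻¹' chartDom ψ U q) :=
    hX.continuousOn.isOpen_inter_preimage hW (isOpen_chartDom hψ _)
  have hW'y : y ∈ W ∩ X ⁻¹' chartDom ψ U q := ⟨hy, mem_chartDom (hm hy)⟩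
  have hJ : MatSmooth (W ∩ X ⁻¹' chartDom ψ U q) (fun z => jac (chartRep ψ q) (X z)) :=
    (IsCoordChange.jac_smooth (contDiffOn_chartRep hψ q) (isOpen_chartDom hψ q)).comp
      (hX.mono Set.inter_subset_left) fun z hz => hz.2
  have hB := contDiffAt_iff_toMat.1 (contMDiffAt_end_iff.1 (hΨ.contMDiffAt (hW.mem_nhds hy))).2
  rw [hqy] at hB
  have hJy : (jac (chartRep ψ q) (X y)).det ≠ 0 := by
    have hd : DifferentiableAt ℝ (chartRep ψ (ψ (X y))) (X y) :=
      ((contDiffOn_chartRep hψ _).contDiffAt ((isOpen_chartDom hψ _).mem_nhds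
        (mem_chartDom (hm hy)))).differentiableAt (by simp)
    refine det_jac_ne_zero hd ?_
    rw [← dmap_eq_fderiv_chartRep hψ (hm hy)]
    exact hψ.immersive _ (hm hy)
  have hV : IsOpen ((W ∩ X ⁻¹' chartDom ψ U q) ∩
      (fun z => (jac (chartRep ψ q) (X z)).det) ⁻¹' {0}ᶜ) :=
    hJ.det.continuousOn.isOpen_inter_preimage hW'o isOpen_compl_singleton
  have hJi := (hJ.mono (Set.inter_subset_left (t := (fun z => (jac (chartRep ψ q) (X z)).det) ⁻¹'
    {0}ᶜ))).inv fun z hz => hz.2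
  have hyV := hV.mem_nhds ⟨hW'y, hJy⟩
  have hKeq : (fun z => K z a b) =ᶠ[𝓝 y] fun z => ((jac (chartRep ψ q) (X z))⁻¹ *
      (toMat (trivSnd q (Ψ z)) * jac (chartRep ψ q) (X z))) a b := by
    filter_upwards [hyV] with z hz
    have h4 := (trivSnd_comp hψ q hz.1.2 (hp z hz.1.1) (K := K z)).1 (hendo z hz.1.1)
    rw [h4, ← mul_assoc, Matrix.nonsing_inv_mul _ (isUnit_iff_ne_zero.2 hz.2), one_mul]
  refine ContDiffAt.congr_of_eventuallyEq ?_ hKeq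
  simp only [Matrix.mul_apply]
  exact ContDiffAt.sum fun k _ => ((hJi a k).contDiffAt hyV).mul
    (ContDiffAt.sum fun l _ => (hB k l).mul
      ((hJ l b).contDiffAt (hW'o.mem_nhds hW'y)))

/-- The covariant derivative of the matrix `K`, with connection matrices `Γ`, along `X`. -/
def covDeriv (Γ : Fin 4 → E 4 → Matrix (Fin 4) (Fin 4) ℝ) (X : E n → E 4)
    (K : E n → Matrix (Fin 4) (Fin 4) ℝ) (i : Fin n) (y : E n) : Matrix (Fin 4) (Fin 4) ℝ :=
  mpd i K y + ((∑ a, jac X y a i • Γ a (X y)) * K y - K y * ∑ a, jac X y a i • Γ a (X y))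

namespace IsRep

theorem horizontalPart_mfderiv (h : IsRep ψ U W Ψ X K) (hψ : IsParam ψ U) {y : E n} (hy : y ∈ W)
    (i : Fin n) : (horizontalPart (Ψ y) (mfderiv (𝓡 n) endModel Ψ y (e i)) : E 4) =
      ∑ a, jac X y a i • dmap ψ (X y) (e a) := by
  have hs := (h.contMDiffOn hψ).contMDiffAt (h.isOpen.mem_nhds hy)
  obtain ⟨W', hW', hopen, hyW, hdom⟩ := h.eventually_mem hψ hy
  have hXd : DifferentiableAt ℝ X y :=
    (h.smooth_base.contDiffAt (h.isOpen.mem_nhds hy)).differentiableAt (by simp)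
  have hCd : DifferentiableAt ℝ (chartRep ψ (Ψ y).proj) (X y) :=
    ((contDiffOn_chartRep hψ _).contDiffAt ((isOpen_chartDom hψ _).mem_nhds
      (hdom y hyW))).differentiableAt (by simp)
  have h1 : (horizontalPart (Ψ y) (mfderiv (𝓡 n) endModel Ψ y (e i)) : E 4) =
      fderiv ℝ (fun z => (chartAt (E 4) (Ψ y).proj (Ψ z).proj : E 4)) y (e i) :=
    congrArg Prod.fst (mfderiv_end hs (e i))
  have h2 : (fun z => (chartAt (E 4) (Ψ y).proj (Ψ z).proj : E 4)) =ᶠ[𝓝 y]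
      chartRep ψ (Ψ y).proj ∘ X := by
    filter_upwards [hopen.mem_nhds hyW] with z hz
    simp only [Function.comp, chartRep, h.proj z (hW' hz)]
  rw [h1, h2.fderiv_eq, fderiv_comp y hCd hXd, ContinuousLinearMap.comp_apply, fderiv_eq_jac hXd]
  have h3 : dmap ψ (X y) = fderiv ℝ (chartRep ψ (Ψ y).proj) (X y) := by
    rw [h.proj y hy]; exact dmap_eq_fderiv_chartRep hψ (h.mapsTo hy)
  simp only [map_sum, map_smul, h3]
  rfl

theorem toMat_connectionForm (p : M) (v : E 4) : toMat (connectionForm g p v) =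
    ∑ a, v a • gam (chartCoeff g p) a (chartAt (E 4) p p) := by
  refine (toMat_mcl _).trans ?_
  ext k j
  simp only [Matrix.sum_apply, Matrix.smul_apply, gam, Matrix.of_apply, smul_eq_mul]
  exact Finset.sum_congr rfl fun a _ => mul_comm _ _

/-- Differentiate the intertwining relation `B J = J K` and use the transformation law of the
Christoffel symbols; the derivatives of `J` cancel. The covariant derivative is thus computed in any
parametrization, up to conjugation by `J`, which the trace form ignores. -/
theorem verticalPart_mfderiv (h : IsRep ψ U W Ψ X K) (hψ : IsParam ψ U) {y : E n} (hy : y ∈ W)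
    (i : Fin n) : toMat (verticalPart g (Ψ y) (mfderiv (𝓡 n) endModel Ψ y (e i))) *
      jac (chartRep ψ (Ψ y).proj) (X y) = jac (chartRep ψ (Ψ y).proj) (X y) *
        covDeriv (gam (baseMetric g ψ)) X K i y := by
  have hs := (h.contMDiffOn hψ).contMDiffAt (h.isOpen.mem_nhds hy)
  obtain ⟨W', hW', hopen, hyW, hdom⟩ := h.eventually_mem hψ hy
  have hXd : DifferentiableAt ℝ X y :=
    (h.smooth_base.contDiffAt (h.isOpen.mem_nhds hy)).differentiableAt (by simp)
  set q := (Ψ y).proj with hq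
  set J := jac (chartRep ψ q) with hJ
  have hJs : MatSmooth (chartDom ψ U q) J :=
    IsCoordChange.jac_smooth (contDiffOn_chartRep hψ q) (isOpen_chartDom hψ q)
  have hBd : ContDiffAt ℝ ∞ (fun z => trivSnd q (Ψ z)) y := (contMDiffAt_end_iff.1 hs).2
  have hBe := fun a b => (contDiffAt_iff_toMat.1 hBd a b).differentiableAt (by simp)
  have hrel : ∀ z ∈ W', toMat (trivSnd q (Ψ z)) * J (X z) = J (X z) * K z := fun z hz =>
    (trivSnd_comp hψ q (hdom z hz) (h.proj z (hW' hz))).1 (h.endo z (hW' hz))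
  have hJX : MatSmooth W' (fun z => J (X z)) := hJs.comp (h.smooth_base.mono hW') hdom
  have hder := mpd_congr_on hopen hyW i hrel
  rw [mpd_mul i hBe (hJX.diffAt hopen hyW),
    mpd_mul i (hJX.diffAt hopen hyW) ((h.smooth_mat.mono hW').diffAt hopen hyW),
    mpd_comp hXd (hJs.diffAt (isOpen_chartDom hψ q) (hdom y hyW))] at hder
  have hend : toMat (Twistor.endo (Ψ y)) * J (X y) = J (X y) * K y := by
    have hd : DifferentiableAt ℝ (chartRep ψ q) (X y) :=
      ((contDiffOn_chartRep hψ _).contDiffAt ((isOpen_chartDom hψ _).mem_nhds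
        (hdom y hyW))).differentiableAt (by simp)
    have h1 := h.endo y hy
    rw [dmap_eq_fderiv_chartRep hψ (h.mapsTo hy), ← h.proj y hy] at h1
    have h2 := congrArg toMat h1
    rwa [toMat_comp, toMat_comp, toMat_mcl, toMat_fderiv hd] at h2
  have hsnd : (mfderiv (𝓡 n) endModel Ψ y (e i) : E 4 × (E 4 →L[ℝ] E 4)).2 =
      fderiv ℝ (fun z => trivSnd q (Ψ z)) y (e i) := congrArg Prod.snd (mfderiv_end hs (e i))
  have hhor := h.horizontalPart_mfderiv hψ hy i
  set ξ := mfderiv (𝓡 n) endModel Ψ y (e i) with hξ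
  have hΓ : toMat (connectionForm g q (horizontalPart (Ψ y) ξ)) * J (X y) +
      ∑ c, jac X y c i • mpd c J (X y) = J (X y) * ∑ a, jac X y a i • gam (baseMetric g ψ) a (X y) := by
    have h1 : toMat (connectionForm g q (horizontalPart (Ψ y) ξ)) =
        ∑ c, jac X y c i • ∑ a, J (X y) a c • gam (chartCoeff g q) a (chartRep ψ q (X y)) := by
      refine (toMat_connectionForm g q _).trans ?_
      rw [hhor]
      have hqx : chartAt (E 4) q q = chartRep ψ q (X y) := by
        rw [chartRep, ← h.proj y hy]
      have hcoord : ∀ c a, (dmap ψ (X y) (e c)) a = J (X y) a c := fun c a => by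
        rw [dmap_apply_coord hψ (h.mapsTo hy), hJ, hq, h.proj y hy]
      rw [hqx]
      simp only [Finset.smul_sum, smul_smul]
      rw [Finset.sum_comm]
      refine Finset.sum_congr rfl fun a _ => ?_
      rw [← Finset.sum_smul]
      congr 1
      simp [hcoord]
    rw [h1, Finset.sum_mul, Finset.mul_sum, ← Finset.sum_add_distrib]
    refine Finset.sum_congr rfl fun c _ => ?_
    rw [Matrix.mul_smul, (isCoordChange_chartRep g hψ q).mul_gam (chartCoeff_isMetricOn g q)
      (hdom y hyW), smul_add, Matrix.smul_mul]
  have hvert : toMat (verticalPart g (Ψ y) ξ) =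
      mpd i (fun z => toMat (trivSnd q (Ψ z))) y +
        toMat (connectionForm g q (horizontalPart (Ψ y) ξ)) * toMat (Twistor.endo (Ψ y)) -
        toMat (Twistor.endo (Ψ y)) * toMat (connectionForm g q (horizontalPart (Ψ y) ξ)) := by
    rw [verticalPart, hsnd, toMat_sub, toMat_add, toMat_comp, toMat_comp,
      toMat_fderiv_clm (hBd.differentiableAt (by simp))]
  rw [hvert, covDeriv]
  have hBy : toMat (trivSnd q (Ψ y)) * J (X y) = toMat (Twistor.endo (Ψ y)) * J (X y) :=
    (hrel y hyW).trans hend.symm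
  have hu : IsUnit (J (X y)).det :=
    isUnit_iff_ne_zero.2 ((isCoordChange_chartRep g hψ q).det_ne _ (hdom y hyW))
  have hBy' : toMat (trivSnd q (Ψ y)) = toMat (Twistor.endo (Ψ y)) := by
    have := congrArg (fun A => A * (J (X y))⁻¹) hBy
    simpa only [mul_assoc, Matrix.mul_nonsing_inv _ hu, mul_one] using this
  rw [hBy'] at hder
  set Γ := toMat (connectionForm g q (horizontalPart (Ψ y) ξ))
  set σ := toMat (Twistor.endo (Ψ y))
  set Jy := J (X y)
  set dJ := ∑ c, jac X y c i • mpd c J (X y) with hdJ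
  have hdJ' : ∑ c, pderiv i (fun y => X y c) y • mpd c J (X y) = dJ := rfl
  rw [hdJ'] at hder
  set A := ∑ a, jac X y a i • gam (baseMetric g ψ) a (X y)
  have e1 : (mpd i (fun z => toMat (trivSnd q (Ψ z))) y + Γ * σ - σ * Γ) * Jy =
      (mpd i (fun z => toMat (trivSnd q (Ψ z))) y * Jy + σ * dJ) + (Γ * (σ * Jy)) -
        σ * (Γ * Jy + dJ) := by noncomm_ring
  have e2 : Jy * (K y * A) = σ * (Γ * Jy + dJ) := by
    rw [hΓ, ← mul_assoc, ← hend, mul_assoc]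
  rw [e1, hder, hend, mul_add Jy, mul_sub Jy, e2, ← mul_assoc Jy A, ← hΓ]
  noncomm_ring

/-- The pull-back of the twistor metric along a represented map. -/
theorem pullbackCoeff_eq (h : IsRep ψ U W Ψ X K) (hψ : IsParam ψ U) (t : ℝ) {y : E n}
    (hy : y ∈ W) (i j : Fin n) : pullbackCoeff endModel (twistorMetric g t) Ψ y i j =
      ((jac X y).transpose * baseMetric g ψ (X y) * jac X y) i j +
        t * (-(1 / 4) * (covDeriv (gam (baseMetric g ψ)) X K i y *
          covDeriv (gam (baseMetric g ψ)) X K j y).trace) := by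
  have hx : X y ∈ chartDom ψ U (Ψ y).proj := by
    rw [h.proj y hy]; exact mem_chartDom (h.mapsTo hy)
  have hu : IsUnit (jac (chartRep ψ (Ψ y).proj) (X y)).det :=
    isUnit_iff_ne_zero.2 ((isCoordChange_chartRep g hψ (Ψ y).proj).det_ne _ hx)
  set J := jac (chartRep ψ (Ψ y).proj) (X y)
  rw [pullbackCoeff, Matrix.of_apply, twistorMetric]
  congr 1
  · have h1 := h.horizontalPart_mfderiv hψ hy i
    have h2 := h.horizontalPart_mfderiv hψ hy j
    change gform g (Ψ y).proj _ _ = _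
    rw [h1, h2, h.proj y hy]
    simp only [map_sum, map_smul, FunLike.coe_sum, Finset.sum_apply,
      FunLike.coe_smul, Pi.smul_apply, smul_eq_mul, Finset.mul_sum, Matrix.mul_apply,
      Matrix.transpose_apply, Finset.sum_mul, baseMetric_apply]
    exact Finset.sum_congr rfl fun a _ => Finset.sum_congr rfl fun d _ => by ring
  · rw [twoVectorInner_eq]
    congr 2
    have hV : ∀ i, toMat (verticalPart g (Ψ y) (mfderiv (𝓡 n) endModel Ψ y (e i))) =
        J * covDeriv (gam (baseMetric g ψ)) X K i y * J⁻¹ := fun i => by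
      rw [← h.verticalPart_mfderiv g hψ hy i, mul_assoc, Matrix.mul_nonsing_inv _ hu, mul_one]
    rw [hV, hV]
    set A := covDeriv (gam (baseMetric g ψ)) X K i y
    set B := covDeriv (gam (baseMetric g ψ)) X K j y
    have : J * A * J⁻¹ * (J * B * J⁻¹) = J * (A * B) * J⁻¹ := by
      rw [mul_assoc (J * A), ← mul_assoc J⁻¹, ← mul_assoc J⁻¹, Matrix.nonsing_inv_mul _ hu, one_mul]
      noncomm_ring
    rw [this, Matrix.trace_mul_comm, ← mul_assoc, Matrix.nonsing_inv_mul _ hu, one_mul]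

end IsRep

end Rep

/-! ## The twistor metric in a moving frame -/

section FrameConn

variable {U V : Set (E 4)} {G F : E 4 → Matrix (Fin 4) (Fin 4) ℝ}

/-- The connection matrices in the orthonormal frame with coefficients `F`. -/
def frameConn (G F : E 4 → Matrix (Fin 4) (Fin 4) ℝ) (a : Fin 4) (x : E 4) :
    Matrix (Fin 4) (Fin 4) ℝ :=
  (F x).transpose * G x * (mpd a F x + gam G a x * F x)

/-- The anti-self-dual part of the connection matrices. -/
def frameForm (G F : E 4 → Matrix (Fin 4) (Fin 4) ℝ) (a : Fin 4) (x : E 4) : Fin 3 → ℝ :=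
  asd (frameConn G F a x)

/-- `F` is the coefficient matrix of an orthonormal frame for the metric `G`. -/
structure IsOrthoFrame (U V : Set (E 4)) (G F : E 4 → Matrix (Fin 4) (Fin 4) ℝ) : Prop where
  metric : IsMetricOn U G
  isOpen : IsOpen V
  subset : V ⊆ U
  smooth : MatSmooth V F
  orthonormal : ∀ x ∈ V, (F x).transpose * G x * F x = 1

namespace IsOrthoFrame

variable (h : IsOrthoFrame U V G F) {x : E 4}
include h

theorem mul_inv (hx : x ∈ V) : F x * ((F x).transpose * G x) = 1 :=
  mul_eq_one_comm.1 (h.orthonormal x hx)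

theorem mul_frameConn (hx : x ∈ V) (a : Fin 4) :
    F x * frameConn G F a x = mpd a F x + gam G a x * F x := by
  rw [frameConn, ← mul_assoc, h.mul_inv hx, one_mul]

/-- The derivative of the orthonormality relation, combined with metric compatibility. -/
theorem frameConn_skew (hx : x ∈ V) (a : Fin 4) :
    (frameConn G F a x).transpose = -frameConn G F a x := by
  have hs : (G x).transpose = G x := by ext i j; exact h.metric.symm x (h.subset hx) j i
  have hGV := h.metric.smooth.mono h.subset
  have hd := mpd_congr_on h.isOpen hx a h.orthonormal
  rw [mpd_const, mpd_mul a ((h.smooth.transpose.mul hGV).diffAt h.isOpen hx)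
    (h.smooth.diffAt h.isOpen hx), mpd_mul a (h.smooth.transpose.diffAt h.isOpen hx)
    (hGV.diffAt h.isOpen hx), mpd_transpose, h.metric.compat (h.subset hx)] at hd
  rw [frameConn, Matrix.transpose_mul, Matrix.transpose_mul, Matrix.transpose_add,
    Matrix.transpose_mul, Matrix.transpose_transpose, hs, eq_neg_iff_add_eq_zero, ← hd]
  noncomm_ring

theorem frameConn_smooth (a : Fin 4) : MatSmooth V (frameConn G F a) := by
  have hGV := h.metric.smooth.mono h.subset
  have hm : MatSmooth V (mpd a F) := h.smooth.mpd h.isOpen a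
  exact (h.smooth.transpose.mul hGV).mul
    (hm.add (((h.metric.gam_smooth a).mono h.subset).mul h.smooth))

theorem frameForm_smooth (a : Fin 4) (k : Fin 3) :
    ContDiffOn ℝ ∞ (fun x => frameForm G F a x k) V := by
  have hc := h.frameConn_smooth a
  unfold frameForm asd
  fin_cases k
  · exact (hc 3 2).sub (hc 1 0)
  · exact (hc 1 3).sub (hc 2 0)
  · exact (hc 2 1).sub (hc 3 0)

end IsOrthoFrame

variable {n : ℕ} {W : Set (E n)} {X : E n → E 4} {K : E n → Matrix (Fin 4) (Fin 4) ℝ}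
  {S : E n → Fin 3 → ℝ}

theorem jmat_smooth (hS : ∀ k, ContDiffOn ℝ ∞ (fun y => S y k) W) :
    MatSmooth W (fun y => jmat (S y)) := by
  intro i j
  have h0 := hS 0
  have h1 := hS 1
  have h2 := hS 2
  fin_cases i <;> fin_cases j <;> simp [jmat] <;> first
    | exact contDiffOn_const
    | assumption
    | exact h0.neg
    | exact h1.neg
    | exact h2.neg

theorem mpd_jmat {y : E n} (i : Fin n) :
    mpd i (fun y => jmat (S y)) y = jmat fun k => pderiv i (fun y => S y k) y := by
  ext a b
  have hn : ∀ f : E n → ℝ, pderiv i (fun y => -f y) y = -pderiv i f y := fun f =>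
    pderiv_neg i
  fin_cases a <;> fin_cases b <;> simp [mpd, jmat, hn, pderiv_const]

/-- The covariant derivative of an anti-self-dual endomorphism in an orthonormal frame. -/
theorem covDeriv_frame (h : IsOrthoFrame U V G F) (hW : IsOpen W) (hX : ContDiffOn ℝ ∞ X W)
    (hm : Set.MapsTo X W V) (hK : MatSmooth W K) (hS : ∀ k, ContDiffOn ℝ ∞ (fun y => S y k) W)
    (hKS : ∀ z ∈ W, K z * F (X z) = F (X z) * jmat (S z)) {y : E n} (hy : y ∈ W) (i : Fin n) :
    covDeriv (gam G) X K i y * F (X y) = F (X y) *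
      jmat ((fun k => pderiv i (fun y => S y k) y) +
        ∑ a, jac X y a i • cr (frameForm G F a (X y)) (S y)) := by
  have hXd : DifferentiableAt ℝ X y := (hX.contDiffAt (hW.mem_nhds hy)).differentiableAt (by simp)
  have hFX : MatSmooth W (fun z => F (X z)) := h.smooth.comp hX hm
  have hj := jmat_smooth hS
  have hder := mpd_congr_on hW hy i hKS
  rw [mpd_mul i (hK.diffAt hW hy) (hFX.diffAt hW hy), mpd_mul i (hFX.diffAt hW hy)
    (hj.diffAt hW hy), mpd_jmat, mpd_comp hXd (h.smooth.diffAt h.isOpen (hm hy))] at hder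
  set dF := ∑ c, pderiv i (fun y => X y c) y • mpd c F (X y) with hdF
  set A := ∑ a, jac X y a i • frameConn G F a (X y) with hA
  set Γ := ∑ a, jac X y a i • gam G a (X y) with hΓ
  have h1 : F (X y) * A = dF + Γ * F (X y) := by
    rw [hA, hdF, hΓ, Finset.mul_sum, Finset.sum_mul, ← Finset.sum_add_distrib]
    refine Finset.sum_congr rfl fun a _ => ?_
    rw [Matrix.mul_smul, h.mul_frameConn (hm hy), smul_add, Matrix.smul_mul]
    rfl
  have h2 : A * jmat (S y) - jmat (S y) * A =
      jmat (∑ a, jac X y a i • cr (frameForm G F a (X y)) (S y)) := by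
    rw [jmat_sum_smul, hA, Finset.sum_mul, Finset.mul_sum, ← Finset.sum_sub_distrib]
    refine Finset.sum_congr rfl fun a _ => ?_
    rw [Matrix.smul_mul, Matrix.mul_smul, ← smul_sub, commutator_jmat (h.frameConn_skew (hm hy) a)]
    rfl
  rw [jmat_add, ← h2, covDeriv]
  set dS := jmat fun k => pderiv i (fun y => S y k) y
  have h3 : F (X y) * (A * jmat (S y)) = dF * jmat (S y) + Γ * (K y * F (X y)) := by
    rw [← mul_assoc, h1, hKS y hy, add_mul, mul_assoc]
  have h4 : F (X y) * (jmat (S y) * A) = K y * dF + K y * (Γ * F (X y)) := by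
    rw [← mul_assoc, ← hKS y hy, mul_assoc, h1, mul_add]
  have h5 : (mpd i K y + (Γ * K y - K y * Γ)) * F (X y) =
      mpd i K y * F (X y) + Γ * (K y * F (X y)) - K y * (Γ * F (X y)) := by noncomm_ring
  rw [h5, mul_add (F (X y)), mul_sub (F (X y)), h3, h4]
  rw [eq_sub_of_add_eq hder]
  abel

end FrameConn

/-! ### Product coordinates and the pull-back of the bundle metric -/

section Glue

/-- The point of the six-dimensional coordinate space with the given components. -/
def glue (x : E 4) (u : E 2) : E 6 :=
  WithLp.toLp 2 (Fin.addCases (m := 4) (n := 2) (motive := fun _ => ℝ) x u)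

theorem glue_hor (x : E 4) (u : E 2) (a : Fin 4) : glue x u (hor a) = x a :=
  Fin.addCases_left (m := 4) (n := 2) (motive := fun _ => ℝ) a

theorem glue_ver (x : E 4) (u : E 2) (α : Fin 2) : glue x u (ver α) = u α :=
  Fin.addCases_right (m := 4) (n := 2) (motive := fun _ => ℝ) α

theorem px_glue (x : E 4) (u : E 2) : px (glue x u) = x := by
  ext a; exact glue_hor x u a

theorem pu_glue (x : E 4) (u : E 2) : pu (glue x u) = u := by
  ext a; exact glue_ver x u a

theorem glue_px_pu (y : E 6) : glue (px y) (pu y) = y := by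
  ext I
  refine Fin.addCases (m := 4) (n := 2) (motive := fun I => glue (px y) (pu y) I = y I) ?_ ?_ I
  · exact fun a => glue_hor _ _ a
  · exact fun a => glue_ver _ _ a

variable {n : ℕ} {X : E n → E 4} {u : E n → E 2}

theorem contDiffOn_glue {W : Set (E n)} (hX : ContDiffOn ℝ ∞ X W) (hu : ContDiffOn ℝ ∞ u W) :
    ContDiffOn ℝ ∞ (fun y => glue (X y) (u y)) W := by
  rw [contDiffOn_euclidean]
  intro I
  refine Fin.addCases (m := 4) (n := 2)
    (motive := fun I => ContDiffOn ℝ ∞ (fun y => glue (X y) (u y) I) W) ?_ ?_ I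
  · intro a
    exact (contDiffOn_coord hX a).congr fun y _ => glue_hor _ _ a
  · intro α
    exact (contDiffOn_coord hu α).congr fun y _ => glue_ver _ _ α

theorem jac_glue_hor (y : E n) (a : Fin 4) (i : Fin n) :
    jac (fun y => glue (X y) (u y)) y (hor a) i = jac X y a i := by
  simp only [jac, Matrix.of_apply, glue_hor]

theorem jac_glue_ver (y : E n) (α : Fin 2) (i : Fin n) :
    jac (fun y => glue (X y) (u y)) y (ver α) i = jac u y α i := by
  simp only [jac, Matrix.of_apply, glue_ver]

theorem sum_quadratic {m p : ℕ} (c : ℝ) (J₁ J₂ : Fin m → ℝ) (v : Fin m → Fin p → ℝ) :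
    ∑ L, ∑ I, J₁ I * (c * ∑ k, v I k * v L k) * J₂ L =
      c * ∑ k, (∑ I, J₁ I * v I k) * ∑ L, J₂ L * v L k := by
  simp only [Finset.mul_sum, Finset.sum_mul]
  conv_rhs => rw [Finset.sum_comm]
  refine Finset.sum_congr rfl fun I _ => ?_
  rw [Finset.sum_comm]
  exact Finset.sum_congr rfl fun L _ => Finset.sum_congr rfl fun k _ => by ring

theorem pull_bundleMetric (r : ℝ) (G : E 4 → Matrix (Fin 4) (Fin 4) ℝ)
    (θ : Fin 4 → E 4 → Fin 3 → ℝ) (J : Matrix (Fin 6) (Fin n) ℝ) (z : E 6) (i j : Fin n) :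
    (J.transpose * bundleMetric r G θ z * J) i j =
      ∑ a, ∑ b, J (hor a) i * G (px z) a b * J (hor b) j +
      r ^ 2 * ∑ k, (∑ I, J I i * bundleVec r θ I z k) * (∑ I, J I j * bundleVec r θ I z k) := by
  have h1 : ∑ a, ∑ b, J (hor a) i * G (px z) a b * J (hor b) j =
      ∑ I, ∑ L, J I i * baseCoeff G I L z * J L j := by
    simp only [sum_six, baseCoeff_hor_hor, baseCoeff_hor_ver, baseCoeff_ver]
    simp
  rw [h1, ← sum_quadratic, Finset.sum_comm, ← Finset.sum_add_distrib]
  simp only [Matrix.mul_apply, Matrix.transpose_apply, bundleMetric, Matrix.of_apply,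
    Finset.sum_mul, ← Finset.sum_add_distrib, mul_add, add_mul]

/-- The chain rule: contracting `bundleVec` with the Jacobian gives the covariant derivative `dS + θ
× S` along a map with base point `X` and fibre coordinate `u`. -/
theorem sum_bundleVec_glue {r : ℝ} {θ : Fin 4 → E 4 → Fin 3 → ℝ} {y : E n} {W : Set (E n)}
    (hr : 0 < r) (hW : IsOpen W) (hu : ContDiffOn ℝ ∞ u W) (hy : y ∈ W) (hud : u y ∈ disk r)
    (i : Fin n) (k : Fin 3) :
    ∑ I, jac (fun y => glue (X y) (u y)) y I i * bundleVec r θ I (glue (X y) (u y)) k =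
      ((fun k => pderiv i (fun y => sph r (u y) k) y) +
        ∑ a, jac X y a i • cr (θ a (X y)) (sph r (u y))) k := by
  have hd : DifferentiableAt ℝ u y := (hu.contDiffAt (hW.mem_nhds hy)).differentiableAt (by simp)
  have hs : DifferentiableAt ℝ (fun u => sph r u k) (u y) :=
    ((contDiffOn_sph hr k).contDiffAt ((isOpen_disk r).mem_nhds hud)).differentiableAt (by simp)
  simp only [sum_six, bundleVec_hor, bundleVec_ver, jac_glue_hor, jac_glue_ver, px_glue, pu_glue,
    Pi.add_apply, Finset.sum_apply, Pi.smul_apply, smul_eq_mul]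
  rw [add_comm, pderiv_comp hd hs]
  rfl

end Glue

section Pullback

variable {M : Type u} [TopologicalSpace M] [ChartedSpace (E 4) M] [IsManifold (𝓡 4) ∞ M]
  {g : Metric M} {ψ : E 4 → M} {U V : Set (E 4)} {n : ℕ} {W : Set (E n)} {Ψ : E n → EndBundle M}
  {X : E n → E 4} {K : E n → Matrix (Fin 4) (Fin 4) ℝ} {F : E 4 → Matrix (Fin 4) (Fin 4) ℝ}
  {u : E n → E 2} {r : ℝ}

/-- The twistor metric in the coordinates given by an orthonormal frame. -/
theorem pullbackCoeff_twistorMetric (hr : 0 < r) (hψ : IsParam ψ U)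
    (hF : IsOrthoFrame U V (baseMetric g ψ) F) (hΨ : IsRep ψ U W Ψ X K) (hm : Set.MapsTo X W V)
    (hu : ContDiffOn ℝ ∞ u W) (hud : Set.MapsTo u W (disk r))
    (hKF : ∀ y ∈ W, K y * F (X y) = F (X y) * jmat (sph r (u y))) {y : E n} (hy : y ∈ W) :
    pullbackCoeff endModel (twistorMetric g (r ^ 2)) Ψ y =
      (jac (fun y => glue (X y) (u y)) y).transpose *
        bundleMetric r (baseMetric g ψ) (frameForm (baseMetric g ψ) F) (glue (X y) (u y)) *
        jac (fun y => glue (X y) (u y)) y := by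
  have hS : ∀ k, ContDiffOn ℝ ∞ (fun y => sph r (u y) k) W := fun k =>
    (contDiffOn_sph hr k).comp hu hud
  have hc := fun i => covDeriv_frame hF hΨ.isOpen hΨ.smooth_base hm hΨ.smooth_mat hS hKF hy i
  ext i j
  rw [hΨ.pullbackCoeff_eq g hψ (r ^ 2) hy, pull_bundleMetric]
  simp only [sum_bundleVec_glue hr hΨ.isOpen hu hy (hud hy)]
  set A := covDeriv (gam (baseMetric g ψ)) X K i y
  set B := covDeriv (gam (baseMetric g ψ)) X K j y
  set f := F (X y)
  set fi := f.transpose * baseMetric g ψ (X y)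
  have h1 : f * fi = 1 := hF.mul_inv (hm hy)
  have h2 : fi * f = 1 := hF.orthonormal _ (hm hy)
  congr 1
  · simp only [Matrix.mul_apply, Matrix.transpose_apply, Finset.sum_mul, jac_glue_hor, px_glue]
    rw [Finset.sum_comm]
  · congr 1
    have h3 : ∀ (A : Matrix (Fin 4) (Fin 4) ℝ) (S : Fin 3 → ℝ), A * f = f * jmat S →
        A = f * jmat S * fi := fun A S hA => by rw [← hA, mul_assoc, h1, mul_one]
    have h5 : ∀ P Q : Matrix (Fin 4) (Fin 4) ℝ, f * P * fi * (f * Q * fi) = f * (P * Q) * fi :=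
      fun P Q => by
        rw [mul_assoc (f * P), ← mul_assoc fi, ← mul_assoc fi, h2, one_mul]; noncomm_ring
    -- Conjugation by the frame drops out of the trace, and the normalization `-1/4` of the inner
    -- product cancels the factor in `trace_jmat_mul`.
    rw [h3 A _ (hc i), h3 B _ (hc j), h5, Matrix.trace_mul_comm, ← mul_assoc, h2, one_mul, trace_jmat_mul]
    ring

end Pullback

/-! ### Bilinearity of the twistor metric and immersivity -/

section Linear

variable {M : Type u} [TopologicalSpace M] [ChartedSpace (E 4) M] [IsManifold (𝓡 4) ∞ M]
  (g : Metric M)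

theorem connectionForm_linear (p : M) : IsLinearMap ℝ (fun v : E 4 => connectionForm g p v) := by
  have h : ∀ v : E 4, connectionForm g p v =
      mcl (∑ a, v a • gam (chartCoeff g p) a (chartAt (E 4) p p)) := fun v => by
    rw [← IsRep.toMat_connectionForm, mcl_toMat]
  constructor
  · intro v w
    rw [h, h, h]
    simp only [mcl, ← map_add, PiLp.add_apply, add_smul, Finset.sum_add_distrib]
  · intro c v
    rw [h, h]
    simp only [mcl, ← map_smul, PiLp.smul_apply, smul_eq_mul, mul_smul, Finset.smul_sum]

/-- The vertical part as a linear map. -/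
theorem verticalPart_linear (σ : EndBundle M) :
    IsLinearMap ℝ (fun ξ : E 4 × (E 4 →L[ℝ] E 4) => verticalPart g σ ξ) := by
  have h : ∀ ξ : E 4 × (E 4 →L[ℝ] E 4), verticalPart g σ ξ = ξ.2 +
      connectionForm g σ.proj ξ.1 ∘L endo σ - endo σ ∘L connectionForm g σ.proj ξ.1 := fun ξ => rfl
  have hl := connectionForm_linear g σ.proj
  constructor
  · intro ξ η
    rw [h, h, h, Prod.fst_add, Prod.snd_add, hl.map_add, ContinuousLinearMap.add_comp,
      ContinuousLinearMap.comp_add]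
    abel
  · intro c ξ
    rw [h, h, Prod.smul_fst, Prod.smul_snd, hl.map_smul, ContinuousLinearMap.smul_comp,
      ContinuousLinearMap.comp_smul, smul_sub, smul_add]

theorem twistorMetric_linear (t : ℝ) (σ : EndBundle M) (ξ : E 4 × (E 4 →L[ℝ] E 4)) :
    IsLinearMap ℝ (fun η : E 4 × (E 4 →L[ℝ] E 4) => twistorMetric g t σ ξ η) := by
  have h : ∀ η : E 4 × (E 4 →L[ℝ] E 4), twistorMetric g t σ ξ η = gform g σ.proj ξ.1 η.1 +
      t * (-(1 / 4) * (toMat (verticalPart g σ ξ) * toMat (verticalPart g σ η)).trace) :=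
    fun η => by rw [← twoVectorInner_eq]; rfl
  have hl := verticalPart_linear g σ
  have hsm : ∀ (c : ℝ) (L : E 4 →L[ℝ] E 4), toMat (c • L) = c • toMat L := fun _ _ => rfl
  constructor
  · intro η η'
    rw [h, h, h, hl.map_add, toMat_add, mul_add, Matrix.trace_add, Prod.fst_add, map_add]
    ring
  · intro c η
    rw [h, h, hl.map_smul, hsm, Matrix.mul_smul, Matrix.trace_smul, Prod.smul_fst, map_smul]
    simp only [smul_eq_mul]
    ring

/-- A map with non-degenerate pull-back metric is immersive. -/
theorem injective_of_pullback {n : ℕ} {t : ℝ} {Ψ : E n → EndBundle M} {y : E n}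
    (h : (pullbackCoeff endModel (twistorMetric g t) Ψ y).det ≠ 0) :
    Function.Injective (mfderiv (𝓡 n) endModel Ψ y) := by
  let D : E n →ₗ[ℝ] E 4 × (E 4 →L[ℝ] E 4) := (mfderiv (𝓡 n) endModel Ψ y).toLinearMap
  change Function.Injective D
  rw [injective_iff_map_eq_zero]
  intro v hv
  by_contra hne
  refine h (Matrix.exists_mulVec_eq_zero_iff.1 ⟨v, fun h0 => hne (by ext i; exact congrFun h0 i), ?_⟩)
  funext i
  let L := (twistorMetric_linear g t (Ψ y) (D (e i))).mk'
  have h1 : L (D v) = 0 := by rw [hv, map_zero]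
  rw [e_expand v] at h1
  simp only [map_sum, map_smul] at h1
  rw [Pi.zero_apply, ← h1]
  change ∑ j, pullbackCoeff endModel (twistorMetric g t) Ψ y i j * v j =
    ∑ j, v j * pullbackCoeff endModel (twistorMetric g t) Ψ y i j
  exact Finset.sum_congr rfl fun j _ => mul_comm _ _

end Linear

/-! ### The map into the twistor space defined by a frame -/

section Lift

variable {M : Type u} [TopologicalSpace M] [ChartedSpace (E 4) M] [IsManifold (𝓡 4) ∞ M]
  {g : Metric M} {ψ : E 4 → M} {U V : Set (E 4)} {F : E 4 → Matrix (Fin 4) (Fin 4) ℝ} {r : ℝ}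

theorem mcl_e (A : Matrix (Fin 4) (Fin 4) ℝ) (j : Fin 4) : mcl A (e j) = ∑ i, A i j • (e i : E 4) := by
  conv_lhs => rw [e_expand (mcl A (e j))]
  refine Finset.sum_congr rfl fun i _ => ?_
  have : mcl A (e j) i = toMat (mcl A) i j := rfl
  rw [this, toMat_mcl]

theorem frameVec_eq (x : E 4) (j : Fin 4) : frameVec ψ F x j = dmap ψ x (mcl (F x) (e j)) := by
  rw [mcl_e, map_sum]
  simp only [map_smul, frameVec]

/-- Relates the coordinate matrix `K` to the frame matrix `A`; injectivity of the derivative of `ψ`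
allows it to be cancelled. -/
theorem hasMatrix_frameVec_iff (hψ : IsParam ψ U) {x : E 4} (hx : x ∈ U) {σ : E 4 →L[ℝ] E 4}
    {K A : Matrix (Fin 4) (Fin 4) ℝ} (hK : σ ∘L dmap ψ x = dmap ψ x ∘L mcl K) :
    HasMatrix (frameVec ψ F x) σ A ↔ K * F x = F x * A := by
  have hK' : ∀ v, σ (dmap ψ x v) = dmap ψ x (mcl K v) := fun v => DFunLike.congr_fun hK v
  have h1 : ∀ j, σ (frameVec ψ F x j) = dmap ψ x (mcl (K * F x) (e j)) := fun j => by
    rw [frameVec_eq, hK', mcl_mul]; rfl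
  have h2 : ∀ j, ∑ i, A i j • frameVec ψ F x i = dmap ψ x (mcl (F x * A) (e j)) := fun j => by
    rw [mcl_mul, ContinuousLinearMap.comp_apply, mcl_e A, map_sum, map_sum]
    simp only [map_smul, frameVec_eq]
  constructor
  · intro h
    have h3 : ∀ j, mcl (K * F x) (e j) = mcl (F x * A) (e j) := fun j =>
      hψ.immersive x hx (by
        have h4 := h j
        rw [h1, h2] at h4
        exact h4)
    rw [← toMat_mcl (K * F x), ← toMat_mcl (F x * A)]
    ext i j
    simp only [toMat, Matrix.of_apply, h3]
  · intro h j
    rw [h1, h2, h]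

theorem endBundle_ext {σ τ : EndBundle M} (h : σ.proj = τ.proj) (h' : endo σ = endo τ) : σ = τ := by
  obtain ⟨p, L⟩ := σ
  obtain ⟨q, L'⟩ := τ
  obtain rfl : p = q := h
  congr 1

theorem dmap_surjective (hψ : IsParam ψ U) {x : E 4} (hx : x ∈ U) :
    Function.Surjective (dmap ψ x) := by
  have h : Function.Injective (dmap ψ x).toLinearMap := hψ.immersive x hx
  exact LinearMap.injective_iff_surjective.1 h

theorem comp_dmap_injective (hψ : IsParam ψ U) {x : E 4} (hx : x ∈ U) {L L' : E 4 →L[ℝ] E 4}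
    (h : L ∘L dmap ψ x = L' ∘L dmap ψ x) : L = L' := by
  refine ContinuousLinearMap.ext fun v => ?_
  obtain ⟨w, rfl⟩ := dmap_surjective hψ hx v
  exact DFunLike.congr_fun h w

variable (g ψ F r) in
/-- The matrix, in coordinates, of the endomorphism with frame components `sph r (pu y)`. -/
def liftMat (y : E 6) : Matrix (Fin 4) (Fin 4) ℝ :=
  F (px y) * jmat (sph r (pu y)) * ((F (px y)).transpose * baseMetric g ψ (px y))

variable (g ψ F r) in
/-- The map into the twistor space defined by an orthonormal frame of the base and graph coordinates
of the sphere. -/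
def lift (y : E 6) : EndBundle M :=
  ⟨ψ (px y), (mcl (toMat (dmap ψ (px y)) * liftMat g ψ F r y * (toMat (dmap ψ (px y)))⁻¹) :
    E 4 →L[ℝ] E 4)⟩

theorem liftMat_mul (hF : IsOrthoFrame U V (baseMetric g ψ) F) {y : E 6} (hy : px y ∈ V) :
    liftMat g ψ F r y * F (px y) = F (px y) * jmat (sph r (pu y)) := by
  rw [liftMat, mul_assoc, hF.orthonormal _ hy, mul_one]

theorem det_toMat_dmap (hψ : IsParam ψ U) {x : E 4} (hx : x ∈ U) : (toMat (dmap ψ x)).det ≠ 0 := by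
  have hd : DifferentiableAt ℝ (chartRep ψ (ψ x)) x :=
    ((contDiffOn_chartRep hψ _).contDiffAt ((isOpen_chartDom hψ _).mem_nhds
      (mem_chartDom hx))).differentiableAt (by simp)
  rw [dmap_eq_fderiv_chartRep hψ hx, toMat_fderiv hd]
  refine det_jac_ne_zero hd ?_
  rw [← dmap_eq_fderiv_chartRep hψ hx]
  exact hψ.immersive _ hx

theorem lift_comp_dmap (hψ : IsParam ψ U) {y : E 6} (hy : px y ∈ U) :
    endo (lift g ψ F r y) ∘L dmap ψ (px y) = dmap ψ (px y) ∘L mcl (liftMat g ψ F r y) := by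
  have h : endo (lift g ψ F r y) =
    mcl (toMat (dmap ψ (px y)) * liftMat g ψ F r y * (toMat (dmap ψ (px y)))⁻¹) := rfl
  have hu := isUnit_iff_ne_zero.2 (det_toMat_dmap hψ hy)
  rw [h]
  conv_lhs => rw [← mcl_toMat (dmap ψ (px y))]
  conv_rhs => rw [← mcl_toMat (dmap ψ (px y))]
  rw [toMat_mcl, ← mcl_mul, ← mcl_mul, mul_assoc, Matrix.nonsing_inv_mul _ hu, mul_one]

theorem isRep_lift (hr : 0 < r) (hψ : IsParam ψ U) (hF : IsOrthoFrame U V (baseMetric g ψ) F) :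
    IsRep ψ U (boxSet V (disk r)) (lift g ψ F r) px (liftMat g ψ F r) where
  isOpen := isOpen_boxSet hF.isOpen (isOpen_disk r)
  smooth_base := contDiff_px.contDiffOn
  mapsTo := fun y hy => hF.subset hy.1
  smooth_mat := by
    have hp : ContDiffOn ℝ ∞ px (boxSet V (disk r)) := contDiff_px.contDiffOn
    have hm : Set.MapsTo px (boxSet V (disk r)) V := fun y hy => hy.1
    have h1 := hF.smooth.comp hp hm
    have h2 := (hF.metric.smooth.mono hF.subset).comp hp hm
    have h3 : MatSmooth (boxSet V (disk r)) (fun y => jmat (sph r (pu y))) :=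
      jmat_smooth fun k => (contDiffOn_sph hr k).comp contDiff_pu.contDiffOn fun y hy => hy.2
    exact (h1.mul h3).mul (h1.transpose.mul h2)
  proj := fun y _ => rfl
  endo := fun y hy => lift_comp_dmap hψ (hF.subset hy.1)

/-- For the lift the base point and fibre coordinate are the projections, so the glued coordinate
map is the identity and its Jacobian is 1. -/
theorem pullbackCoeff_lift (hr : 0 < r) (hψ : IsParam ψ U)
    (hF : IsOrthoFrame U V (baseMetric g ψ) F) {y : E 6} (hy : y ∈ boxSet V (disk r)) :
    pullbackCoeff endModel (twistorMetric g (r ^ 2)) (lift g ψ F r) y =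
      bundleMetric r (baseMetric g ψ) (frameForm (baseMetric g ψ) F) y := by
  rw [pullbackCoeff_twistorMetric (X := px) (u := pu) hr hψ hF (isRep_lift hr hψ hF)
    (fun y hy => hy.1) contDiff_pu.contDiffOn (fun y hy => hy.2)
    (fun y hy => liftMat_mul hF hy.1) hy]
  have : jac (fun y => glue (px y) (pu y)) y = 1 := by
    ext I J
    simp only [glue_px_pu, jac, Matrix.of_apply]
    rw [pderiv_coord, Matrix.one_apply]
    simp only [eq_comm]
  rw [this, glue_px_pu]
  simp

end Lift

/-! ### Adapted charts of the twistor space -/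

section TwistorChart

variable {M : Type u} [TopologicalSpace M] [ChartedSpace (E 4) M] [IsManifold (𝓡 4) ∞ M]
  (g : Metric M) (o : ManifoldOrientation M) {ψ : E 4 → M} {U V : Set (E 4)}
  {F : E 4 → Matrix (Fin 4) (Fin 4) ℝ} {r : ℝ} {p : M} {b : Fin 4 → E 4}

/-- A normal parametrization at `p` with a positively oriented normal orthonormal frame. -/
structure IsTwistorChart (p : M) (b : Fin 4 → E 4) (ψ : E 4 → M) (U V : Set (E 4))
    (F : E 4 → Matrix (Fin 4) (Fin 4) ℝ) : Prop where
  normal : IsNormalParam g p b ψ U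
  frame : IsNormalFrame (baseMetric g ψ) V F
  subset : V ⊆ U
  oriented : ∀ x ∈ V, ∃ b' : Module.Basis (Fin 4) ℝ (E 4), IsFrame g o (ψ x) b' ∧
    ∀ i, b' i = frameVec ψ F x i

/-- Combines the normal parametrization with the normal frame, shrinking the domain until the frame
is positively oriented everywhere. -/
theorem exists_isTwistorChart {b : Module.Basis (Fin 4) ℝ (E 4)} (hb : IsFrame g o p b) :
    ∃ ψ U V F, IsTwistorChart g o p b ψ U V F := by
  obtain ⟨ψ, U, hψ⟩ := exists_isNormalParam g p b hb.gform
  obtain ⟨V, F, hVU, hF⟩ := exists_isNormalFrame (baseMetric_isMetricOn g hψ.param) hψ.zero_mem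
    hψ.metric_one hψ.metric_flat
  have hev := eventually_frame_oriented g o b hb hψ hF
  obtain ⟨V', hV', hopen, h0⟩ := eventually_nhds_iff.1 hev
  refine ⟨ψ, U, V ∩ V', F, hψ, ⟨hF.isOpen.inter hopen, ⟨hF.zero_mem, h0⟩,
    hF.smooth.mono Set.inter_subset_left, fun x hx => hF.symm x hx.1,
    fun x hx => hF.orthonormal x hx.1, hF.zero, hF.flat⟩, fun x hx => hVU hx.1, fun x hx => ?_⟩
  have hvo : ∀ i j, gform g (ψ x) (frameVec ψ F x i) (frameVec ψ F x j) =
      if i = j then 1 else 0 := fun i j => by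
    rw [gform_frameVec, hF.symm x hx.1, hF.orthonormal x hx.1, Matrix.one_apply]
  obtain ⟨b', hb'⟩ := exists_basis_of_orthonormal g hvo
  exact ⟨b', hV' x hx.2 b' hb', hb'⟩

variable {g o}

namespace IsTwistorChart

variable (h : IsTwistorChart g o p b ψ U V F)
include h

theorem isOrthoFrame : IsOrthoFrame U V (baseMetric g ψ) F where
  metric := baseMetric_isMetricOn g h.normal.param
  isOpen := h.frame.isOpen
  subset := h.subset
  smooth := h.frame.smooth
  orthonormal := fun x hx => by rw [h.frame.symm x hx]; exact h.frame.orthonormal x hx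

theorem frameConn_zero (a : Fin 4) : frameConn (baseMetric g ψ) F a 0 = 0 := by
  have hG := baseMetric_isMetricOn g h.normal.param
  have h1 : gam (baseMetric g ψ) a 0 = 0 := by
    have h2 : ∀ a, (0 : Matrix (Fin 4) (Fin 4) ℝ) = gam (baseMetric g ψ) a 0 :=
      hG.gam_unique h.normal.zero_mem (fun _ => 0) (fun _ _ _ => rfl) fun i => by
        rw [h.normal.metric_flat]; simp
    exact (h2 a).symm
  rw [frameConn, h.frame.flat, h1]
  simp

theorem frameForm_zero (a : Fin 4) (k : Fin 3) : frameForm (baseMetric g ψ) F a 0 k = 0 := by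
  rw [frameForm, h.frameConn_zero, asd]
  fin_cases k <;> simp

theorem frameVec_zero (i : Fin 4) : frameVec ψ F 0 i = b i := by
  rw [frameVec, h.frame.zero, ← h.normal.dmap_zero i]
  simp [Matrix.one_apply]

theorem lift_mem {y : E 6} (hr : 0 < r) (hy : y ∈ boxSet V (disk r)) :
    lift g ψ F r y ∈ twistorSpace g o := by
  obtain ⟨b', hb', e'⟩ := h.oriented _ hy.1
  refine hb'.mem_twistorSpace (S := sph r (pu y)) rfl (sph_norm hr hy.2) ?_
  have h1 := (hasMatrix_frameVec_iff (F := F) (A := jmat (sph r (pu y))) h.normal.param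
    (h.subset hy.1) (lift_comp_dmap (r := r) h.normal.param (h.subset hy.1))).2
    (liftMat_mul h.isOrthoFrame hy.1)
  intro j
  have h2 := h1 j
  simp only [← e'] at h2
  exact h2

/-- The lift is a local parametrization of the twistor space near the origin. -/
theorem exists_isLocalParam_lift (hr : 0 < r) :
    ∃ W, IsLocalParam endModel (twistorSpace g o) (lift g ψ F r) W ∧ (0 : E 6) ∈ W ∧
      W ⊆ boxSet V (disk r) ∧
      IsMetricOn W (bundleMetric r (baseMetric g ψ) (frameForm (baseMetric g ψ) F)) := by
  have hF := h.isOrthoFrame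
  have hGV : IsMetricOn V (baseMetric g ψ) := hF.metric.mono hF.isOpen hF.subset
  obtain ⟨W, hW, h0, hsub⟩ := bundleMetric_isMetricOn hr hGV hF.frameForm_smooth
    h.frame.zero_mem h.normal.metric_one h.frameForm_zero
  refine ⟨W, ⟨hW.isOpen, ((isRep_lift hr h.normal.param hF).contMDiffOn h.normal.param).mono hsub,
    fun y hy => ?_, fun y hy => h.lift_mem hr (hsub hy)⟩, h0, hsub, hW⟩
  refine injective_of_pullback g (t := r ^ 2) ?_
  rw [pullbackCoeff_lift hr h.normal.param hF (hsub hy)]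
  exact hW.det_ne y hy

/-- The pole `sph r 0` is the axis 0. Together with `exists_adapted` this makes every point of the
twistor space the centre of an adapted lift. -/
theorem lift_zero {σ : EndBundle M} (hσ : σ.proj = p)
    (hm : HasMatrix b (endo σ) (jmat ![1, 0, 0])) : lift g ψ F r 0 = σ := by
  have h0U := h.normal.zero_mem
  have hp0 : px 0 = 0 := px_zero
  have h1 := (hasMatrix_frameVec_iff (F := F) (A := jmat (sph r (pu 0))) h.normal.param
    (by rw [hp0]; exact h0U) (lift_comp_dmap (y := 0) (r := r) h.normal.param
      (by rw [hp0]; exact h0U))).2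
    (liftMat_mul h.isOrthoFrame (by rw [hp0]; exact h.frame.zero_mem))
  rw [px_zero, pu_zero, sph_zero] at h1
  refine endBundle_ext ?_ ?_
  · rw [hσ, ← h.normal.map_zero, ← px_zero]; rfl
  · refine comp_dmap_injective h.normal.param h0U (ContinuousLinearMap.ext fun v => ?_)
    conv_lhs => rw [e_expand v]
    conv_rhs => rw [e_expand v]
    simp only [map_sum, map_smul, ContinuousLinearMap.comp_apply, h.normal.dmap_zero]
    refine Finset.sum_congr rfl fun i _ => ?_
    congr 1
    have h2 := h1 i
    simp only [h.frameVec_zero] at h2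
    exact h2.trans (hm i).symm

/-- Every local parametrization of the twistor space is, locally, a coordinate change of the lift. -/
theorem exists_isCoordChange (hr : 0 < r) {Ψ : E 6 → EndBundle M} {W₀ : Set (E 6)}
    (hΨ : IsLocalParam endModel (twistorSpace g o) Ψ W₀) {y₀ : E 6} (hy₀ : y₀ ∈ W₀)
    (hp : (Ψ y₀).proj = p) (hm : HasMatrix b (endo (Ψ y₀)) (jmat ![1, 0, 0])) {W₁ : Set (E 6)}
    (hW₁ : IsOpen W₁) (h0W₁ : (0 : E 6) ∈ W₁) (hsub : W₁ ⊆ boxSet V (disk r)) :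
    ∃ W φ, y₀ ∈ W ∧ φ y₀ = 0 ∧ IsCoordChange W W₁ φ
      (pullbackCoeff endModel (twistorMetric g (r ^ 2)) Ψ)
      (bundleMetric r (baseMetric g ψ) (frameForm (baseMetric g ψ) F)) := by
  have hF := h.isOrthoFrame
  have hpar := h.normal.param
  set G := baseMetric g ψ with hG
  obtain ⟨O, χ, hO, hpO, hχ, hχm, hχp, hψχ⟩ := h.normal.inverse
  have hprojs : ContMDiffOn (𝓡 6) (𝓡 4) ∞ (fun y => (Ψ y).proj) W₀ := fun y hy =>
    (contMDiffAt_end_iff.1 (hΨ.smooth.contMDiffAt (hΨ.isOpen.mem_nhds hy))).1.contMDiffWithinAt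
  -- The coordinate change is recovered from `Ψ`: the base coordinates through the local inverse of
  -- `ψ`, and the fibre coordinates from the frame components of `Ψ y`.
  let X : E 6 → E 4 := fun y => χ (Ψ y).proj
  have hWa : IsOpen (W₀ ∩ (fun y => (Ψ y).proj) ⁻¹' O) :=
    hprojs.continuousOn.isOpen_inter_preimage hΨ.isOpen hO
  have hXa : ContDiffOn ℝ ∞ X (W₀ ∩ (fun y => (Ψ y).proj) ⁻¹' O) :=
    contMDiffOn_iff_contDiffOn.1 (hχ.comp (hprojs.mono Set.inter_subset_left) fun y hy => hy.2)
  have hX0 : X y₀ = 0 := by simp only [X, hp, hχp]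
  have hWb : IsOpen ((W₀ ∩ (fun y => (Ψ y).proj) ⁻¹' O) ∩ X ⁻¹' V) :=
    hXa.continuousOn.isOpen_inter_preimage hWa hF.isOpen
  set Wb := (W₀ ∩ (fun y => (Ψ y).proj) ⁻¹' O) ∩ X ⁻¹' V with hWbdef
  have hyb : y₀ ∈ Wb := ⟨⟨hy₀, by rw [Set.mem_preimage, hp]; exact hpO⟩,
    by rw [Set.mem_preimage, hX0]; exact h.frame.zero_mem⟩
  have hXs : ContDiffOn ℝ ∞ X Wb := hXa.mono Set.inter_subset_left
  obtain ⟨K, hrep⟩ := exists_isRep hpar hWb (hΨ.smooth.mono fun y hy => hy.1.1) hXs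
    (fun y hy => hF.subset hy.2) (fun y hy => (hψχ _ hy.1.2).symm)
  -- The matrix of `Ψ y` in the frame. On the twistor space it is a `jmat`, whose components stand
  -- in its first column; this expresses them as smooth functions.
  let L : E 6 → Matrix (Fin 4) (Fin 4) ℝ := fun y =>
    (F (X y)).transpose * G (X y) * (K y * F (X y))
  have hmV : Set.MapsTo X Wb V := fun y hy => hy.2
  have hFX : MatSmooth Wb fun y => F (X y) := hF.smooth.comp hXs hmV
  have hGX : MatSmooth Wb fun y => G (X y) := (hF.metric.smooth.mono hF.subset).comp hXs hmV
  have hLs : MatSmooth Wb L := (hFX.transpose.mul hGX).mul (hrep.smooth_mat.mul hFX)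
  let S : E 6 → Fin 3 → ℝ := fun y => ![L y 1 0, L y 2 0, L y 3 0]
  have hLS : ∀ A, ∀ y ∈ Wb, K y * F (X y) = F (X y) * jmat A → S y = A := fun A y hy hA => by
    have : L y = jmat A := by
      simp only [L]
      rw [hA, ← mul_assoc, hF.orthonormal _ (hmV hy), one_mul]
    ext k
    simp only [S, this]
    fin_cases k <;> simp [jmat]
  have hS : ∀ y ∈ Wb, K y * F (X y) = F (X y) * jmat (S y) ∧ ∑ k, S y k ^ 2 = 1 := fun y hy => by
    obtain ⟨b', hb', e'⟩ := h.oriented _ (hmV hy)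
    have hq : (Ψ y).proj = ψ (X y) := hrep.proj y hy
    rw [← hq] at hb'
    obtain ⟨h1, h2⟩ := hb'.hasMatrix_asdComp (hΨ.mapsTo hy.1.1)
    have h3 : HasMatrix (frameVec ψ F (X y)) (endo (Ψ y))
        (jmat (asdComp g (Ψ y).proj b' (endo (Ψ y)))) := fun j => by
      have := h1 j
      simp only [e'] at this
      exact this
    have h4 := (hasMatrix_frameVec_iff hpar (hF.subset (hmV hy)) (hrep.endo y hy)).1 h3
    have h5 := hLS _ y hy h4
    rw [h5]
    exact ⟨h4, h2⟩
  have hS0 : S y₀ = ![1, 0, 0] := by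
    refine hLS _ y₀ hyb ((hasMatrix_frameVec_iff hpar (hF.subset (hmV hyb))
      (hrep.endo y₀ hyb)).1 fun j => ?_)
    simp only [hX0, h.frameVec_zero]
    exact hm j
  have hSs : ∀ k, ContDiffOn ℝ ∞ (fun y => S y k) Wb := fun k => by
    fin_cases k
    · exact hLs 1 0
    · exact hLs 2 0
    · exact hLs 3 0
  let u : E 6 → E 2 := fun y => WithLp.toLp 2 ![r * S y 1, r * S y 2]
  have hus : ContDiffOn ℝ ∞ u Wb := by
    rw [contDiffOn_euclidean]
    intro α
    fin_cases α
    · exact contDiffOn_const.mul (hSs 1)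
    · exact contDiffOn_const.mul (hSs 2)
  -- On the open hemisphere around the pole the graph coordinates determine the point of the sphere,
  -- the height being the positive root.
  have hWc : IsOpen (Wb ∩ (fun y => S y 0) ⁻¹' Set.Ioi 0) :=
    (hSs 0).continuousOn.isOpen_inter_preimage hWb isOpen_Ioi
  set Wc := Wb ∩ (fun y => S y 0) ⁻¹' Set.Ioi 0 with hWcdef
  have hcb : Wc ⊆ Wb := Set.inter_subset_left
  have hyc : y₀ ∈ Wc := ⟨hyb, by simp [hS0]⟩
  have hu0 : ∀ y, u y 0 = r * S y 1 := fun y => rfl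
  have hu1 : ∀ y, u y 1 = r * S y 2 := fun y => rfl
  have hnorm : ∀ y ∈ Wc, S y 0 ^ 2 + S y 1 ^ 2 + S y 2 ^ 2 = 1 := fun y hy => by
    have := (hS y (hcb hy)).2
    rwa [Fin.sum_univ_three] at this
  have hudisk : Set.MapsTo u Wc (disk r) := fun y hy => by
    have h1 := hnorm y hy
    have h2 : 0 < S y 0 := hy.2
    simp only [disk, Set.mem_ofPred_eq, hu0, hu1]
    have h3 : 0 < r ^ 2 * S y 0 ^ 2 := by positivity
    nlinarith
  have hsph : ∀ y ∈ Wc, sph r (u y) = S y := fun y hy => by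
    have h1 := hnorm y hy
    have h2 : 0 < S y 0 := hy.2
    have h3 : height r (u y) = S y 0 := by
      rw [height, hu0, hu1]
      have : 1 - ((r * S y 1) ^ 2 + (r * S y 2) ^ 2) / r ^ 2 = S y 0 ^ 2 := by
        field_simp
        linarith
      rw [this, Real.sqrt_sq h2.le]
    ext k
    fin_cases k
    · exact h3
    · simp [sph, hu0, hr.ne']
    · simp [sph, hu1, hr.ne']
  let φ : E 6 → E 6 := fun y => glue (X y) (u y)
  have hφs : ContDiffOn ℝ ∞ φ Wc := contDiffOn_glue (hXs.mono hcb) (hus.mono hcb)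
  have hφ0 : φ y₀ = 0 := by
    have hu00 : u y₀ = 0 := by
      ext α
      fin_cases α
      · simp [hu0, hS0]
      · simp [hu1, hS0]
    simp only [φ, hX0, hu00]
    have := glue_px_pu 0
    rwa [px_zero, pu_zero] at this
  have hWd : IsOpen (Wc ∩ φ ⁻¹' W₁) := hφs.continuousOn.isOpen_inter_preimage hWc hW₁
  have hyd : y₀ ∈ Wc ∩ φ ⁻¹' W₁ := ⟨hyc, by rw [Set.mem_preimage, hφ0]; exact h0W₁⟩
  have hKF : ∀ y ∈ Wc, K y * F (X y) = F (X y) * jmat (sph r (u y)) := fun y hy => by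
    rw [hsph y hy]; exact (hS y (hcb hy)).1
  have hlift : ∀ y ∈ Wc, Ψ y = lift g ψ F r (φ y) := fun y hy => by
    have hpx : px (φ y) = X y := px_glue _ _
    have hpu : pu (φ y) = u y := pu_glue _ _
    refine endBundle_ext ?_ ?_
    · rw [hrep.proj y (hcb hy), ← hpx]; rfl
    · have hXU := hF.subset (hmV (hcb hy))
      refine comp_dmap_injective hpar hXU ?_
      have h1 := lift_comp_dmap (g := g) (F := F) (r := r) (y := φ y) hpar (by rw [hpx]; exact hXU)
      rw [hpx] at h1
      rw [hrep.endo y (hcb hy), h1]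
      congr 2
      rw [liftMat, hpx, hpu, ← hKF y hy, mul_assoc, hF.mul_inv (hmV (hcb hy)), mul_one]
  refine ⟨Wc ∩ φ ⁻¹' W₁, φ, hyd, hφ0, hWd, hφs.mono Set.inter_subset_left, fun y hy => hy.2,
    fun y hy => ?_, fun y hy => ?_⟩
  · have hφd : DifferentiableAt ℝ φ y :=
      (hφs.contDiffAt (hWc.mem_nhds hy.1)).differentiableAt (by simp)
    refine det_jac_ne_zero hφd ?_
    -- The change of coordinates is immersive because `Ψ` factors through it; equality of dimensions
    -- makes the Jacobian invertible.
    have hld : MDifferentiableAt (𝓡 6) endModel (lift g ψ F r) (φ y) :=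
      (((isRep_lift hr hpar hF).contMDiffOn hpar).contMDiffAt
        ((isOpen_boxSet hF.isOpen (isOpen_disk r)).mem_nhds (hsub hy.2))).mdifferentiableAt (by simp)
    have heq : Ψ =ᶠ[𝓝 y] lift g ψ F r ∘ φ :=
      Filter.eventuallyEq_of_mem (hWc.mem_nhds hy.1) hlift
    have hinj := hΨ.immersive y hy.1.1.1.1
    rw [heq.mfderiv_eq, mfderiv_comp y hld hφd.mdifferentiableAt, mfderiv_eq_fderiv] at hinj
    exact Function.Injective.of_comp hinj
  · exact pullbackCoeff_twistorMetric hr hpar hF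
      ⟨hWc, hXs.mono hcb, fun y hy => hF.subset (hmV (hcb hy)), hrep.smooth_mat.mono hcb,
        fun y hy => hrep.proj y (hcb hy), fun y hy => hrep.endo y (hcb hy)⟩
      (fun y hy => hmV (hcb hy)) (hus.mono hcb) hudisk hKF hy.1

end IsTwistorChart

end TwistorChart

/-! ## The curvature tensor in orthonormal frames -/

section Tensor

/-- The algebraic symmetries of a Riemannian curvature tensor. -/
structure IsCurvTensor (R : Fin 4 → Fin 4 → Fin 4 → Fin 4 → ℝ) : Prop where
  skew : ∀ i j k l, R j i k l = -R i j k l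
  skew' : ∀ i j k l, R i j l k = -R i j k l
  pair : ∀ i j k l, R k l i j = R i j k l
  bianchi : ∀ i j k l, R i j k l + R j k i l + R k i j l = 0

/-- The curvature of the bundle of anti-self-dual two-vectors. -/
def asdCurv (R : Fin 4 → Fin 4 → Fin 4 → Fin 4 → ℝ) (i j : Fin 4) : Fin 3 → ℝ :=
  ![R i j 0 1 - R i j 2 3, R i j 0 2 - R i j 3 1, R i j 0 3 - R i j 1 2]

end Tensor

section Riem

variable {M : Type u} [TopologicalSpace M] [ChartedSpace (E 4) M] [IsManifold (𝓡 4) ∞ M]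
  (g : Metric M)

/-- The curvature operator on coordinate vectors. -/
def curvOp (p : M) (x y z : E 4) : E 4 := curvature g p x y z

theorem curvOp_apply (p : M) (x y z : E 4) (l : Fin 4) : curvOp g p x y z l =
    - ∑ i, ∑ j, ∑ k, curvatureCoeff (chartCoeff g p) l i j k (chartAt (E 4) p p) *
      x i * y j * z k := rfl

theorem curvOp_linear₁ (p : M) (y z : E 4) : IsLinearMap ℝ (fun x => curvOp g p x y z) := by
  constructor
  · intro x x'
    ext l
    rw [PiLp.add_apply, curvOp_apply, curvOp_apply, curvOp_apply]
    simp only [PiLp.add_apply, mul_add, add_mul, Finset.sum_add_distrib, neg_add]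
  · intro c x
    ext l
    rw [PiLp.smul_apply, curvOp_apply, curvOp_apply]
    simp only [PiLp.smul_apply, smul_eq_mul, mul_neg, Finset.mul_sum]
    congr 1
    exact Finset.sum_congr rfl fun i _ => Finset.sum_congr rfl fun j _ =>
      Finset.sum_congr rfl fun k _ => by ring

theorem curvOp_linear₂ (p : M) (x z : E 4) : IsLinearMap ℝ (fun y => curvOp g p x y z) := by
  constructor
  · intro y y'
    ext l
    rw [PiLp.add_apply, curvOp_apply, curvOp_apply, curvOp_apply]
    simp only [PiLp.add_apply, mul_add, add_mul, Finset.sum_add_distrib, neg_add]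
  · intro c y
    ext l
    rw [PiLp.smul_apply, curvOp_apply, curvOp_apply]
    simp only [PiLp.smul_apply, smul_eq_mul, mul_neg, Finset.mul_sum]
    congr 1
    exact Finset.sum_congr rfl fun i _ => Finset.sum_congr rfl fun j _ =>
      Finset.sum_congr rfl fun k _ => by ring

theorem curvOp_linear₃ (p : M) (x y : E 4) : IsLinearMap ℝ (fun z => curvOp g p x y z) := by
  constructor
  · intro z z'
    ext l
    rw [PiLp.add_apply, curvOp_apply, curvOp_apply, curvOp_apply]
    simp only [PiLp.add_apply, mul_add, Finset.sum_add_distrib, neg_add]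
  · intro c z
    ext l
    rw [PiLp.smul_apply, curvOp_apply, curvOp_apply]
    simp only [PiLp.smul_apply, smul_eq_mul, mul_neg, Finset.mul_sum]
    congr 1
    exact Finset.sum_congr rfl fun i _ => Finset.sum_congr rfl fun j _ =>
      Finset.sum_congr rfl fun k _ => by ring

theorem curvOp_sum₁ (p : M) (c : Fin 4 → ℝ) (v : Fin 4 → E 4) (y z : E 4) :
    curvOp g p (∑ a, c a • v a) y z = ∑ a, c a • curvOp g p (v a) y z := by
  exact (map_sum (curvOp_linear₁ g p y z).mk' (fun a => c a • v a) Finset.univ).trans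
    (Finset.sum_congr rfl fun a _ => (curvOp_linear₁ g p y z).map_smul (c a) (v a))

theorem curvOp_sum₂ (p : M) (c : Fin 4 → ℝ) (v : Fin 4 → E 4) (x z : E 4) :
    curvOp g p x (∑ a, c a • v a) z = ∑ a, c a • curvOp g p x (v a) z := by
  exact (map_sum (curvOp_linear₂ g p x z).mk' (fun a => c a • v a) Finset.univ).trans
    (Finset.sum_congr rfl fun a _ => (curvOp_linear₂ g p x z).map_smul (c a) (v a))

theorem curvOp_sum₃ (p : M) (c : Fin 4 → ℝ) (v : Fin 4 → E 4) (x y : E 4) :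
    curvOp g p x y (∑ a, c a • v a) = ∑ a, c a • curvOp g p x y (v a) := by
  exact (map_sum (curvOp_linear₃ g p x y).mk' (fun a => c a • v a) Finset.univ).trans
    (Finset.sum_congr rfl fun a _ => (curvOp_linear₃ g p x y).map_smul (c a) (v a))

/-- The Ricci tensor on coordinate vectors. -/
def ricForm (p : M) (x y : E 4) : ℝ := ricci g p x y

theorem ricForm_sum (p : M) (c d : Fin 4 → ℝ) (v : Fin 4 → E 4) :
    ricForm g p (∑ a, c a • v a) (∑ a, d a • v a) = ∑ a, ∑ b, c a * d b * ricForm g p (v a) (v b) := by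
  have h : ∀ x y : E 4, ricForm g p x y =
    ∑ i, ∑ j, ricciCoeff (chartCoeff g p) i j (chartAt (E 4) p p) * x i * y j := fun x y => rfl
  have h₁ : ∀ y : E 4, IsLinearMap ℝ (fun x => ricForm g p x y) := fun y => by
    constructor
    · intro x x'
      simp only [h, PiLp.add_apply, mul_add, add_mul, Finset.sum_add_distrib]
    · intro c x
      simp only [h, PiLp.smul_apply, smul_eq_mul, Finset.mul_sum]
      exact Finset.sum_congr rfl fun i _ => Finset.sum_congr rfl fun j _ => by ring
  have h₂ : ∀ x : E 4, IsLinearMap ℝ (fun y => ricForm g p x y) := fun x => by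
    constructor
    · intro y y'
      simp only [h, PiLp.add_apply, mul_add, Finset.sum_add_distrib]
    · intro c y
      simp only [h, PiLp.smul_apply, smul_eq_mul, Finset.mul_sum]
      exact Finset.sum_congr rfl fun i _ => Finset.sum_congr rfl fun j _ => by ring
  have e₁ : ∀ y, ricForm g p (∑ a, c a • v a) y = ∑ a, c a * ricForm g p (v a) y := fun y => by
    exact (map_sum (h₁ y).mk' (fun a => c a • v a) Finset.univ).trans
      (Finset.sum_congr rfl fun a _ => (h₁ y).map_smul (c a) (v a))
  have e₂ : ∀ x, ricForm g p x (∑ a, d a • v a) = ∑ a, d a * ricForm g p x (v a) := fun x => by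
    exact (map_sum (h₂ x).mk' (fun a => d a • v a) Finset.univ).trans
      (Finset.sum_congr rfl fun a _ => (h₂ x).map_smul (d a) (v a))
  rw [e₁]
  simp only [e₂, Finset.mul_sum, mul_assoc]

/-- The components of the curvature tensor. -/
def rm (p : M) (v : Fin 4 → E 4) (i j k l : Fin 4) : ℝ :=
  gform g p (curvOp g p (v i) (v j) (v k)) (v l)

variable {g} {o : ManifoldOrientation M} {ψ : E 4 → M} {U V : Set (E 4)}
  {F : E 4 → Matrix (Fin 4) (Fin 4) ℝ} {p : M}

namespace IsTwistorChart

/-- The sign comes from the convention `R(X, Y) = ∇_{[X, Y]} - [∇_X, ∇_Y]`. With the order of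
indices in `rm`, sectional curvatures are the components `rm i j i j`. -/
theorem rm_eq {b : Fin 4 → E 4} (h : IsTwistorChart g o p b ψ U V F) (i j k l : Fin 4) :
    rm g p b i j k l = -curvM (baseMetric g ψ) i j 0 l k := by
  obtain rfl := h.normal.map_zero
  have h1 : curvOp g (ψ 0) (b i) (b j) (b k) =
      -∑ m, curvM (baseMetric g ψ) i j 0 m k • dmap ψ 0 (e m) := by
    rw [← curvature_dmap g h.normal.param h.normal.zero_mem, h.normal.dmap_zero,
      h.normal.dmap_zero, h.normal.dmap_zero]
    rfl
  have h2 : ∀ m, gform g (ψ 0) (dmap ψ 0 (e m)) (b l) = if m = l then 1 else 0 := fun m => by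
    rw [← h.normal.dmap_zero l, ← baseMetric_apply, h.normal.metric_one, Matrix.one_apply]
  rw [rm, h1]
  simp [h2]

theorem ric_eq {b : Fin 4 → E 4} (h : IsTwistorChart g o p b ψ U V F) (i j : Fin 4) :
    ricForm g p (b i) (b j) = ricciCoeff (baseMetric g ψ) i j 0 := by
  obtain rfl := h.normal.map_zero
  rw [← ricci_dmap g h.normal.param h.normal.zero_mem, h.normal.dmap_zero, h.normal.dmap_zero]
  rfl

end IsTwistorChart

variable {b : Module.Basis (Fin 4) ℝ (E 4)}

/-- In a normal parametrization the curvature is a combination of second derivatives of the metric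
coefficients. All symmetries, including Bianchi's, follow from symmetry in the derivatives and
symmetry of the metric. -/
theorem IsFrame.isCurvTensor (hb : IsFrame g o p b) : IsCurvTensor (rm g p b) := by
  obtain ⟨ψ, U, V, F, h⟩ := exists_isTwistorChart g o hb
  have hG := baseMetric_isMetricOn g h.normal.param
  have h0 := h.normal.zero_mem
  have hf := hG.curvM_of_flat_jet h0 h.normal.metric_one h.normal.metric_flat
  have hs := hG.pderiv2_symm h0
  have hc : ∀ i j a b, pderiv i (pderiv j fun y => baseMetric g ψ y a b) 0 =
      pderiv j (pderiv i fun y => baseMetric g ψ y a b) 0 := fun i j a b =>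
    pderiv_comm hG.isOpen (hG.smooth a b) h0 i j
  constructor
  · intro i j k l
    rw [h.rm_eq, h.rm_eq, hf, hf]; ring
  · intro i j k l
    rw [h.rm_eq, h.rm_eq, hf, hf]; ring
  · intro i j k l
    rw [h.rm_eq, h.rm_eq, hf, hf, hc k j l i, hc k i l j, hc l j k i, hc l i k j, hs j k l i,
      hs i k l j, hs j l k i, hs i l k j]
    ring
  · intro i j k l
    rw [h.rm_eq, h.rm_eq, h.rm_eq, hf, hf, hf, hc i k j l, hc j k i l, hc i j k l,
      hs k i j l]
    rw [hs i l j k, hs j l i k, hs j l k i, hs k l j i, hs k l i j, hs i l k j]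
    ring

theorem IsFrame.ric_eq (hb : IsFrame g o p b) (i j : Fin 4) :
    ricForm g p (b i) (b j) = ∑ a, rm g p b a i a j := by
  obtain ⟨ψ, U, V, F, h⟩ := exists_isTwistorChart g o hb
  rw [h.ric_eq, ricciCoeff_eq]
  refine Finset.sum_congr rfl fun a _ => ?_
  rw [← neg_neg (curvM (baseMetric g ψ) a i 0 a j), ← h.rm_eq, hb.isCurvTensor.skew' a i a j]
  ring

theorem IsFrame.scalarCurvature_eq (hb : IsFrame g o p b) :
    scalarCurvature g p = ∑ i, ricForm g p (b i) (b i) := by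
  obtain ⟨ψ, U, V, F, h⟩ := exists_isTwistorChart g o hb
  obtain rfl := h.normal.map_zero
  rw [scalarCurvature_param g h.normal.param h.normal.zero_mem, h.normal.metric_one, inv_one]
  simp only [h.ric_eq, Matrix.one_apply]
  simp

end Riem

/-! ### Curvature of Λ²₋ in a frame and its divergence -/

section FrameCurv

variable {U V : Set (E 4)} {G F : E 4 → Matrix (Fin 4) (Fin 4) ℝ}

/-- The curvature matrices in the orthonormal frame with coefficients `F`. -/
def frameCurv (G F : E 4 → Matrix (Fin 4) (Fin 4) ℝ) (i j : Fin 4) (x : E 4) :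
    Matrix (Fin 4) (Fin 4) ℝ :=
  mpd i (frameConn G F j) x - mpd j (frameConn G F i) x +
    frameConn G F i x * frameConn G F j x - frameConn G F j x * frameConn G F i x

/-- The frame is a gauge transformation from the coordinate connection to the frame connection, so
`gauge_curvature` applies. -/
theorem IsOrthoFrame.frameCurv_eq (h : IsOrthoFrame U V G F) {x : E 4} (hx : x ∈ V) (i j : Fin 4) :
    frameCurv G F i j x = (F x).transpose * G x * curvM G i j x * F x := by
  have h1 := gauge_curvature h.isOpen hx h.smooth
    (fun i => (h.metric.gam_smooth i).mono h.subset) h.frameConn_smooth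
    (fun y hy i => by rw [h.mul_frameConn hy, add_comm]) i j
  rw [← curvM_eq] at h1
  have h2 := congrArg (fun A => (F x).transpose * G x * A) h1
  simp only [← mul_assoc, h.orthonormal x hx, one_mul] at h2
  exact h2

theorem pderiv_asd {A : E 4 → Matrix (Fin 4) (Fin 4) ℝ} {x : E 4}
    (hA : ∀ a b, DifferentiableAt ℝ (fun y => A y a b) x) (i : Fin 4) (k : Fin 3) :
    pderiv i (fun y => asd (A y) k) x = asd (mpd i A x) k := by
  fin_cases k
  · exact pderiv_sub i (hA 3 2) (hA 1 0)
  · exact pderiv_sub i (hA 1 3) (hA 2 0)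
  · exact pderiv_sub i (hA 2 1) (hA 3 0)

theorem asd_sub (A B : Matrix (Fin 4) (Fin 4) ℝ) (k : Fin 3) :
    asd (A - B) k = asd A k - asd B k := by
  fin_cases k <;> simp [asd] <;> ring

variable {M : Type u} [TopologicalSpace M] [ChartedSpace (E 4) M] [IsManifold (𝓡 4) ∞ M]
  {g : Metric M} {o : ManifoldOrientation M} {ψ : E 4 → M} {p : M} {b : Fin 4 → E 4}

namespace IsTwistorChart

variable (h : IsTwistorChart g o p b ψ U V F)
include h

/-- The two form indices are expressed through the dual coframe `(F x)ᵀ G`. The identity is proved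
on all of `V` and not only at the origin, since the divergence computation differentiates it. -/
theorem asd_frameCurv {x : E 4} (hx : x ∈ V) (i j : Fin 4) (k : Fin 3) :
    asd (frameCurv (baseMetric g ψ) F i j x) k =
      ∑ a, ∑ b, ((F x).transpose * baseMetric g ψ x) a i *
        ((F x).transpose * baseMetric g ψ x) b j * asdCurv (rm g (ψ x) (frameVec ψ F x)) a b k := by
  obtain ⟨b', hb', e'⟩ := h.oriented x hx
  have hpar := h.normal.param
  have hxU := h.subset hx
  set η := (F x).transpose * baseMetric g ψ x with hη
  have hGs : ∀ a c, baseMetric g ψ x a c = baseMetric g ψ x c a :=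
    (baseMetric_isMetricOn g hpar).symm x hxU
  have hv : ∀ a l, gform g (ψ x) (dmap ψ x (e a)) (frameVec ψ F x l) = η l a := fun a l => by
    rw [hη, Matrix.mul_apply, frameVec, map_sum]
    refine Finset.sum_congr rfl fun c _ => ?_
    rw [map_smul, ← baseMetric_apply, hGs a c]
    rfl
  have hexp : ∀ a, dmap ψ x (e a) = ∑ l, η l a • frameVec ψ F x l := fun a => by
    conv_lhs => rw [hb'.expand (dmap ψ x (e a))]
    refine Finset.sum_congr rfl fun l _ => ?_
    rw [e', hv]
  have hcurv : ∀ l m, (η * curvM (baseMetric g ψ) i j x * F x) l m =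
      -∑ a, ∑ c, η a i * η c j * rm g (ψ x) (frameVec ψ F x) a c m l := fun l m => by
    have h1 : curvOp g (ψ x) (dmap ψ x (e i)) (dmap ψ x (e j)) (frameVec ψ F x m) =
        ∑ d, F x d m • -∑ c, curvM (baseMetric g ψ) i j x c d • dmap ψ x (e c) := by
      rw [frameVec, curvOp_sum₃]
      exact Finset.sum_congr rfl fun d _ => by rw [← curvature_dmap g hpar hxU]; rfl
    have h2 : gform g (ψ x) (curvOp g (ψ x) (dmap ψ x (e i)) (dmap ψ x (e j))
        (frameVec ψ F x m)) (frameVec ψ F x l) =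
        -(η * curvM (baseMetric g ψ) i j x * F x) l m := by
      rw [h1]
      simp only [map_sum, map_smul, map_neg, FunLike.coe_sum, Finset.sum_apply, FunLike.coe_smul,
        Pi.smul_apply, FunLike.coe_neg, Pi.neg_apply, smul_eq_mul, hv, Matrix.mul_apply,
        Finset.sum_mul, Finset.mul_sum, mul_neg, Finset.sum_neg_distrib]
      congr 1
      exact Finset.sum_congr rfl fun d _ => Finset.sum_congr rfl fun c _ => by ring
    rw [← neg_neg ((η * curvM (baseMetric g ψ) i j x * F x) l m), ← h2, hexp i, hexp j, curvOp_sum₁]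
    simp only [curvOp_sum₂, map_sum, map_smul, FunLike.coe_sum, Finset.sum_apply, FunLike.coe_smul,
        Pi.smul_apply, smul_eq_mul, Finset.mul_sum, mul_assoc]
    rfl
  rw [h.isOrthoFrame.frameCurv_eq hx, ← hη, asd, hcurv, hcurv, hcurv, hcurv, hcurv, hcurv]
  simp only [asdCurv]
  fin_cases k <;> simp [mul_sub, Finset.sum_sub_distrib, Finset.sum_add_distrib, sub_eq_add_neg,
    mul_add] <;> ring

theorem mpd_frameConn (i j : Fin 4) (k : Fin 3) :
    pderiv i (fun x => frameForm (baseMetric g ψ) F j x k) 0 =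
      asd (mpd i (frameConn (baseMetric g ψ) F j) 0) k :=
  pderiv_asd ((h.isOrthoFrame.frameConn_smooth j).diffAt h.frame.isOpen h.frame.zero_mem) i k

/-- The frame connection vanishes at the origin, so its curvature there is its exterior derivative.
This brings the curvature of `M` into the Ricci tensor of the bundle metric. -/
theorem dConn_frameForm (k : Fin 3) (i j : Fin 4) :
    dConn (frameForm (baseMetric g ψ) F) k i j = asdCurv (rm g p b) i j k := by
  have h1 := h.asd_frameCurv h.frame.zero_mem i j k
  have h2 : frameVec ψ F 0 = b := funext h.frameVec_zero
  have h3 : (F 0).transpose * baseMetric g ψ 0 = 1 := by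
    rw [h.frame.zero, h.normal.metric_one, Matrix.transpose_one, one_mul]
  rw [h2, h3, h.normal.map_zero, frameCurv, h.frameConn_zero, h.frameConn_zero] at h1
  rw [dConn, h.mpd_frameConn, h.mpd_frameConn, ← asd_sub]
  simpa [Matrix.one_apply] using h1

/-- If the curvature of the bundle of anti-self-dual two-vectors is that of a space of constant
curvature, then it is parallel to first order. -/
theorem divergence_frameForm {κ : ℝ} (hκ : ∀ x ∈ V, ∀ a b k,
    asdCurv (rm g (ψ x) (frameVec ψ F x)) a b k = κ * jmat (Pi.single k 1) b a)
    (a b : Fin 4) (k : Fin 3) :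
    pderiv a (pderiv b fun x => frameForm (baseMetric g ψ) F a x k) 0 -
      pderiv a (pderiv a fun x => frameForm (baseMetric g ψ) F b x k) 0 = 0 := by
  have hF := h.isOrthoFrame
  have h0 := h.frame.zero_mem
  have hV := h.frame.isOpen
  have hA := hF.frameConn_smooth
  have h1 : ∀ i j, pderiv a (pderiv i fun x => frameForm (baseMetric g ψ) F j x k) 0 =
      asd (mpd a (mpd i (frameConn (baseMetric g ψ) F j)) 0) k := fun i j => by
    rw [← pderiv_asd (((hA j).mpd hV i).diffAt hV h0)]
    exact pderiv_congr_on hV h0 a fun y hy => pderiv_asd ((hA j).diffAt hV hy) i k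
  have h2 : mpd a (frameCurv (baseMetric g ψ) F b a) 0 =
      mpd a (mpd b (frameConn (baseMetric g ψ) F a)) 0 -
        mpd a (mpd a (frameConn (baseMetric g ψ) F b)) 0 := by
    have e1 := ((hA a).mpd hV b)
    have e2 := ((hA b).mpd hV a)
    have e3 := (hA b).mul (hA a)
    have e4 := (hA a).mul (hA b)
    unfold frameCurv
    rw [mpd_sub a (((e1.sub e2).add e3).diffAt hV h0) (e4.diffAt hV h0),
      mpd_add a ((e1.sub e2).diffAt hV h0) (e3.diffAt hV h0),
      mpd_sub a (e1.diffAt hV h0) (e2.diffAt hV h0),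
      mpd_mul a ((hA b).diffAt hV h0) ((hA a).diffAt hV h0),
      mpd_mul a ((hA a).diffAt hV h0) ((hA b).diffAt hV h0), h.frameConn_zero, h.frameConn_zero]
    simp
  have hcs : MatSmooth V (frameCurv (baseMetric g ψ) F b a) :=
    ((((hA a).mpd hV b).sub ((hA b).mpd hV a)).add ((hA b).mul (hA a))).sub ((hA a).mul (hA b))
  have hGV := hF.metric.smooth.mono hF.subset
  let η : E 4 → Matrix (Fin 4) (Fin 4) ℝ := fun x => (F x).transpose * baseMetric g ψ x
  have hη : MatSmooth V η := hF.smooth.transpose.mul hGV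
  -- Both the frame and the metric are standard to first order, hence so is the dual coframe.
  have hη0 : mpd a η 0 = 0 := by
    rw [mpd_mul a (hF.smooth.transpose.diffAt hV h0) (hGV.diffAt hV h0), mpd_transpose,
      h.frame.flat, h.normal.metric_flat]
    simp
  have hdη : ∀ c d, pderiv a (fun x => η x c d) 0 = 0 := fun c d =>
    congrFun (congrFun hη0 c) d
  -- Near the origin the curvature is a constant form evaluated on the coframe, whose first
  -- derivative vanishes at the origin. So the derivative of the curvature vanishes there as well.
  rw [h1, h1, ← asd_sub, ← h2, ← pderiv_asd (hcs.diffAt hV h0),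
    pderiv_congr_on hV h0 a (h := fun x => ∑ c, ∑ d, κ * jmat (Pi.single k 1) d c *
      (η x c b * η x d a)) fun x hx => by
      rw [h.asd_frameCurv hx]
      refine Finset.sum_congr rfl fun c _ => Finset.sum_congr rfl fun d _ => ?_
      rw [hκ x hx]
      ring]
  have hd := hη.diffAt hV h0
  rw [pderiv_sum]
  · refine Finset.sum_eq_zero fun c _ => ?_
    rw [pderiv_sum]
    · refine Finset.sum_eq_zero fun d _ => ?_
      have hdd : DifferentiableAt ℝ (fun x => η x c b * η x d a) 0 := (hd c b).mul (hd d a)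
      refine (pderiv_const_mul a _ hdd).trans ?_
      rw [pderiv_mul _ (hd c b) (hd d a), hdη, hdη]
      ring
    · exact fun d _ => ((hd c b).mul (hd d a)).const_mul _
  · exact fun c _ => DifferentiableAt.fun_sum fun d _ => ((hd c b).mul (hd d a)).const_mul _

end IsTwistorChart

end FrameCurv

/-! ## Algebra of the Einstein equations -/

section TwoForms

/-- The anti-self-dual components of a skew matrix. -/
def asdPart (θ : Fin 4 → Fin 4 → ℝ) : Fin 3 → ℝ :=
  ![(θ 0 1 - θ 2 3) / 2, (θ 0 2 - θ 3 1) / 2, (θ 0 3 - θ 1 2) / 2]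

/-- The self-dual components of a skew matrix. -/
def sdPart (θ : Fin 4 → Fin 4 → ℝ) : Fin 3 → ℝ :=
  ![(θ 0 1 + θ 2 3) / 2, (θ 0 2 + θ 3 1) / 2, (θ 0 3 + θ 1 2) / 2]

variable {θ η : Fin 4 → Fin 4 → ℝ}

theorem skew_rules (hθ : ∀ i j, θ j i = -θ i j) : θ 0 0 = 0 ∧ θ 1 1 = 0 ∧ θ 2 2 = 0 ∧ θ 3 3 = 0 ∧
    θ 1 0 = -θ 0 1 ∧ θ 2 0 = -θ 0 2 ∧ θ 3 0 = -θ 0 3 ∧ θ 2 1 = -θ 1 2 ∧ θ 1 3 = -θ 3 1 ∧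
    θ 3 2 = -θ 2 3 := by
  have h := fun i => hθ i i
  exact ⟨by linarith [h 0], by linarith [h 1], by linarith [h 2], by linarith [h 3], hθ _ _,
    hθ _ _, hθ _ _, hθ _ _, hθ _ _, hθ _ _⟩

/-- The mixed products of the components are determined by the square of a skew matrix. -/
theorem asdPart_mul_sdPart (hθ : ∀ i j, θ j i = -θ i j) (hη : ∀ i j, η j i = -η i j)
    (h : ∀ b d, ∑ a, θ b a * θ d a = ∑ a, η b a * η d a) (i j : Fin 3) :
    asdPart θ i * sdPart θ j = asdPart η i * sdPart η j := by
  obtain ⟨p0, p1, p2, p3, p4, p5, p6, p7, p8, p9⟩ := skew_rules hθ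
  obtain ⟨q0, q1, q2, q3, q4, q5, q6, q7, q8, q9⟩ := skew_rules hη
  have h00 := h 0 0
  have h11 := h 1 1
  have h22 := h 2 2
  have h33 := h 3 3
  have h01 := h 0 1
  have h02 := h 0 2
  have h03 := h 0 3
  have h12 := h 1 2
  have h13 := h 1 3
  have h23 := h 2 3
  simp only [Fin.sum_univ_four, p0, p1, p2, p3, p4, p5, p6, p7, p8, p9, q0, q1, q2, q3, q4, q5,
    q6, q7, q8, q9] at h00 h11 h22 h33 h01 h02 h03 h12 h13 h23
  fin_cases i <;> fin_cases j <;> simp [asdPart, sdPart] <;> linarith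

theorem sum_mul_eq (hθ : ∀ i j, θ j i = -θ i j) (hη : ∀ i j, η j i = -η i j) :
    ∑ a, ∑ c, θ a c * η a c = 4 * (∑ i, asdPart θ i * asdPart η i + ∑ i, sdPart θ i * sdPart η i) := by
  obtain ⟨p0, p1, p2, p3, p4, p5, p6, p7, p8, p9⟩ := skew_rules hθ
  obtain ⟨q0, q1, q2, q3, q4, q5, q6, q7, q8, q9⟩ := skew_rules hη
  simp only [Fin.sum_univ_four, Fin.sum_univ_three, p0, p1, p2, p3, p4, p5, p6, p7, p8, p9, q0, q1,
    q2, q3, q4, q5, q6, q7, q8, q9]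
  simp [asdPart, sdPart]
  ring

/-- The square of a skew matrix whose mixed products vanish is a multiple of the identity. -/
theorem sum_mul_of_mixed_eq_zero (hθ : ∀ i j, θ j i = -θ i j)
    (h : ∀ i j, asdPart θ i * sdPart θ j = 0) (b d : Fin 4) :
    ∑ a, θ b a * θ d a = if b = d then ∑ i, asdPart θ i ^ 2 + ∑ i, sdPart θ i ^ 2 else 0 := by
  obtain ⟨p0, p1, p2, p3, p4, p5, p6, p7, p8, p9⟩ := skew_rules hθ
  have h00 := h 0 0
  have h01 := h 0 1
  have h02 := h 0 2
  have h10 := h 1 0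
  have h11 := h 1 1
  have h12 := h 1 2
  have h20 := h 2 0
  have h21 := h 2 1
  have h22 := h 2 2
  simp [asdPart, sdPart] at h00 h01 h02 h10 h11 h12 h20 h21 h22
  simp only [← mul_eq_zero] at h00 h01 h02 h10 h11 h12 h20 h21 h22
  simp only [Fin.sum_univ_four, Fin.sum_univ_three]
  fin_cases b <;> fin_cases d <;>
    simp [asdPart, sdPart, p0, p1, p2, p3, p4, p5, p6, p7, p8, p9] <;> linarith

/-- Two pairs of vectors with the same tensor product and opposite inner products. -/
theorem mul_eq_zero_of_tensor {x y x' y' : Fin 3 → ℝ} (h : ∀ i j, x i * y j = x' i * y' j)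
    (h0 : ∑ i, x i * x' i + ∑ i, y i * y' i = 0) (i j : Fin 3) : x i * y j = 0 := by
  by_contra hne
  have hx : x i ≠ 0 := left_ne_zero_of_mul hne
  have hy : y j ≠ 0 := right_ne_zero_of_mul hne
  have hne' : x' i * y' j ≠ 0 := h i j ▸ hne
  have hx' : x' i ≠ 0 := left_ne_zero_of_mul hne'
  have hy' : y' j ≠ 0 := right_ne_zero_of_mul hne'
  -- Contractions of the tensor identity with `x'` and with `y'`. They express both inner products
  -- through the squared norms of `x'` and `y'`.
  have e1 : y j * ∑ k, x k * x' k = y' j * ∑ k, x' k ^ 2 := by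
    rw [Finset.mul_sum, Finset.mul_sum]
    exact Finset.sum_congr rfl fun k _ => by linear_combination x' k * h k j
  have e2 : x i * ∑ k, y k * y' k = x' i * ∑ k, y' k ^ 2 := by
    rw [Finset.mul_sum, Finset.mul_sum]
    exact Finset.sum_congr rfl fun k _ => by linear_combination y' k * h i k
  have hX : 0 < ∑ k, x' k ^ 2 := Finset.sum_pos' (fun k _ => sq_nonneg _)
    ⟨i, Finset.mem_univ _, by positivity⟩
  have hY : 0 < ∑ k, y' k ^ 2 := Finset.sum_pos' (fun k _ => sq_nonneg _)
    ⟨j, Finset.mem_univ _, by positivity⟩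
  have e3 : (x i * x' i) * (y' j ^ 2 * ∑ k, x' k ^ 2) + (y j * y' j) * (x' i ^ 2 * ∑ k, y' k ^ 2) =
      0 := by
    linear_combination (-(x i * x' i * y' j)) * e1 - (y j * y' j * x' i) * e2 +
      (x i * x' i * y' j * y j) * h0
  -- The factors `x i * x' i` and `y j * y' j` have the same sign, their product being `(x i * y j)
  -- ^ 2`. Then `e3` is a vanishing sum of two non-zero terms of equal sign.
  have e4 : 0 < (x i * x' i) * (y j * y' j) := by
    have : (x i * x' i) * (y j * y' j) = (x i * y j) ^ 2 := by
      linear_combination -(x i * y j) * h i j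
    rw [this]; positivity
  have h1 : 0 < y' j ^ 2 * ∑ k, x' k ^ 2 := by positivity
  have h2 : 0 < x' i ^ 2 * ∑ k, y' k ^ 2 := by positivity
  rcases mul_pos_iff.1 e4 with ⟨ha, hb⟩ | ⟨ha, hb⟩
  · linarith [mul_pos ha h1, mul_pos hb h2]
  · linarith [mul_neg_of_neg_of_pos ha h1, mul_neg_of_neg_of_pos hb h2]

end TwoForms

section Symmetric

/-- A symmetric matrix of order three whose square is scalar and whose trace is large is scalar. -/
theorem eq_smul_one_of_sq {A : Matrix (Fin 3) (Fin 3) ℝ} {q t : ℝ} (ht : 0 < t)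
    (hA : A * A = q • (1 : Matrix (Fin 3) (Fin 3) ℝ)) (htr : A.trace = 1 / t + 2 * t * q)
    (hq : 0 ≤ q) :
    ∃ κ : ℝ, A = κ • (1 : Matrix (Fin 3) (Fin 3) ℝ) := by
  set τ := A.trace with hτ
  set s := (τ ^ 2 - (A * A).trace) / 2 with hs
  -- Cayley-Hamilton in order three. Once `A * A` is scalar it becomes linear: `(q + s) A` is
  -- scalar, and it remains to see that `q + s` is not zero.
  have hch : A * A * A - τ • (A * A) + s • A = A.det • (1 : Matrix (Fin 3) (Fin 3) ℝ) := by
    ext i j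
    simp only [hs, hτ, Matrix.det_fin_three, Matrix.trace, Matrix.diag, Fin.sum_univ_three,
      Matrix.add_apply, Matrix.sub_apply, Matrix.smul_apply, Matrix.mul_apply, smul_eq_mul]
    fin_cases i <;> fin_cases j <;> simp <;> ring
  have htrq : (A * A).trace = 3 * q := by
    rw [hA, Matrix.trace_smul, Matrix.trace_one]; simp [mul_comm]
  -- Here `q + s = (τ ^ 2 - q) / 2`, and `τ ^ 2` exceeds `q` because it equals `(1/t - 2tq)² + 8q`.
  have hpos : 0 < q + s := by
    have h1 : τ ^ 2 = (1 / t - 2 * t * q) ^ 2 + 8 * q := by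
      rw [htr]; field_simp; ring
    have h2 : 0 < τ := by rw [htr]; positivity
    rw [hs, htrq]
    rcases hq.eq_or_lt with h3 | h3
    · rw [← h3]; nlinarith
    · nlinarith [sq_nonneg (1 / t - 2 * t * q)]
  refine ⟨(A.det + τ * q) / (q + s), ?_⟩
  rw [hA, Matrix.smul_mul, one_mul] at hch
  have h4 : (q + s) • A = (A.det + τ * q) • (1 : Matrix (Fin 3) (Fin 3) ℝ) := by
    rw [add_smul, add_smul, ← hch, smul_smul]; abel
  rw [div_eq_inv_mul, mul_smul, ← h4, smul_smul, inv_mul_cancel₀ hpos.ne', one_smul]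

end Symmetric

/-! ### Self-dual and anti-self-dual blocks of the curvature of Λ²₋ -/

section CurvAlgebra

variable {R : Fin 4 → Fin 4 → Fin 4 → Fin 4 → ℝ}

/-- The Ricci contraction. -/
def ricR (R : Fin 4 → Fin 4 → Fin 4 → Fin 4 → ℝ) (i j : Fin 4) : ℝ := ∑ a, R a i a j

namespace IsCurvTensor

variable (h : IsCurvTensor R)
include h

theorem asdCurv_skew (k : Fin 3) (i j : Fin 4) : asdCurv R j i k = -asdCurv R i j k := by
  fin_cases k <;> simp [asdCurv, h.skew i j] <;> ring

theorem symmetries : (∀ i k l, R i i k l = 0) ∧ (∀ i k l, R k l i i = 0) :=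
  ⟨fun i k l => by linarith [h.skew i i k l], fun i k l => by linarith [h.skew' k l i i]⟩

/-- The self-dual part of the curvature of the bundle of anti-self-dual two-vectors is the
traceless Ricci tensor. -/
theorem sdPart_asdCurv {c : ℝ} (hc : ∀ i j, ricR R i j = if i = j then c else 0) (k l : Fin 3) :
    sdPart (fun i j => asdCurv R i j k) l = 0 := by
  obtain ⟨z, z'⟩ := h.symmetries
  have r00 := hc 0 0
  have r11 := hc 1 1
  have r22 := hc 2 2
  have r33 := hc 3 3
  have r01 := hc 0 1
  have r02 := hc 0 2
  have r03 := hc 0 3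
  have r12 := hc 1 2
  have r23 := hc 2 3
  have r31 := hc 3 1
  simp only [ricR, Fin.sum_univ_four, z, z', if_true, if_false, Fin.reduceEq] at r00 r11 r22 r33 r01 r02 r03 r12 r23 r31
  have s := h.skew
  have s' := h.skew'
  have p := h.pair
  fin_cases k <;> fin_cases l <;> simp [sdPart, asdCurv] <;>
    grind

/-- The anti-self-dual part is symmetric. -/
theorem asdPart_asdCurv_symm (k l : Fin 3) :
    asdPart (fun i j => asdCurv R i j k) l = asdPart (fun i j => asdCurv R i j l) k := by
  have s := h.skew
  have s' := h.skew'
  have p := h.pair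
  fin_cases k <;> fin_cases l <;> simp [asdPart, asdCurv] <;> grind

/-- The diagonal entries contain half the sum of the six sectional curvatures, which is a quarter of
the scalar curvature. The remaining terms form the Bianchi sum of `R 0 1 2 3` and vanish. -/
theorem trace_asdPart : ∑ k, asdPart (fun i j => asdCurv R i j k) k = (∑ i, ricR R i i) / 4 := by
  obtain ⟨z, z'⟩ := h.symmetries
  have s := h.skew
  have s' := h.skew'
  have p := h.pair
  have b := h.bianchi 0 1 2 3
  simp only [Fin.sum_univ_three, Fin.sum_univ_four, ricR, z, z']
  simp [asdPart, asdCurv]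
  grind

end IsCurvTensor

end CurvAlgebra

/-! ### Solving the Einstein equations at the three axes -/

section EinsteinEq

variable {R : Fin 4 → Fin 4 → Fin 4 → Fin 4 → ℝ} {t c : ℝ}

theorem eq_jmat_asdPart {θ : Fin 4 → Fin 4 → ℝ} (hθ : ∀ i j, θ j i = -θ i j)
    (h : ∀ l, sdPart θ l = 0) (i j : Fin 4) : θ i j = jmat (asdPart θ) j i := by
  obtain ⟨p0, p1, p2, p3, p4, p5, p6, p7, p8, p9⟩ := skew_rules hθ
  have h0 := h 0
  have h1 := h 1
  have h2 := h 2
  simp [sdPart] at h0 h1 h2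
  fin_cases i <;> fin_cases j <;> simp [jmat, asdPart, p0, p1, p2, p3, p4, p5, p6, p7, p8, p9] <;>
    linarith

/-- The components of the Einstein equation of the twistor space at the point with axis `m`. -/
structure EinsteinEq (t c : ℝ) (R : Fin 4 → Fin 4 → Fin 4 → Fin 4 → ℝ) (m : Fin 3) : Prop where
  hor : ∀ b d, ricR R b d - t / 2 * ∑ a, (asdCurv R b a (m + 1) * asdCurv R d a (m + 1)
    + asdCurv R b a (m + 2) * asdCurv R d a (m + 2)) = if b = d then c else 0
  ver₁ : 1 / t + t / 4 * ∑ a, ∑ d, asdCurv R a d (m + 1) * asdCurv R a d (m + 1) = c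
  ver₁₂ : ∑ a, ∑ d, asdCurv R a d (m + 1) * asdCurv R a d (m + 2) = 0

/-- The cyclic permutation of the last three indices. -/
def cyc : Equiv.Perm (Fin 4) where
  toFun := ![0, 2, 3, 1]
  invFun := ![0, 3, 1, 2]
  left_inv := by decide
  right_inv := by decide

theorem asdCurv_cyc (i j : Fin 4) (k : Fin 3) :
    asdCurv (fun i j k l => R (cyc i) (cyc j) (cyc k) (cyc l)) i j k =
      asdCurv R (cyc i) (cyc j) (k + 1) := by
  fin_cases k <;> rfl

/-- The cyclic permutation of the last three frame vectors is even and permutes the axes of Λ²₋. It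
suffices therefore to derive the equations at the axis 0 for every frame. -/
theorem EinsteinEq.of_cyc {m : Fin 3}
    (h : EinsteinEq t c (fun i j k l => R (cyc i) (cyc j) (cyc k) (cyc l)) m) :
    EinsteinEq t c R (m + 1) := by
  obtain ⟨h1, h2, h4⟩ := h
  simp only [asdCurv_cyc] at h1 h2 h4
  have e2 : m + 2 + 1 = m + 1 + 2 := by abel
  simp only [e2] at h1 h4
  have hs : ∀ f : Fin 4 → Fin 4 → ℝ, ∑ a, ∑ d, f (cyc a) (cyc d) = ∑ a, ∑ d, f a d := fun f => by
    rw [← Equiv.sum_comp cyc fun a => ∑ d, f a d]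
    exact Finset.sum_congr rfl fun a _ => Equiv.sum_comp cyc fun d => f (cyc a) d
  refine ⟨fun b d => ?_, ?_, ?_⟩
  · have h5 := h1 (cyc.symm b) (cyc.symm d)
    simp only [Equiv.apply_symm_apply, ricR, cyc.symm.injective.eq_iff] at h5
    rw [Equiv.sum_comp cyc fun a => R a b a d, Equiv.sum_comp cyc fun a =>
      asdCurv R b a (m + 1 + 1) * asdCurv R d a (m + 1 + 1) +
        asdCurv R b a (m + 1 + 2) * asdCurv R d a (m + 1 + 2)] at h5
    exact h5
  · rw [← h2, hs fun a d => asdCurv R a d (m + 1 + 1) * asdCurv R a d (m + 1 + 1)]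
  · rw [← h4, hs fun a d => asdCurv R a d (m + 1 + 1) * asdCurv R a d (m + 1 + 2)]

/-- The Einstein equations at the three axes of a frame determine the curvature of the bundle of
anti-self-dual two-vectors. -/
theorem IsCurvTensor.eq_of_einsteinEq (h : IsCurvTensor R) (ht : 0 < t)
    (hE : ∀ m, EinsteinEq t c R m) :
    ∃ κ : ℝ, (∀ i j, ricR R i j = if i = j then 3 * κ else 0) ∧
      (∀ i j k, asdCurv R i j k = κ * jmat (Pi.single k 1) j i) ∧
      c = 1 / t + t * κ ^ 2 ∧ 3 * κ = 1 / t + 2 * t * κ ^ 2 := by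
  have hsk := h.asdCurv_skew
  set A : Fin 3 → Fin 3 → ℝ := fun k => asdPart fun i j => asdCurv R i j k with hA
  set B : Fin 3 → Fin 3 → ℝ := fun k => sdPart fun i j => asdCurv R i j k with hB
  -- The component `k` is the first one orthogonal to the axis `k + 2`, indices being taken modulo
  -- 3.
  have hd : ∀ k, 1 / t + t / 4 * ∑ a, ∑ d, asdCurv R a d k * asdCurv R a d k = c := fun k => by
    have := (hE (k + 2)).ver₁
    rwa [show k + 2 + 1 = k by rw [add_assoc, show (2 + 1 : Fin 3) = 0 from rfl, add_zero]] at this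
  have hne : ∀ k l, k ≠ l → ∑ a, ∑ d, asdCurv R a d k * asdCurv R a d l = 0 := by
    have hsw : ∀ k l, ∑ a, ∑ d, asdCurv R a d k * asdCurv R a d l =
        ∑ a, ∑ d, asdCurv R a d l * asdCurv R a d k := fun k l =>
      Finset.sum_congr rfl fun a _ => Finset.sum_congr rfl fun d _ => mul_comm _ _
    have h0 := (hE 0).ver₁₂
    have h1 := (hE 1).ver₁₂
    have h2 := (hE 2).ver₁₂
    intro k l hkl
    fin_cases k <;> fin_cases l <;> first
      | exact absurd rfl hkl
      | exact h0
      | exact h1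
      | exact h2
      | exact (hsw _ _).trans h0
      | exact (hsw _ _).trans h1
      | exact (hsw _ _).trans h2
  -- At each axis the horizontal equation contains the sum of the other two squares. The three
  -- pairwise sums agree, hence so do the three squares.
  have hP : ∀ k l b d, ∑ a, asdCurv R b a k * asdCurv R d a k =
      ∑ a, asdCurv R b a l * asdCurv R d a l := by
    intro k l b d
    have h0 := (hE 0).hor b d
    have h1 := (hE 1).hor b d
    have h2 := (hE 2).hor b d
    simp only [Finset.sum_add_distrib, zero_add, show (1 + 1 : Fin 3) = 2 from rfl,
      show (1 + 2 : Fin 3) = 0 from rfl, show (2 + 1 : Fin 3) = 0 from rfl,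
      show (2 + 2 : Fin 3) = 1 from rfl] at h0 h1 h2
    set P0 := ∑ a, asdCurv R b a 0 * asdCurv R d a 0
    set P1 := ∑ a, asdCurv R b a 1 * asdCurv R d a 1
    set P2 := ∑ a, asdCurv R b a 2 * asdCurv R d a 2
    have e01 : P0 = P1 := mul_left_cancel₀ (half_pos ht).ne' (by linarith)
    have e12 : P1 = P2 := mul_left_cancel₀ (half_pos ht).ne' (by linarith)
    have key : ∀ k, ∑ a, asdCurv R b a k * asdCurv R d a k = P0 := fun k => by
      fin_cases k
      · rfl
      · exact e01.symm
      · exact (e01.trans e12).symm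
    rw [key, key]
  -- The equality of squares for `k` and `k + 1` gives equal tensors `A ⊗ B`, and their
  -- orthogonality gives inner products of opposite sign.
  have hAB : ∀ k i j, A k i * B k j = 0 := fun k i j => by
    have hkl : k ≠ k + 1 := by fin_cases k <;> decide
    refine mul_eq_zero_of_tensor (fun i j => asdPart_mul_sdPart (hsk k) (hsk (k + 1))
      (hP k (k + 1)) i j) ?_ i j
    have h1 := hne k (k + 1) hkl
    rw [sum_mul_eq (hsk k) (hsk (k + 1))] at h1
    linarith
  -- The common value of `|A_k|² + |B_k|²`, as read off from the vertical equation.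
  set q := (c - 1 / t) / t with hq
  have hPk : ∀ k b d, ∑ a, asdCurv R b a k * asdCurv R d a k = if b = d then q else 0 :=
    fun k b d => by
    rw [sum_mul_of_mixed_eq_zero (hsk k) (hAB k)]
    congr 1
    have h1 := hd k
    rw [sum_mul_eq (hsk k) (hsk k)] at h1
    rw [hq, ← h1]
    field_simp
    ring
  have hc : c = 1 / t + t * q := by rw [hq]; field_simp; ring
  have hric : ∀ i j, ricR R i j = if i = j then 1 / t + 2 * t * q else 0 := fun i j => by
    have h1 := (hE 0).hor i j
    rw [Finset.sum_add_distrib, hPk, hPk] at h1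
    split_ifs at h1 ⊢ <;> linarith
  -- Scalar squares in the horizontal equation have made the Ricci tensor scalar, and `B` is its
  -- traceless part.
  have hB0 : ∀ k l, B k l = 0 := fun k l => h.sdPart_asdCurv hric k l
  have hAA : (Matrix.of A) * (Matrix.of A) = q • (1 : Matrix (Fin 3) (Fin 3) ℝ) := by
    ext k l
    have hs : ∀ i, A i l = A l i := fun i => h.asdPart_asdCurv_symm i l
    simp only [Matrix.mul_apply, Matrix.of_apply, hs, Matrix.smul_apply, Matrix.one_apply,
      smul_eq_mul]
    have h1 := sum_mul_eq (hsk k) (hsk l)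
    have h2 : ∑ i, sdPart (fun i j => asdCurv R i j k) i * sdPart (fun i j => asdCurv R i j l) i
        = 0 := Finset.sum_eq_zero fun i _ => mul_eq_zero_of_left (hB0 k i) _
    rw [h2, add_zero] at h1
    by_cases hkl : k = l
    · subst hkl
      simp only [hPk, if_true, Finset.sum_const, Finset.card_univ, Fintype.card_fin] at h1
      simp only [if_true, mul_one]
      rw [nsmul_eq_mul] at h1
      push_cast at h1
      linarith
    · rw [hne k l hkl] at h1
      simp only [hkl, if_false, mul_zero]
      linarith
  have htr : (Matrix.of A).trace = 1 / t + 2 * t * q := by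
    have h1 := h.trace_asdPart
    simp only [hric, if_true, Finset.sum_const, Finset.card_univ, Fintype.card_fin,
      nsmul_eq_mul] at h1
    push_cast at h1
    calc (Matrix.of A).trace = ∑ k, A k k := rfl
      _ = _ := by rw [h1]; ring
  have hq0 : 0 ≤ q := by
    have := hPk 0 0 0
    rw [if_pos rfl] at this
    rw [← this]
    exact Finset.sum_nonneg fun a _ => mul_self_nonneg _
  obtain ⟨κ, hκ⟩ := eq_smul_one_of_sq ht hAA htr hq0
  have hκq : κ ^ 2 = q := by
    have h1 := congrFun (congrFun hAA 0) 0
    rw [hκ] at h1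
    simpa [sq] using h1
  have h3κ : 3 * κ = 1 / t + 2 * t * q := by
    rw [← htr, hκ, Matrix.trace_smul, Matrix.trace_one]
    simp [mul_comm]
  refine ⟨κ, fun i j => by rw [hric, h3κ], fun i j k => ?_, by rw [hκq, hc], by rw [hκq, h3κ]⟩
  have h1 := eq_jmat_asdPart (hsk k) (hB0 k) i j
  have h2 : asdPart (fun i j => asdCurv R i j k) = κ • Pi.single k 1 := by
    funext l
    have := congrFun (congrFun hκ k) l
    rw [Matrix.smul_apply, Matrix.one_apply] at this
    refine Eq.trans this ?_
    simp [Pi.single_apply, eq_comm]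
  rw [h1, h2]
  fin_cases i <;> fin_cases j <;> simp [jmat]

end EinsteinEq

/-! ### Locality and symmetry of the Ricci coefficients -/

section Congr

variable {n : ℕ} {G G' : E n → Matrix (Fin n) (Fin n) ℝ} {U : Set (E n)} {x : E n}

theorem christoffel_congr (h : G =ᶠ[𝓝 x] G') (k i j : Fin n) :
    christoffel G k i j x = christoffel G' k i j x := by
  have hp : ∀ i a b, pderiv i (fun y => G y a b) x = pderiv i (fun y => G' y a b) x :=
    fun i a b => pderiv_congr i (h.mono fun y hy => by simp only [hy])
  simp only [christoffel, hp, h.self_of_nhds]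

theorem ricciCoeff_congr (h : G =ᶠ[𝓝 x] G') (j k : Fin n) :
    ricciCoeff G j k x = ricciCoeff G' j k x := by
  have hc : ∀ k i j, christoffel G k i j =ᶠ[𝓝 x] christoffel G' k i j := fun k i j =>
    h.eventuallyEq_nhds.mono fun y hy => christoffel_congr hy k i j
  have hp : ∀ l k i j, pderiv l (christoffel G k i j) x = pderiv l (christoffel G' k i j) x :=
    fun l k i j => pderiv_congr l (hc k i j)
  simp only [ricciCoeff, curvatureCoeff, hp, fun k i j => (hc k i j).self_of_nhds]

/-- Supplies the vertical-horizontal block of the Ricci tensor from the horizontal-vertical one. -/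
theorem IsMetricOn.ricci_symm_of_eq_one (hG : IsMetricOn U G) (hx : x ∈ U) (h1 : G x = 1)
    (j k : Fin n) : ricciCoeff G j k x = ricciCoeff G k j x := by
  have hl : ∀ i a b, lowC G i x a b = lowC G b x a i := fun i a b => by
    simp only [lowC, Matrix.of_apply]
    rw [hG.pderiv_symm hx a i b]
    ring
  rw [hG.ricci_of_eq_one hx h1, hG.ricci_of_eq_one hx h1]
  refine Finset.sum_congr rfl fun i _ => ?_
  rw [hG.pderiv2_symm hx i i j k, pderiv_comm hG.isOpen (hG.smooth i i) hx j k]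
  congr 1
  · ring
  · refine Finset.sum_congr rfl fun a _ => ?_
    rw [hl j a i, hl i a k, hl j a k]
    ring

end Congr

/-! ### The Weyl tensor of an Einstein metric on the base -/

section Base

variable {M : Type u} [TopologicalSpace M] [ChartedSpace (E 4) M] [IsManifold (𝓡 4) ∞ M]
  {g : Metric M} {o : ManifoldOrientation M} {p : M} {b : Module.Basis (Fin 4) ℝ (E 4)} {κ : ℝ}

theorem IsFrame.ricForm_eq (hb : IsFrame g o p b)
    (hric : ∀ i j, ricForm g p (b i) (b j) = if i = j then κ else 0) (x y : E 4) :
    ricForm g p x y = κ * Twistor.gform g p x y := by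
  rw [hb.expand x, hb.expand y, ricForm_sum, hb.gform_sum]
  simp [hric, Finset.mul_sum]
  exact Finset.sum_congr rfl fun i _ => by ring

/-- The Ricci operator is `3κ`, so the traceless Ricci term is `6κ - s/2 = 0`. The scalar part is
`s/6 = 2κ`, halved by the normalization of the metric on two-vectors. -/
theorem weylForm_eq (hric : ∀ x y, ricForm g p x y = 3 * κ * gform g p x y)
    (hs : scalarCurvature g p = 12 * κ) (x y z w : E 4) :
    weylForm g p x y z w = gform g p (curvOp g p x y z) w -
      κ * (gform g p x z * gform g p y w - gform g p x w * gform g p y z) := by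
  have h1 : weylForm g p x y z w = gform g p (curvOp g p x y z) w -
      scalarCurvature g p / 6 * ((1 / 2) * (gform g p x z * gform g p y w -
        gform g p x w * gform g p y z)) -
      ((1 / 2) * (ricForm g p x z * gform g p y w - ricForm g p x w * gform g p y z)
        + (1 / 2) * (gform g p x z * ricForm g p y w - gform g p x w * ricForm g p y z)
        - scalarCurvature g p / 2 * ((1 / 2) * (gform g p x z * gform g p y w -
          gform g p x w * gform g p y z))) := rfl
  rw [h1, hs]
  simp only [hric]
  ring

theorem IsFrame.weylForm_basis (hb : IsFrame g o p b)
    (hric : ∀ x y, ricForm g p x y = 3 * κ * Twistor.gform g p x y)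
    (hs : scalarCurvature g p = 12 * κ) (i j k l : Fin 4) :
    weylForm g p (b i) (b j) (b k) (b l) = rm g p b i j k l -
      κ * ((if i = k then 1 else 0) * (if j = l then 1 else 0) -
        (if i = l then 1 else 0) * (if j = k then 1 else 0)) := by
  have h1 := weylForm_eq hric hs (b i) (b j) (b k) (b l)
  rw [hb.gform, hb.gform, hb.gform, hb.gform] at h1
  exact h1

theorem IsFrame.weylForm_expand (hb : IsFrame g o p b)
    (hric : ∀ x y, ricForm g p x y = 3 * κ * Twistor.gform g p x y)
    (hs : scalarCurvature g p = 12 * κ) (i j : Fin 4) (z w : E 4) :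
    weylForm g p (b i) (b j) z w = ∑ k, ∑ l, Twistor.gform g p z (b k) * Twistor.gform g p w (b l) *
      weylForm g p (b i) (b j) (b k) (b l) := by
  simp only [hb.weylForm_basis hric hs]
  refine (weylForm_eq hric hs (b i) (b j) z w).trans ?_
  conv_lhs => rw [hb.expand z, hb.expand w, curvOp_sum₃]
  simp only [map_sum, map_smul, FunLike.coe_sum, Finset.sum_apply, FunLike.coe_smul,
    Pi.smul_apply, smul_eq_mul, hb.gform, mul_sub, Finset.sum_sub_distrib, Finset.mul_sum]
  congr 1
  · rw [Finset.sum_comm]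
    refine Finset.sum_congr rfl fun k _ => Finset.sum_congr rfl fun l _ => ?_
    rw [rm]; ring
  · simp
    ring

/-- Self-duality of an Einstein metric in terms of the curvature of the bundle of anti-self-dual
two-vectors. -/
theorem IsFrame.asdCurv_iff (hb : IsFrame g o p b)
    (hric : ∀ x y, ricForm g p x y = 3 * κ * Twistor.gform g p x y)
    (hs : scalarCurvature g p = 12 * κ) :
    (∀ i j k, asdCurv (rm g p b) i j k = κ * jmat (Pi.single k 1) j i) ↔
      ∀ k l, weylForm g p (b 0) (b 1) (b k) (b l) - weylForm g p (b 2) (b 3) (b k) (b l) = 0 ∧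
        weylForm g p (b 0) (b 2) (b k) (b l) - weylForm g p (b 3) (b 1) (b k) (b l) = 0 ∧
        weylForm g p (b 0) (b 3) (b k) (b l) - weylForm g p (b 1) (b 2) (b k) (b l) = 0 := by
  -- Pair symmetry moves the anti-self-dual combination from the first two indices, where `weylForm`
  -- has it, to the last two, where `asdCurv` has it.
  have hp := hb.isCurvTensor.pair
  have key : ∀ i j, (weylForm g p (b 0) (b 1) (b i) (b j) - weylForm g p (b 2) (b 3) (b i) (b j) =
        asdCurv (rm g p b) i j 0 - κ * jmat (Pi.single 0 1) j i) ∧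
      (weylForm g p (b 0) (b 2) (b i) (b j) - weylForm g p (b 3) (b 1) (b i) (b j) =
        asdCurv (rm g p b) i j 1 - κ * jmat (Pi.single 1 1) j i) ∧
      (weylForm g p (b 0) (b 3) (b i) (b j) - weylForm g p (b 1) (b 2) (b i) (b j) =
        asdCurv (rm g p b) i j 2 - κ * jmat (Pi.single 2 1) j i) := fun i j => by
    simp only [hb.weylForm_basis hric hs]
    rw [hp i j 0 1, hp i j 2 3, hp i j 0 2, hp i j 3 1, hp i j 0 3, hp i j 1 2]
    simp only [asdCurv]
    generalize rm g p b i j = Q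
    refine ⟨?_, ?_, ?_⟩ <;> fin_cases i <;> fin_cases j <;> simp [jmat] <;> ring
  constructor
  · intro h k l
    obtain ⟨h0, h1, h2⟩ := key k l
    rw [h0, h1, h2, h, h, h]
    simp
  · intro h i j k
    obtain ⟨h0, h1, h2⟩ := key i j
    obtain ⟨w0, w1, w2⟩ := h i j
    fin_cases k
    · exact sub_eq_zero.1 (h0.symm.trans w0)
    · exact sub_eq_zero.1 (h1.symm.trans w1)
    · exact sub_eq_zero.1 (h2.symm.trans w2)

end Base

section Indices

theorem one_hor_hor (i j : Fin 4) :
    (1 : Matrix (Fin 6) (Fin 6) ℝ) (hor i) (hor j) = if i = j then 1 else 0 := by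
  fin_cases i <;> fin_cases j <;> rfl

theorem one_hor_ver (i : Fin 4) (α : Fin 2) :
    (1 : Matrix (Fin 6) (Fin 6) ℝ) (hor i) (ver α) = 0 := by
  fin_cases i <;> fin_cases α <;> rfl

theorem one_ver_hor (i : Fin 4) (α : Fin 2) :
    (1 : Matrix (Fin 6) (Fin 6) ℝ) (ver α) (hor i) = 0 := by
  fin_cases i <;> fin_cases α <;> rfl

theorem one_ver_ver (α β : Fin 2) :
    (1 : Matrix (Fin 6) (Fin 6) ℝ) (ver α) (ver β) = if α = β then 1 else 0 := by
  fin_cases α <;> fin_cases β <;> rfl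

theorem sum_jmat_mul (k : Fin 3) (i j : Fin 4) :
    ∑ a, jmat (Pi.single k 1) a i * jmat (Pi.single k 1) a j = if i = j then 1 else 0 := by
  fin_cases k <;> fin_cases i <;> fin_cases j <;> simp [jmat, Fin.sum_univ_four]

theorem sum_sum_jmat_mul (k l : Fin 3) :
    ∑ a, ∑ d, jmat (Pi.single k 1) d a * jmat (Pi.single l 1) d a = if k = l then 4 else 0 := by
  fin_cases k <;> fin_cases l <;> simp [jmat, Fin.sum_univ_four] <;> norm_num

end Indices

/-! ### The Einstein condition on the twistor space -/

section Einstein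

variable {M : Type u} [TopologicalSpace M] [ChartedSpace (E 4) M] [IsManifold (𝓡 4) ∞ M]
  {g : Metric M} {o : ManifoldOrientation M} {p : M} {b : Module.Basis (Fin 4) ℝ (E 4)}
  {ψ : E 4 → M} {U V : Set (E 4)} {F : E 4 → Matrix (Fin 4) (Fin 4) ℝ} {r c κ : ℝ}

namespace IsTwistorChart

theorem bundleMetric_zero {b : Fin 4 → E 4} (h : IsTwistorChart g o p b ψ U V F) (hr : 0 < r) :
    bundleMetric r (baseMetric g ψ) (frameForm (baseMetric g ψ) F) 0 = 1 :=
  Twistor.bundleMetric_zero hr h.normal.metric_one h.frameForm_zero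

variable (hb : IsFrame g o p b) (h : IsTwistorChart g o p b ψ U V F) (hr : 0 < r)
include hb h hr

theorem ricci_hor (i j : Fin 4) :
    ricciCoeff (bundleMetric r (baseMetric g ψ) (frameForm (baseMetric g ψ) F)) (hor i) (hor j) 0 =
      ricR (rm g p b) i j - r ^ 2 / 2 * ∑ a, (asdCurv (rm g p b) i a 1 * asdCurv (rm g p b) j a 1 +
        asdCurv (rm g p b) i a 2 * asdCurv (rm g p b) j a 2) := by
  rw [bundleMetric_ricci_hor hr (h.isOrthoFrame.metric.mono h.frame.isOpen h.subset)
    h.isOrthoFrame.frameForm_smooth h.frame.zero_mem h.normal.metric_one h.frameForm_zero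
    h.normal.metric_flat, ← h.ric_eq, hb.ric_eq]
  simp only [h.dConn_frameForm]
  rfl

omit hb in
theorem ricci_ver (α β : Fin 2) :
    ricciCoeff (bundleMetric r (baseMetric g ψ) (frameForm (baseMetric g ψ) F)) (ver α) (ver β) 0 =
      1 / r ^ 2 * (if α = β then 1 else 0) + r ^ 2 / 4 * ∑ a, ∑ d,
        ((![asdCurv (rm g p b) a d 2, -asdCurv (rm g p b) a d 1] : Fin 2 → ℝ) α *
          (![asdCurv (rm g p b) a d 2, -asdCurv (rm g p b) a d 1] : Fin 2 → ℝ) β) := by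
  rw [bundleMetric_ricci_ver hr (h.isOrthoFrame.metric.mono h.frame.isOpen h.subset)
    h.isOrthoFrame.frameForm_smooth h.frame.zero_mem h.normal.metric_one h.frameForm_zero
    h.normal.metric_flat]
  simp only [h.dConn_frameForm]

/-- Only the horizontal and vertical blocks are extracted; the mixed block carries no information
needed for the algebra. -/
theorem einsteinEq (hc : ∀ I J : Fin 6,
    ricciCoeff (bundleMetric r (baseMetric g ψ) (frameForm (baseMetric g ψ) F)) I J 0 =
      c * bundleMetric r (baseMetric g ψ) (frameForm (baseMetric g ψ) F) 0 I J) :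
    EinsteinEq (r ^ 2) c (rm g p b) 0 := by
  rw [h.bundleMetric_zero hr] at hc
  have hv := fun α β => (h.ricci_ver hr α β).symm.trans (hc (ver α) (ver β))
  simp only [one_ver_ver] at hv
  refine ⟨fun i j => ?_, ?_, ?_⟩
  · have := (h.ricci_hor hb hr i j).symm.trans (hc (hor i) (hor j))
    rw [one_hor_hor, mul_ite, mul_one, mul_zero] at this
    exact this
  · have := hv 1 1
    simpa using this
  · have := hv 0 1
    simp only [Matrix.cons_val_zero, Matrix.cons_val_one, mul_neg, Finset.sum_neg_distrib,
      zero_ne_one, if_false, mul_zero, zero_add, neg_eq_zero, mul_eq_zero] at this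
    rcases this with h1 | h1
    · exact absurd h1 (by positivity)
    · simpa only [zero_add, mul_comm] using h1

/-- The Ricci tensor of the twistor space of a self-dual Einstein manifold. -/
theorem ricci_bundleMetric (hκ : ∀ x ∈ V, ∀ i j k,
    asdCurv (rm g (ψ x) (frameVec ψ F x)) i j k = κ * jmat (Pi.single k 1) j i)
    (hric : ∀ i j, ricR (rm g p b) i j = if i = j then 3 * κ else 0)
    (h3 : 3 * κ = 1 / r ^ 2 + 2 * r ^ 2 * κ ^ 2) (I J : Fin 6) :
    ricciCoeff (bundleMetric r (baseMetric g ψ) (frameForm (baseMetric g ψ) F)) I J 0 =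
      (1 / r ^ 2 + r ^ 2 * κ ^ 2) *
        bundleMetric r (baseMetric g ψ) (frameForm (baseMetric g ψ) F) 0 I J := by
  have hκ0 : ∀ i j k, asdCurv (rm g p b) i j k = κ * jmat (Pi.single k 1) j i := by
    have := hκ 0 h.frame.zero_mem
    rwa [funext h.frameVec_zero, h.normal.map_zero] at this
  obtain ⟨W, -, h0W, -, hW⟩ := h.exists_isLocalParam_lift hr
  -- Each summand of the divergence vanishes separately, the curvature being constant to first
  -- order.
  have hmix : ∀ i δ, ricciCoeff (bundleMetric r (baseMetric g ψ)
      (frameForm (baseMetric g ψ) F)) (hor i) (ver δ) 0 = 0 := fun i δ =>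
    bundleMetric_ricci_mixed hr (h.isOrthoFrame.metric.mono h.frame.isOpen h.subset)
      h.isOrthoFrame.frameForm_smooth h.frame.zero_mem h.normal.metric_one h.frameForm_zero
      h.normal.metric_flat i δ fun k => Finset.sum_eq_zero fun a _ =>
        h.divergence_frameForm hκ a i k
  rw [h.bundleMetric_zero hr]
  refine Fin.addCases (m := 4) (n := 2) (fun i => ?_) (fun α => ?_) I <;>
  refine Fin.addCases (m := 4) (n := 2) (fun j => ?_) (fun β => ?_) J
  · refine (h.ricci_hor hb hr i j).trans ?_
    have h1 : ∀ k, ∑ a, asdCurv (rm g p b) i a k * asdCurv (rm g p b) j a k =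
        κ ^ 2 * if i = j then 1 else 0 := fun k => by
      rw [← sum_jmat_mul k, Finset.mul_sum]
      exact Finset.sum_congr rfl fun a _ => by rw [hκ0, hκ0]; ring
    refine Eq.trans ?_ (congrArg _ (one_hor_hor i j).symm)
    rw [Finset.sum_add_distrib, h1, h1, hric]
    -- The horizontal eigenvalue is `3κ - r²κ²`; the quadratic equation for κ equates it with the
    -- vertical one, `1/r² + r²κ²`.
    split_ifs
    · rw [h3]; ring
    · ring
  · refine (hmix i β).trans ?_
    exact (mul_eq_zero_of_right _ (one_hor_ver i β)).symm
  · refine (hW.ricci_symm_of_eq_one h0W (h.bundleMetric_zero hr) _ _).trans ((hmix j α).trans ?_)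
    exact (mul_eq_zero_of_right _ (one_ver_hor j α)).symm
  · refine (h.ricci_ver hr α β).trans ?_
    refine Eq.trans ?_ (congrArg _ (one_ver_ver α β).symm)
    have h1 : ∀ k l, ∑ a, ∑ d, asdCurv (rm g p b) a d k * asdCurv (rm g p b) a d l =
        κ ^ 2 * if k = l then 4 else 0 := fun k l => by
      rw [← sum_sum_jmat_mul k l, Finset.mul_sum]
      refine Finset.sum_congr rfl fun a _ => ?_
      rw [Finset.mul_sum]
      exact Finset.sum_congr rfl fun d _ => by rw [hκ0, hκ0]; ring
    fin_cases α <;> fin_cases β <;> simp [h1] <;> ring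

end IsTwistorChart

/-- For each frame the Einstein condition is tested on one local parametrization, the adapted lift
at its centre. Running through the cyclic permutations of the frame visits the three axes in the
fibre over `p`. -/
theorem IsFrame.einsteinEq {t : ℝ} (ht : 0 < t) (hb : IsFrame g o p b)
    (hc : ∀ (Ψ : E 6 → EndBundle M) (W : Set (E 6)), IsLocalParam endModel (twistorSpace g o) Ψ W →
      ∀ y ∈ W, ∀ i j : Fin 6, ricciCoeff (pullbackCoeff endModel (twistorMetric g t) Ψ) i j y =
        c * pullbackCoeff endModel (twistorMetric g t) Ψ y i j) :
    ∀ m, EinsteinEq t c (rm g p b) m := by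
  have hr : 0 < √t := Real.sqrt_pos.2 ht
  have hr2 : √t ^ 2 = t := Real.sq_sqrt ht.le
  have key : ∀ b : Module.Basis (Fin 4) ℝ (E 4), IsFrame g o p b →
      EinsteinEq t c (rm g p b) 0 := fun b hb => by
    obtain ⟨ψ, U, V, F, h⟩ := exists_isTwistorChart g o hb
    obtain ⟨W, hW, h0W, hsub, -⟩ := h.exists_isLocalParam_lift hr
    have h1 := hc _ W hW 0 h0W
    have h2 : ∀ y ∈ W, pullbackCoeff endModel (twistorMetric g t) (lift g ψ F √t) y =
        bundleMetric √t (baseMetric g ψ) (frameForm (baseMetric g ψ) F) y := fun y hy => by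
      have := pullbackCoeff_lift hr h.normal.param h.isOrthoFrame (hsub hy)
      rwa [hr2] at this
    have h3 := h.einsteinEq hb hr (c := c) fun I J => by
      rw [← h2 0 h0W, ← h1,
        ricciCoeff_congr (Filter.eventuallyEq_of_mem (hW.isOpen.mem_nhds h0W) h2)]
    rwa [hr2] at h3
  have step : ∀ m, (∀ b : Module.Basis (Fin 4) ℝ (E 4), IsFrame g o p b →
      EinsteinEq t c (rm g p b) m) → ∀ b : Module.Basis (Fin 4) ℝ (E 4), IsFrame g o p b →
      EinsteinEq t c (rm g p b) (m + 1) := fun m hm b hb => by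
    obtain ⟨b', hb', e'⟩ := hb.cycle
    refine EinsteinEq.of_cyc ?_
    have := hm b' hb'
    convert this using 5 with i j k l
    simp only [rm, e']
    rfl
  intro m
  fin_cases m
  · exact key b hb
  · exact step 0 key b hb
  · exact step 1 (step 0 key) b hb

/-- The curvature of a manifold with Einstein twistor space. -/
theorem exists_curvature_of_isEinstein [Nonempty M] {t : ℝ} (ht : 0 < t)
    (hE : IsEinstein endModel 6 (twistorSpace g o) (twistorMetric g t)) :
    ∃ κ : ℝ, (κ = 1 / (2 * t) ∨ κ = 1 / t) ∧
      ∀ (p : M) (b : Module.Basis (Fin 4) ℝ (E 4)), IsFrame g o p b →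
        (∀ i j, ricForm g p (b i) (b j) = if i = j then 3 * κ else 0) ∧
        ∀ i j k, asdCurv (rm g p b) i j k = κ * jmat (Pi.single k 1) j i := by
  obtain ⟨-, c, hc⟩ := hE
  have key : ∀ (p : M) (b : Module.Basis (Fin 4) ℝ (E 4)), IsFrame g o p b →
      ∃ κ : ℝ, (∀ i j, ricForm g p (b i) (b j) = if i = j then 3 * κ else 0) ∧
        (∀ i j k, asdCurv (rm g p b) i j k = κ * jmat (Pi.single k 1) j i) ∧
        c = 1 / t + t * κ ^ 2 ∧ 3 * κ = 1 / t + 2 * t * κ ^ 2 := fun p b hb => by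
    obtain ⟨κ, h1, h2⟩ := hb.isCurvTensor.eq_of_einsteinEq ht (hb.einsteinEq ht hc)
    exact ⟨κ, fun i j => by rw [hb.ric_eq]; exact h1 i j, h2⟩
  obtain ⟨p₀⟩ := ‹Nonempty M›
  obtain ⟨b₀, hb₀⟩ := exists_isFrame g o p₀
  obtain ⟨κ, -, -, h1, h2⟩ := key p₀ b₀ hb₀
  refine ⟨κ, ?_, fun p b hb => ?_⟩
  · have h3 : (κ - 1 / (2 * t)) * (κ - 1 / t) = 0 := by
      have h4 : 2 * t * ((κ - 1 / (2 * t)) * (κ - 1 / t)) = 0 := by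
        have : 2 * t * ((κ - 1 / (2 * t)) * (κ - 1 / t)) = 1 / t + 2 * t * κ ^ 2 - 3 * κ := by
          field_simp; ring
        rw [this, h2]; ring
      exact (mul_eq_zero.1 h4).resolve_left (by positivity)
    exact (mul_eq_zero.1 h3).imp sub_eq_zero.1 sub_eq_zero.1
  · obtain ⟨κ', e1, e2, e3, e4⟩ := key p b hb
    -- The two equations combine to `3κ = 2c - 1/t`, so the Einstein constant of the twistor space
    -- determines κ at every point.
    obtain rfl : κ' = κ := by linarith
    exact ⟨e1, e2⟩

/-- The Ricci tensor is computed at the centre of an adapted lift and carried to an arbitrary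
parametrization by tensoriality, each point of the latter being made the centre of a lift in turn.
-/
theorem isEinstein_of_curvature {t : ℝ} (ht : 0 < t)
    (h3 : 3 * κ = 1 / t + 2 * t * κ ^ 2)
    (hκ : ∀ (p : M) (b : Module.Basis (Fin 4) ℝ (E 4)), IsFrame g o p b →
        (∀ i j, ricForm g p (b i) (b j) = if i = j then 3 * κ else 0) ∧
        ∀ i j k, asdCurv (rm g p b) i j k = κ * jmat (Pi.single k 1) j i) :
    IsEinstein endModel 6 (twistorSpace g o) (twistorMetric g t) := by
  have hr : 0 < √t := Real.sqrt_pos.2 ht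
  have hr2 : √t ^ 2 = t := Real.sq_sqrt ht.le
  refine ⟨fun σ hσ => ?_, 1 / t + t * κ ^ 2, fun Ψ W₀ hΨ y₀ hy₀ i j => ?_⟩
  · obtain ⟨b, hb, hm⟩ := exists_adapted hσ
    obtain ⟨ψ, U, V, F, h⟩ := exists_isTwistorChart g o hb
    obtain ⟨W, hW, h0W, -, -⟩ := h.exists_isLocalParam_lift hr
    exact ⟨_, W, hW, 0, h0W, h.lift_zero rfl hm⟩
  · obtain ⟨b, hb, hm⟩ := exists_adapted (hΨ.mapsTo hy₀)
    obtain ⟨ψ, U, V, F, h⟩ := exists_isTwistorChart g o hb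
    obtain ⟨W, hW, h0W, hsub, hmet⟩ := h.exists_isLocalParam_lift hr
    obtain ⟨W', φ, hyW, hφ0, hφ⟩ := h.exists_isCoordChange hr hΨ hy₀ rfl hm hW.isOpen h0W hsub
    have h1 := h.ricci_bundleMetric hb hr (κ := κ) (fun x hx i j k => by
      obtain ⟨b', hb', e'⟩ := h.oriented x hx
      rw [← funext e']
      exact (hκ _ b' hb').2 i j k) (fun i j => by
      rw [← (hκ _ b hb).1 i j, hb.ric_eq]; rfl) (by rw [hr2]; exact h3)
    rw [hr2] at hφ h1
    rw [hφ.ricci hmet hyW, hφ.pull _ hyW, hφ0]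
    simp only [h1, Matrix.mul_apply, Matrix.transpose_apply, Finset.mul_sum, Finset.sum_mul]
    rw [Finset.sum_comm]
    exact Finset.sum_congr rfl fun a _ => Finset.sum_congr rfl fun d _ => by ring

theorem isEinstein_base (hκ : ∀ (p : M) (x y : E 4), ricForm g p x y = κ * gform g p x y) :
    IsEinstein (𝓡 4) 4 (Set.univ : Set M) (metricForm g) := by
  refine ⟨fun q _ => ⟨(chartAt (E 4) q).symm, _, isParam_chart_symm q, chartAt (E 4) q q,
    mem_chart_target _ q, (chartAt (E 4) q).left_inv (mem_chart_source _ q)⟩, κ,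
    fun ψ U hψ x hx i j => ?_⟩
  exact (ricci_dmap g hψ hx i j).symm.trans (hκ _ _ _)

theorem ricForm_of_isEinstein (hE : IsEinstein (𝓡 4) 4 (Set.univ : Set M) (metricForm g)) :
    ∃ c : ℝ, ∀ (p : M) (b : Module.Basis (Fin 4) ℝ (E 4)), IsFrame g o p b →
      ∀ i j, ricForm g p (b i) (b j) = if i = j then c else 0 := by
  obtain ⟨-, c, hc⟩ := hE
  refine ⟨c, fun p b hb i j => ?_⟩
  obtain ⟨ψ, U, V, F, h⟩ := exists_isTwistorChart g o hb
  rw [h.ric_eq]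
  refine (hc ψ U h.normal.param 0 h.normal.zero_mem i j).trans ?_
  rw [show pullbackCoeff (𝓡 4) (metricForm g) ψ 0 = 1 from h.normal.metric_one, Matrix.one_apply]
  simp

theorem IsFrame.scalarCurvature_of_ricForm (hb : IsFrame g o p b)
    (hric : ∀ i j, ricForm g p (b i) (b j) = if i = j then c else 0) :
    scalarCurvature g p = 4 * c := by
  rw [hb.scalarCurvature_eq]
  simp [hric]

end Einstein

end Twistor

end

theorem theorem3p5 {M : Type*} [TopologicalSpace M] [ChartedSpace (Twistor.E 4) M]
    [IsManifold (𝓡 4) ∞ M] [ConnectedSpace M] (g : Twistor.Metric M)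
    (o : Twistor.ManifoldOrientation M) (t : ℝ) (ht : 0 < t) :
    Twistor.IsEinstein Twistor.endModel 6 (Twistor.twistorSpace g o) (Twistor.twistorMetric g t) ↔
      Twistor.IsSelfDual g o ∧
      Twistor.IsEinstein (𝓡 4) 4 (Set.univ : Set M) (Twistor.metricForm g) ∧
      ((∀ p : M, Twistor.scalarCurvature g p = 6 / t) ∨
        (∀ p : M, Twistor.scalarCurvature g p = 12 / t)) := by
  open Twistor in
  constructor
  · intro hE
    obtain ⟨κ, hκ, h⟩ := exists_curvature_of_isEinstein ht hE
    have hric : ∀ (p : M) (x y : E 4), ricForm g p x y = 3 * κ * gform g p x y := fun p => by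
      obtain ⟨b, hb⟩ := exists_isFrame g o p
      exact hb.ricForm_eq (h p b hb).1
    have hs : ∀ p : M, scalarCurvature g p = 12 * κ := fun p => by
      obtain ⟨b, hb⟩ := exists_isFrame g o p
      rw [hb.scalarCurvature_of_ricForm (h p b hb).1]
      ring
    refine ⟨fun p b hb Z U => ?_, isEinstein_base hric, ?_⟩
    · have hb' : IsFrame g o p b := hb
      have h1 := (hb'.asdCurv_iff (hric p) (hs p)).1 (h p b hb').2
      -- Self-duality quantifies over all vectors `Z`, `U`; bilinearity reduces it to the basis
      -- vectors, where `asdCurv_iff` applies.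
      have h2 := fun i j => hb'.weylForm_expand (hric p) (hs p) i j Z U
      refine ⟨?_, ?_, ?_⟩
      all_goals
        refine (congrArg₂ (· - ·) (h2 _ _) (h2 _ _)).trans ?_
        simp only [← Finset.sum_sub_distrib, ← mul_sub, h1, mul_zero, Finset.sum_const_zero]
    · rcases hκ with rfl | rfl
      · left; intro p; rw [hs]; field_simp; norm_num
      · right; intro p; rw [hs]; field_simp
  · rintro ⟨hsd, hE, hs⟩
    obtain ⟨c, hc⟩ := ricForm_of_isEinstein (o := o) hE
    have hs' : ∀ p : M, scalarCurvature g p = 4 * c := fun p => by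
      obtain ⟨b, hb⟩ := exists_isFrame g o p
      exact hb.scalarCurvature_of_ricForm (hc p b hb)
    obtain ⟨p₀⟩ : Nonempty M := inferInstance
    -- The Ricci constant is `c = s/4`, so κ is `c/3 = s/12`; the two admissible values of `s` are
    -- exactly those for which it solves the quadratic equation.
    have hc' : 3 * (c / 3) = 1 / t + 2 * t * (c / 3) ^ 2 := by
      have h2 := hs' p₀
      rcases hs with hs | hs
      · have : c = 3 / (2 * t) := by rw [hs] at h2; field_simp at h2 ⊢; linarith
        rw [this]; field_simp; norm_num
      · have : c = 3 / t := by rw [hs] at h2; field_simp at h2 ⊢; linarith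
        rw [this]; field_simp; norm_num
    refine isEinstein_of_curvature (κ := c / 3) ht hc' fun p b hb => ?_
    have h3 : 3 * (c / 3) = c := by ring
    refine ⟨fun i j => by rw [h3]; exact hc p b hb i j, ?_⟩
    refine (hb.asdCurv_iff (κ := c / 3) (by rw [h3]; exact hb.ricForm_eq (hc p b hb))
      (by rw [hs']; ring)).2 fun k l => ?_
    exact hsd p b hb (b k) (b l)
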